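/- Graphs are finite and loopless but may have parallel edges. Let $G=(V+r,E)$ be a rooted graph, i.e. a graph with vertex set $V\cup\{r\}$ ($r\notin V$) and root $r$, let $k\ge 1$ be an integer, and suppose $|V|\ge 2k-2$. A tree $T$ with vertex set $U+r$ is *$(r,k)$-safe* if $|U\setminus V(C_T^v)|\ge k$ for every $v\in U$, where $C_T^v$ is obtained from $T-v$ by deleting the component containing $r$. Let $L_G$ be the set of vertices $v\in V$ that have at least $8k-7$ distinct neighbours in $G$. A *compact $(r,k)$-certificate* is a subgraph $X=(V'+r,E')$ of $G$, with $V'\subseteq V$ and $|V'|\le 2k-2$, such that $X$ is a tree, every vertex of $V'\cap L_G$ is a leaf of $X$ (has degree 1 in $X$), and an $(r,k)$-safe tree (not necessarily a subgraph of $G$) can be obtained from $X$ by adding a set $V^*$ of $2k-2-|V'|$ new vertices and, for each $v\in V^*$, one edge joining $v$ to a vertex of $V'\cap L_G$. A pair $(X_1,X_2)$ of subtrees of $G$ is *completable* if there are edge-disjoint spanning trees $T_1,T_2$ of $G$ with $E(X_i)\subseteq E(T_i)$ for $i=1,2$. Then $G$ has two edge-disjoint $(r,k)$-safe spanning trees if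 and only if $G$ contains a completable pair of compact $(r,k)$-certificates. Further, there is an algorithm that, given such $G$, $r$, $k$ and a completable pair of compact $(r,k)$-certificates, finds two edge-disjoint $(r,k)$-safe spanning trees of $G$ in time polynomial in the number of vertices and edges of $G$. -/

import Mathlib

open scoped Graph

/-!
Multigraphs are Mathlib's `Graph α β` (parallel edges allowed). A rooted graph with root `r` and
vertex set `V + r` is a `Graph` with `r ∈ V(G)`; the set `V` of the paper is `V(G) \ {r}`.
-/

namespace Graph

variable {α β : Type*}

/-- Every two vertices are joined by a walk, and there is at least one vertex. -/
def IsConnectedGraph (G : Graph α β) : Prop :=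
  V(G).Nonempty ∧ ∀ x ∈ V(G), ∀ y ∈ V(G), Relation.ReflTransGen G.Adj x y

/-- A cycle of length `n + 1`: pairwise distinct vertices `v 0, …, v n` and pairwise distinct edges
`e 0, …, e n`, where `e i` joins `v i` to its cyclic successor (addition in `Fin (n + 1)` is modulo
`n + 1`). Two parallel edges form a cycle of length two, a loop is a cycle of length one. -/
def IsCycleOf (G : Graph α β) (n : ℕ) (v : Fin (n + 1) → α) (e : Fin (n + 1) → β) : Prop :=
  Function.Injective v ∧ Function.Injective e ∧ ∀ i, G.IsLink (e i) (v i) (v (i + 1))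

/-- A tree: a connected graph without cycles. -/
def IsTreeGraph (G : Graph α β) : Prop :=
  G.IsConnectedGraph ∧ ∀ n v e, ¬ G.IsCycleOf n v e

/-- `T` is a spanning tree of `G`. -/
def IsSpanningTreeOf (T G : Graph α β) : Prop :=
  T ≤ G ∧ V(T) = V(G) ∧ T.IsTreeGraph

/-- The vertex set of what remains of `T - v` after deleting the component that contains `r`. -/
def cutOff (T : Graph α β) (r v : α) : Set α :=
  {w | w ∈ V(T.deleteVerts {v}) ∧ ¬ Relation.ReflTransGen (T.deleteVerts {v}).Adj r w}

/-- `T` is a tree rooted at `r`, and for every non-root vertex `v`, at least `k` non-root vertices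
lie outside of `T.cutOff r v`. -/
def IsSafeTree (T : Graph α β) (r : α) (k : ℕ) : Prop :=
  T.IsTreeGraph ∧ r ∈ V(T) ∧
    ∀ v ∈ V(T) \ {r}, k ≤ ((V(T) \ {r}) \ T.cutOff r v).ncard

/-- `T₁`, `T₂` are two edge-disjoint `(r,k)`-safe spanning trees of `G`. -/
def IsSafePair (G : Graph α β) (r : α) (k : ℕ) (T₁ T₂ : Graph α β) : Prop :=
  T₁.IsSpanningTreeOf G ∧ T₂.IsSpanningTreeOf G ∧ Disjoint E(T₁) E(T₂) ∧
    T₁.IsSafeTree r k ∧ T₂.IsSafeTree r k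

/-- The non-root vertices with at least `8k - 7` distinct neighbours. -/
def largeVerts (G : Graph α β) (r : α) (k : ℕ) : Set α :=
  {v | v ∈ V(G) \ {r} ∧ 8 * k - 7 ≤ {w | G.Adj v w}.ncard}

/-- `v` is a leaf of `G`: exactly one edge is incident to it (used for loopless graphs). -/
def IsLeafVertex (G : Graph α β) (v : α) : Prop :=
  v ∈ V(G) ∧ (G.incidenceSet v).ncard = 1

/-- The graph obtained from `X` by adding `q` new vertices, and for every `i < q` one new edge that
joins the `i`-th new vertex to the vertex `a i` of `X`. -/
def addPendant (X : Graph α β) {q : ℕ} (a : Fin q → α) (ha : ∀ i, a i ∈ V(X)) :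
    Graph (α ⊕ Fin q) (β ⊕ Fin q) where
  vertexSet := Sum.inl '' V(X) ∪ Set.range Sum.inr
  IsLink e x y :=
    match e with
    | Sum.inl e => ∃ u w, X.IsLink e u w ∧ x = Sum.inl u ∧ y = Sum.inl w
    | Sum.inr i =>
        (x = Sum.inl (a i) ∧ y = Sum.inr i) ∨ (x = Sum.inr i ∧ y = Sum.inl (a i))
  isLink_symm := by
    rintro (e | i) -
    · exact ⟨fun x y ⟨u, w, h, hx, hy⟩ => ⟨w, u, h.symm, hy, hx⟩⟩
    · exact ⟨fun x y h => h.elim (fun h => Or.inr ⟨h.2, h.1⟩) (fun h => Or.inl ⟨h.2, h.1⟩)⟩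
  eq_or_eq_of_isLink_of_isLink := by
    rintro (e | i) x y v w h h'
    · obtain ⟨u₁, w₁, h₁, rfl, rfl⟩ := h
      obtain ⟨u₂, w₂, h₂, rfl, rfl⟩ := h'
      exact (h₁.left_eq_or_eq h₂).imp (congrArg _) (congrArg _)
    · rcases h with ⟨rfl, rfl⟩ | ⟨rfl, rfl⟩ <;> rcases h' with ⟨rfl, rfl⟩ | ⟨rfl, rfl⟩ <;> simp
  left_mem_of_isLink := by
    rintro (e | i) x y h
    · obtain ⟨u, w, h, rfl, rfl⟩ := h
      exact Or.inl ⟨u, h.left_mem, rfl⟩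
    · rcases h with ⟨rfl, rfl⟩ | ⟨rfl, rfl⟩
      · exact Or.inl ⟨_, ha i, rfl⟩
      · exact Or.inr ⟨i, rfl⟩

/-- Compact `(r,k)`-certificates of the graph `G` rooted at `r`. -/
def IsCompactCertificate (G : Graph α β) (r : α) (k : ℕ) (X : Graph α β) : Prop :=
  X ≤ G ∧ r ∈ V(X) ∧ (V(X) \ {r}).ncard ≤ 2 * k - 2 ∧
  X.IsTreeGraph ∧
  (∀ v ∈ V(X) ∩ G.largeVerts r k, X.IsLeafVertex v) ∧
  ∃ (a : Fin (2 * k - 2 - (V(X) \ {r}).ncard) → α) (ha : ∀ i, a i ∈ V(X)),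
    (∀ i, a i ∈ G.largeVerts r k) ∧ (X.addPendant a ha).IsSafeTree (Sum.inl r) k

/-- There are edge-disjoint spanning trees of `G`, the first one containing the edges of `X₁` and
the second one those of `X₂`. -/
def IsCompletablePair (G X₁ X₂ : Graph α β) : Prop :=
  ∃ T₁ T₂ : Graph α β, T₁.IsSpanningTreeOf G ∧ T₂.IsSpanningTreeOf G ∧
    Disjoint E(T₁) E(T₂) ∧ E(X₁) ⊆ E(T₁) ∧ E(X₂) ⊆ E(T₂)

end Graph

/-!
The machine model is the random access machine with unit cost, whose only arithmetic operations are
addition and truncated subtraction (so that it is polynomially equivalent to Turing machines), in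
the form of structured programs over registers and arrays of natural numbers.
-/

namespace RAM

/-- Memory: the register `x` holds `reg x`, the `i`-th cell of the array `a` holds `arr a i`. -/
structure State where
  reg : ℕ → ℕ
  arr : ℕ → ℕ → ℕ

inductive Expr where
  | const (c : ℕ)
  | reg (x : ℕ)
  | get (a : ℕ) (i : Expr)
  | add (e₁ e₂ : Expr)
  | sub (e₁ e₂ : Expr)

namespace Expr

def eval (s : State) : Expr → ℕ
  | const c => c
  | reg x => s.reg x
  | get a i => s.arr a (i.eval s)
  | add e₁ e₂ => e₁.eval s + e₂.eval s
  | sub e₁ e₂ => e₁.eval s - e₂.eval s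

/-- The number of operations performed when the expression is evaluated. -/
def cost : Expr → ℕ
  | const _ => 1
  | reg _ => 1
  | get _ i => i.cost + 1
  | add e₁ e₂ => e₁.cost + e₂.cost + 1
  | sub e₁ e₂ => e₁.cost + e₂.cost + 1

end Expr

/-- Programs; a test `e` succeeds if the value of `e` is not zero. -/
inductive Prog where
  | skip
  | assign (x : ℕ) (e : Expr)
  | store (a : ℕ) (i e : Expr)
  | seq (p q : Prog)
  | ite (e : Expr) (p q : Prog)
  | loop (e : Expr) (p : Prog)

/-- `Runs p s t s'`: started in the memory `s`, the program `p` halts after exactly `t` steps, and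
the memory is then `s'`. -/
inductive Runs : Prog → State → ℕ → State → Prop
  | skip (s : State) : Runs Prog.skip s 1 s
  | assign (x : ℕ) (e : Expr) (s : State) :
      Runs (Prog.assign x e) s (e.cost + 1)
        { s with reg := Function.update s.reg x (e.eval s) }
  | store (a : ℕ) (i e : Expr) (s : State) :
      Runs (Prog.store a i e) s (i.cost + e.cost + 1)
        { s with arr := Function.update s.arr a
                  (Function.update (s.arr a) (i.eval s) (e.eval s)) }
  | seq {p q : Prog} {s s' s'' : State} {t t' : ℕ} :
      Runs p s t s' → Runs q s' t' s'' → Runs (Prog.seq p q) s (t + t') s''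
  | ite_true {e : Expr} {p q : Prog} {s s' : State} {t : ℕ} :
      e.eval s ≠ 0 → Runs p s t s' → Runs (Prog.ite e p q) s (e.cost + 1 + t) s'
  | ite_false {e : Expr} {p q : Prog} {s s' : State} {t : ℕ} :
      e.eval s = 0 → Runs q s t s' → Runs (Prog.ite e p q) s (e.cost + 1 + t) s'
  | loop_done {e : Expr} {p : Prog} {s : State} :
      e.eval s = 0 → Runs (Prog.loop e p) s (e.cost + 1) s
  | loop_step {e : Expr} {p : Prog} {s s' s'' : State} {t t' : ℕ} :
      e.eval s ≠ 0 → Runs p s t s' → Runs (Prog.loop e p) s' t' s'' →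
      Runs (Prog.loop e p) s (e.cost + 1 + t + t') s''

open Classical in
/-- The memory that holds the input: a graph with vertices `0, …, n - 1` and edges `0, …, m - 1`,
where the edge `e` has the ends `tail e` and `head e`, the root `r`, the number `k`, and two
subgraphs, each given by the characteristic arrays of its vertex set and of its edge set.
All other memory is zero. -/
noncomputable def inputState (n m r k : ℕ) (tail head : ℕ → ℕ) (X₁ X₂ : Graph ℕ ℕ) : State where
  reg
    | 0 => n
    | 1 => m
    | 2 => r
    | 3 => k
    | _ => 0
  arr
    | 0 => fun e => if e < m then tail e else 0
    | 1 => fun e => if e < m then head e else 0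
    | 2 => fun v => if v ∈ V(X₁) then 1 else 0
    | 3 => fun e => if e ∈ E(X₁) then 1 else 0
    | 4 => fun v => if v ∈ V(X₂) then 1 else 0
    | 5 => fun e => if e ∈ E(X₂) then 1 else 0
    | _ => fun _ => 0

/-- In the memory `s`, the arrays `6` and `7`, restricted to the edges `0, …, m - 1`, describe the
edge sets of `T₁` and `T₂`. -/
def HoldsOutput (s : State) (m : ℕ) (T₁ T₂ : Graph ℕ ℕ) : Prop :=
  E(T₁) = {e | e < m ∧ s.arr 6 e ≠ 0} ∧ E(T₂) = {e | e < m ∧ s.arr 7 e ≠ 0}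

end RAM

/-! Call the components that remain when `r` is deleted from a tree its branches. Within a branch,
the neighbour of `r` cuts off the most: the whole branch except itself. Hence a tree is safe exactly
when at least `k - 1` non-root vertices lie outside each branch (`isSafeTree_iff`). A spanning tree
is therefore safe as soon as it contains a subtree at `r` with at least `2k - 2` further vertices
whose branches have at most `k - 1` vertices each (`IsPartialCertificate.isSafeTree`). A compact
certificate is used only through the weaker notion `IsPartialCertificate`: a small rooted tree with
small branches which is either full or has vertices of `L` at which it can still grow.

From safe trees to certificates: in a safe spanning tree take a maximal rooted subtree that respects
both size bounds and has the vertices of `L` as leaves. If it had no room to grow, then all but one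
of its branches would be entire branches of the spanning tree, and fewer than `k - 1` vertices would
lie outside the remaining one, or the subtree would span everything (`IsSeed.isPartialCertificate`).
The missing vertices can be distributed over at most two branches
(`IsPartialCertificate.exists_distribution`). The two spanning trees themselves complete the pair of
certificates.

From certificates to safe trees: a certificate that is not full has a vertex `v` of `L` in a branch
that may grow. Let `w` be a neighbour of `v` outside both certificates. The edge `vw` can be forced
into the first spanning tree by one exchange if the second tree does not use it
(`Completes.exchange_unused`), and by a double exchange if the part of the second tree beyond `vw`
misses the first certificate (`Completes.exchange_used`). The parts beyond different neighbours are
disjoint, so at most as many neighbours fail as the first certificate has vertices. The degree bound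
leaves a good one (`Completable.exists_extension`).

The algorithm tries edges greedily and needs a test whether a pair is completable. This is matroid
union for two copies of the cycle matroid, with the certificate edges locked to their colours.
Recolouring a free edge of least level in the exchange digraph decreases a quadratically bounded
measure (`IsTwoForest.deficiency_update_lt`), and when no such edge exists, a rank count shows that
both forests span (`IsTwoForest.completes`). The programs use only `for` loops with bounds linear in
the input size, so they run in polynomial time by construction (`ForProg.runs_compile`), and
correctness is proved by loop invariants. -/

namespace Graph

/-! ### Connectivity and forests in terms of edge sets. -/

variable {α β : Type*}

/-- `x` and `y` are joined by a walk all of whose edges belong to `F`. -/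
def Conn (G : Graph α β) (F : Set β) : α → α → Prop :=
  Relation.ReflTransGen fun a b => ∃ e ∈ F, G.IsLink e a b

/-- Every edge of `F` is a bridge of the graph with edge set `F`. -/
def Forest (G : Graph α β) (F : Set β) : Prop :=
  ∀ e ∈ F, ∀ x y, G.IsLink e x y → ¬ G.Conn (F \ {e}) x y

/-- `F` is the edge set of a spanning tree. -/
structure SpanTree (G : Graph α β) (F : Set β) : Prop where
  subset : F ⊆ E(G)
  forest : G.Forest F
  conn : ∀ x ∈ V(G), ∀ y ∈ V(G), G.Conn F x y

variable {G : Graph α β} {F F' S T : Set β} {e f g : β} {a b x y z : α}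

lemma Conn.refl (x : α) : G.Conn F x x := Relation.ReflTransGen.refl

lemma IsLink.conn (h : G.IsLink e x y) (he : e ∈ F) : G.Conn F x y :=
  Relation.ReflTransGen.single ⟨e, he, h⟩

lemma Conn.trans (h : G.Conn F x y) (h' : G.Conn F y z) : G.Conn F x z :=
  Relation.ReflTransGen.trans h h'

lemma Conn.symm (h : G.Conn F x y) : G.Conn F y x := by
  induction h with
  | refl => exact Conn.refl _
  | tail _ hl ih =>
    obtain ⟨e, he, hl⟩ := hl
    exact (hl.symm.conn he).trans ih

lemma conn_comm : G.Conn F x y ↔ G.Conn F y x := ⟨Conn.symm, Conn.symm⟩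

lemma Conn.of_forall_link (H : ∀ e ∈ F, ∀ a b, G.IsLink e a b → G.Conn F' a b)
    (h : G.Conn F x y) : G.Conn F' x y := by
  induction h with
  | refl => exact Conn.refl _
  | tail _ hl ih =>
    obtain ⟨e, he, hl⟩ := hl
    exact ih.trans (H e he _ _ hl)

lemma Conn.mono (hF : F ⊆ F') (h : G.Conn F x y) : G.Conn F' x y :=
  h.of_forall_link fun _ he _ _ hl => hl.conn (hF he)

/-- A set of vertices that no edge of `F` leaves contains every vertex reached from it. -/
lemma Conn.mem_of_closed {A : Set α} (H : ∀ e ∈ F, ∀ a b, G.IsLink e a b → a ∈ A → b ∈ A)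
    (h : G.Conn F x y) (hx : x ∈ A) : y ∈ A := by
  induction h with
  | refl => exact hx
  | tail _ hl ih =>
    obtain ⟨e, he, hl⟩ := hl
    exact H e he _ _ hl ih

lemma Conn.mem_vertexSet (h : G.Conn F x y) (hx : x ∈ V(G)) : y ∈ V(G) :=
  h.mem_of_closed (A := V(G)) (fun _ _ _ _ hl _ => hl.right_mem) hx

lemma Conn.eq_or_exists_link (h : G.Conn F x y) : x = y ∨ ∃ e ∈ F, ∃ z, G.IsLink e z y := by
  rcases Relation.ReflTransGen.cases_tail h with h | ⟨z, -, e, he, hl⟩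
  · exact Or.inl h.symm
  · exact Or.inr ⟨e, he, z, hl⟩

/-- Along the walk, each use of `e` only moves the current end between the `F`-components of `a` and
`b`, so a single use suffices. -/
lemma conn_insert_cases (hl : G.IsLink e a b) (h : G.Conn (insert e F) x y) :
    G.Conn F x y ∨ (G.Conn F x a ∧ G.Conn F b y) ∨ (G.Conn F x b ∧ G.Conn F a y) := by
  induction h with
  | refl => exact Or.inl (Conn.refl _)
  | @tail y z _ hyz ih =>
    obtain ⟨g, hg, hyz⟩ := hyz
    rcases hg with rfl | hg
    · rcases hyz.eq_and_eq_or_eq_and_eq hl with ⟨rfl, rfl⟩ | ⟨rfl, rfl⟩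
      · rcases ih with h | ⟨h, h'⟩ | ⟨h, h'⟩
        · exact Or.inr (Or.inl ⟨h, Conn.refl _⟩)
        · exact Or.inr (Or.inl ⟨h, Conn.refl _⟩)
        · exact Or.inl h
      · rcases ih with h | ⟨h, h'⟩ | ⟨h, h'⟩
        · exact Or.inr (Or.inr ⟨h, Conn.refl _⟩)
        · exact Or.inl h
        · exact Or.inr (Or.inr ⟨h, Conn.refl _⟩)
    · have hc : G.Conn F y z := hyz.conn hg
      rcases ih with h | ⟨h, h'⟩ | ⟨h, h'⟩
      · exact Or.inl (h.trans hc)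
      · exact Or.inr (Or.inl ⟨h, h'.trans hc⟩)
      · exact Or.inr (Or.inr ⟨h, h'.trans hc⟩)

/-- Exchange in the cycle matroid: the walk from `x` to `y` has to use `e`, so `x` and `y` lie in
the `F`-components of the two ends of `e`, and `g` joins these components. -/
lemma conn_exchange (hl : G.IsLink e a b) (hg : G.IsLink g x y) (h : G.Conn (insert e F) x y)
    (hn : ¬ G.Conn F x y) : G.Conn (insert g F) a b := by
  have hm : ∀ {u v}, G.Conn F u v → G.Conn (insert g F) u v :=
    fun h => h.mono (Set.subset_insert _ _)
  have hxy : G.Conn (insert g F) x y := hg.conn (Set.mem_insert _ _)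
  rcases conn_insert_cases hl h with h | ⟨h, h'⟩ | ⟨h, h'⟩
  · exact absurd h hn
  · exact (hm h).symm.trans (hxy.trans (hm h').symm)
  · exact (hm h').trans (hxy.symm.trans (hm h))

/-- The elements of `S` are deleted one at a time; `f` is the first whose deletion separates `x`
from `y`, and `F₀` is what was left just before. -/
lemma exists_critical (hS : S.Finite) (h : G.Conn F x y) (hn : ¬ G.Conn (F \ S) x y) :
    ∃ f ∈ S, ∃ F₀ ⊆ F, f ∈ F₀ ∧ G.Conn F₀ x y ∧ ¬ G.Conn (F₀ \ {f}) x y := by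
  induction S, hS using Set.Finite.induction_on generalizing F with
  | empty => simp [h] at hn
  | @insert f S _ _ ih =>
    by_cases hc : G.Conn (F \ {f}) x y
    · have : ¬ G.Conn ((F \ {f}) \ S) x y := by
        rwa [Set.sdiff_sdiff, Set.singleton_union]
      obtain ⟨f', hf', F₀, hF₀, h'⟩ := ih hc this
      exact ⟨f', Set.mem_insert_of_mem _ hf', F₀, hF₀.trans Set.sdiff_subset, h'⟩
    · refine ⟨f, Set.mem_insert _ _, F, subset_rfl, ?_, h, hc⟩
      by_contra hf
      exact hc (by rwa [Set.sdiff_singleton_eq_self hf])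

lemma Forest.subset (h : G.Forest F) (hF : F' ⊆ F) : G.Forest F' := fun e he x y hl hc =>
  h e (hF he) x y hl (hc.mono (Set.sdiff_subset_sdiff_left hF))

/-- In a forest, two vertices separated by the deletion of `S` are separated by that of one element
of `S`. -/
lemma Forest.exists_separating (hF : G.Forest F) (hFE : F ⊆ E(G)) (hS : S.Finite)
    (h : G.Conn F x y) (hn : ¬ G.Conn (F \ S) x y) : ∃ f ∈ S ∩ F, ¬ G.Conn (F \ {f}) x y := by
  obtain ⟨f, hfS, F₀, hF₀, hf, hc, hnc⟩ := exists_critical hS h hn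
  refine ⟨f, ⟨hfS, hF₀ hf⟩, fun hxy => ?_⟩
  obtain ⟨u, v, huv⟩ := exists_isLink_of_mem_edgeSet (hFE (hF₀ hf))
  have hm : ∀ {s t}, G.Conn (F₀ \ {f}) s t → G.Conn (F \ {f}) s t :=
    fun h => h.mono (Set.sdiff_subset_sdiff_left hF₀)
  have hc' : G.Conn (insert f (F₀ \ {f})) x y := by
    rwa [Set.insert_sdiff_singleton, Set.insert_eq_of_mem hf]
  -- In `F₀` without `f`, the ends of `f` are joined to `x` and `y`. A connection of `x` and `y`
  -- avoiding `f` would then close a cycle through `f`.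
  refine hF f (hF₀ hf) u v huv ?_
  rcases conn_insert_cases huv hc' with h | ⟨h, h'⟩ | ⟨h, h'⟩
  · exact absurd h hnc
  · exact (hm h).symm.trans (hxy.trans (hm h').symm)
  · exact (hm h').trans (hxy.symm.trans (hm h))

/-- If an old edge `f` ceased to be a bridge, exchanging `e` for `f` would join `a` to `b` inside
`F`. -/
lemma Forest.insert_edge (hF : G.Forest F) (hl : G.IsLink e a b) (hn : ¬ G.Conn F a b) :
    G.Forest (insert e F) := by
  intro f hf x y hxy hc
  by_cases hfe : f = e
  · subst hfe
    have hc' : G.Conn F x y := hc.mono (by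
      rintro g ⟨rfl | hg, hgf⟩
      · exact absurd rfl hgf
      · exact hg)
    rcases hxy.eq_and_eq_or_eq_and_eq hl with ⟨rfl, rfl⟩ | ⟨rfl, rfl⟩
    · exact hn hc'
    · exact hn hc'.symm
  · have hfF : f ∈ F := hf.resolve_left hfe
    have heq : insert e F \ {f} = insert e (F \ {f}) := by
      ext g; simp only [Set.mem_sdiff, Set.mem_insert_iff, Set.mem_singleton_iff]
      constructor
      · rintro ⟨rfl | h, h'⟩
        · exact Or.inl rfl
        · exact Or.inr ⟨h, h'⟩
      · rintro (rfl | ⟨h, h'⟩)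
        · exact ⟨Or.inl rfl, fun h => hfe h.symm⟩
        · exact ⟨Or.inr h, h'⟩
    rw [heq] at hc
    have := conn_exchange hl hxy hc (hF f hfF x y hxy)
    rw [Set.insert_sdiff_singleton, Set.insert_eq_of_mem hfF] at this
    exact hn this

/-- The connection of `a` and `b` in `T` must use `f`; read backwards, `e` reconnects the ends of
`f`. -/
lemma SpanTree.exchange (hT : G.SpanTree T) (hf : f ∈ T) (hl : G.IsLink e a b)
    (hn : ¬ G.Conn (T \ {f}) a b) : G.SpanTree (insert e (T \ {f})) where
  subset := Set.insert_subset hl.edge_mem (Set.sdiff_subset.trans hT.subset)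
  forest := (hT.forest.subset Set.sdiff_subset).insert_edge hl hn
  conn x hx y hy := by
    refine (hT.conn x hx y hy).of_forall_link fun g hg u v huv => ?_
    by_cases hgf : g = f
    · subst hgf
      refine conn_exchange huv hl ?_ hn
      rw [Set.insert_sdiff_singleton, Set.insert_eq_of_mem hf]
      exact hT.conn _ hl.left_mem _ hl.right_mem
    · exact huv.conn (Or.inr ⟨hg, hgf⟩)

/-- A forest spanned by a finite set of edges is not larger than that set. -/
lemma Forest.ncard_le (hT : G.Forest T) (hTE : T ⊆ E(G)) (hTf : T.Finite) (hF : F.Finite)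
    (hFE : F ⊆ E(G)) (h : ∀ e ∈ T, ∀ x y, G.IsLink e x y → G.Conn F x y) :
    T.ncard ≤ F.ncard := by
  generalize hn : (T \ F).ncard = n
  induction n generalizing F with
  | zero =>
    have : T \ F = ∅ := (Set.ncard_eq_zero (hTf.subset Set.sdiff_subset)).1 hn
    exact Set.ncard_le_ncard (Set.sdiff_eq_empty.1 this) hF
  | succ n ih =>
    obtain ⟨e, he⟩ : (T \ F).Nonempty := by
      rw [Set.nonempty_iff_ne_empty]; intro h0; simp [h0] at hn
    obtain ⟨x, y, hxy⟩ := exists_isLink_of_mem_edgeSet (hTE he.1)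
    -- The set `F \ (F \ T)` is `F ∩ T`, which lies in `T` without `e`, and `e` is a bridge of `T`.
    have hsep : ¬ G.Conn (F \ (F \ T)) x y := fun hc => hT e he.1 x y hxy (hc.mono (by
      rintro g ⟨hgF, hg⟩
      refine ⟨by_contra fun hgT => hg ⟨hgF, hgT⟩, ?_⟩
      rintro rfl
      exact he.2 hgF))
    -- Steinitz exchange: replacing some `f` of `F \ T` by `e` preserves the size of `F` and what it
    -- spans, and decreases `T \ F`.
    obtain ⟨f, hfS, F₀, hF₀, hf, hc, hnc⟩ :=
      exists_critical (hF.subset Set.sdiff_subset) (h e he.1 x y hxy) hsep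
    have hef : e ∉ F \ {f} := fun h => he.2 h.1
    have hcard : (insert e (F \ {f})).ncard = F.ncard := by
      rw [Set.ncard_insert_of_notMem hef (hF.subset Set.sdiff_subset),
        Set.ncard_sdiff_singleton_add_one hfS.1 hF]
    rw [← hcard]
    refine ih ((hF.subset Set.sdiff_subset).insert _)
      (Set.insert_subset hxy.edge_mem (Set.sdiff_subset.trans hFE)) ?_ ?_
    · intro g hg u v huv
      refine (h g hg u v huv).of_forall_link fun g' hg' s t hst => ?_
      by_cases hgf : g' = f
      · subst hgf
        have hc' : G.Conn (insert g' (F₀ \ {g'})) x y := by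
          rwa [Set.insert_sdiff_singleton, Set.insert_eq_of_mem hf]
        exact (conn_exchange hst hxy hc' hnc).mono
          (Set.insert_subset_insert (Set.sdiff_subset_sdiff_left hF₀))
      · exact hst.conn (Or.inr ⟨hg', hgf⟩)
    · have : T \ insert e (F \ {f}) = (T \ F) \ {e} := by
        ext g
        simp only [Set.mem_sdiff, Set.mem_insert_iff, Set.mem_singleton_iff, not_or, not_and,
          not_not]
        constructor
        · rintro ⟨hg, hge, hgf⟩
          refine ⟨⟨hg, fun hgF => ?_⟩, hge⟩
          exact hfS.2 (hgf hgF ▸ hg)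
        · rintro ⟨⟨hg, hgF⟩, hge⟩
          exact ⟨hg, hge, fun h => absurd h hgF⟩
      rw [this]
      have := Set.ncard_sdiff_singleton_add_one he (hTf.subset Set.sdiff_subset)
      omega

/-! ### Trees -/

lemma conn_edgeSet_iff : G.Conn E(G) x y ↔ Relation.ReflTransGen G.Adj x y := by
  constructor <;> intro h
  · refine Relation.ReflTransGen.mono ?_ _ _ h
    rintro a b ⟨e, -, hl⟩
    exact ⟨e, hl⟩
  · refine Relation.ReflTransGen.mono ?_ _ _ h
    rintro a b ⟨e, hl⟩
    exact ⟨e, hl.edge_mem, hl⟩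

lemma conn_of_le {H : Graph α β} (hH : H ≤ G) (hF : F ⊆ E(H)) :
    H.Conn F x y ↔ G.Conn F x y := by
  constructor <;> intro h
  · refine Relation.ReflTransGen.mono ?_ _ _ h
    rintro a b ⟨e, he, hl⟩
    exact ⟨e, he, hl.mono hH⟩
  · refine Relation.ReflTransGen.mono ?_ _ _ h
    rintro a b ⟨e, he, hl⟩
    exact ⟨e, he, (hH.isLink_iff (hF he)).2 hl⟩

lemma forest_of_le {H : Graph α β} (hH : H ≤ G) (hF : F ⊆ E(H)) :
    H.Forest F ↔ G.Forest F := by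
  refine forall₂_congr fun e he => forall₂_congr fun x y => ?_
  rw [hH.isLink_iff (hF he), conn_of_le hH (Set.sdiff_subset.trans hF)]

/-- A walk in a set of edges contains a path with the same ends. -/
lemma Conn.exists_path (h : G.Conn F x y) : ∃ (n : ℕ) (v : ℕ → α), v 0 = x ∧ v n = y ∧
    (∀ i ≤ n, ∀ j ≤ n, v i = v j → i = j) ∧ ∀ i < n, ∃ e ∈ F, G.IsLink e (v i) (v (i + 1)) := by
  induction h with
  | refl => exact ⟨0, fun _ => x, rfl, rfl, by intros; omega, by intros; omega⟩
  | @tail y z _ hyz ih =>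
    obtain ⟨n, v, h0, hn, hinj, hl⟩ := ih
    by_cases hz : ∃ j ≤ n, v j = z
    · obtain ⟨j, hj, rfl⟩ := hz
      exact ⟨j, v, h0, rfl, fun i hi i' hi' => hinj i (hi.trans hj) i' (hi'.trans hj),
        fun i hi => hl i (hi.trans_le hj)⟩
    · push Not at hz
      refine ⟨n + 1, fun i => if i ≤ n then v i else z, by simpa using h0, by simp, ?_, ?_⟩
      · intro i hi j hj hij
        by_cases hi' : i ≤ n <;> by_cases hj' : j ≤ n <;> simp only [hi', hj', if_true, if_false] at hij
        · exact hinj i hi' j hj' hij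
        · exact absurd hij (hz i hi')
        · exact absurd hij.symm (hz j hj')
        · omega
      · intro i hi
        rcases Nat.lt_or_ge i n with h | h
        · simpa [h.le, Nat.succ_le_of_lt h] using hl i h
        · obtain rfl : i = n := by omega
          simpa [hn] using hyz

lemma IsCycleOf.conn {n : ℕ} {v : Fin (n + 1) → α} {c : Fin (n + 1) → β} (h : G.IsCycleOf n v c) :
    G.Conn (E(G) \ {c 0}) (v 0) (v 1) := by
  have key : ∀ i : Fin (n + 1), i ≠ 0 → G.Conn (E(G) \ {c 0}) (v i) (v (i + 1)) := fun i hi =>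
    (h.2.2 i).conn ⟨(h.2.2 i).edge_mem, fun hc => hi (h.2.1 hc)⟩
  -- The cycle is traversed the long way round: it starts at `v 1`, written as the second successor
  -- of the last vertex, and index `n + 1` is `v 0` again.
  have : ∀ j ≤ n, G.Conn (E(G) \ {c 0}) (v (Fin.last n + 1 + 1)) (v (Fin.ofNat (n + 1) (j + 1))) := by
    intro j
    induction j with
    | zero =>
      intro _
      have : (Fin.last n + 1 + 1 : Fin (n + 1)) = Fin.ofNat (n + 1) (0 + 1) := by ext; simp
      rw [this]
      exact Conn.refl _
    | succ j ih =>
      intro hj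
      have h1 := key (Fin.ofNat (n + 1) (j + 1)) (by
        intro h0
        have := congrArg Fin.val h0
        rw [Fin.val_ofNat, Nat.mod_eq_of_lt (by omega)] at this
        simp at this)
      have h2 : (Fin.ofNat (n + 1) (j + 1) + 1 : Fin (n + 1)) = Fin.ofNat (n + 1) (j + 1 + 1) := by
        ext; simp [Fin.val_add]
      rw [h2] at h1
      exact (ih (by omega)).trans h1
  have h3 := this n le_rfl
  have h4 : Fin.ofNat (n + 1) (n + 1) = 0 := by ext; simp
  have h5 : (Fin.last n + 1 + 1 : Fin (n + 1)) = 1 := by simp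
  rw [h4, h5] at h3
  exact h3.symm

lemma Forest.not_isCycleOf (h : G.Forest E(G)) {n : ℕ} {v : Fin (n + 1) → α}
    {c : Fin (n + 1) → β} : ¬ G.IsCycleOf n v c := by
  intro hc
  have := hc.2.2 0
  rw [zero_add] at this
  exact h (c 0) this.edge_mem _ _ this hc.conn

/-- An edge that is not a bridge closes a cycle with a path joining its ends in the other edges; it
takes the last index `n` of this cycle. -/
lemma forest_of_forall_not_isCycleOf (h : ∀ n v c, ¬ G.IsCycleOf n v c) : G.Forest E(G) := by
  intro e _ x y hxy hc
  obtain ⟨n, v, h0, hn, hinj, hl⟩ := hc.exists_path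
  obtain ⟨c, hc⟩ : ∃ c : ℕ → β, ∀ i < n, c i ∈ E(G) \ {e} ∧ G.IsLink (c i) (v i) (v (i + 1)) := by
    classical
    refine ⟨fun i => if hi : i < n then (hl i hi).choose else e, fun i hi => ?_⟩
    simpa only [hi, dif_pos] using (hl i hi).choose_spec
  have hcF := fun i hi => (hc i hi).1
  have hcl := fun i hi => (hc i hi).2
  refine h n (fun i => v i) (fun i => if (i : ℕ) < n then c i else e) ⟨?_, ?_, ?_⟩
  · intro i j hij
    exact Fin.ext (hinj _ (by omega) _ (by omega) hij)
  · intro i j hij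
    by_cases hi : (i : ℕ) < n <;> by_cases hj : (j : ℕ) < n <;>
      simp only [hi, hj, if_true, if_false] at hij
    · have h1 := hcl _ hi
      have h2 := hcl _ hj
      rw [hij] at h1
      rcases h1.eq_and_eq_or_eq_and_eq h2 with ⟨h3, -⟩ | ⟨h3, h4⟩
      · exact Fin.ext (hinj _ (by omega) _ (by omega) h3)
      -- An edge traversed in both directions would give `i = j + 1` and `i + 1 = j`.
      · have := hinj _ (by omega) _ (by omega) h3
        have := hinj _ (by omega) _ (by omega) h4
        omega
    · exact absurd hij (hcF _ hi).2
    · exact absurd hij.symm (hcF _ hj).2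
    · exact Fin.ext (by omega)
  · intro i
    by_cases hi : (i : ℕ) < n
    · have : ((i + 1 : Fin (n + 1)) : ℕ) = i + 1 := by
        rw [Fin.val_add_one_of_lt]
        exact Fin.lt_def.2 (by simpa using hi)
      simp only [hi, if_true, this]
      exact hcl _ hi
    · have h1 : (i : ℕ) = n := by omega
      have : i + 1 = 0 := by
        have : i = Fin.last n := Fin.ext h1
        simp [this]
      simp only [this, h1, lt_irrefl, if_false, Fin.val_zero, h0, hn]
      exact hxy.symm

/-- This passes from cycles to bridges; from here on trees are treated as edge sets. -/
lemma isTreeGraph_iff : G.IsTreeGraph ↔ V(G).Nonempty ∧ G.SpanTree E(G) := by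
  constructor
  · rintro ⟨⟨h, h'⟩, hc⟩
    exact ⟨h, subset_rfl, forest_of_forall_not_isCycleOf hc,
      fun x hx y hy => conn_edgeSet_iff.2 (h' x hx y hy)⟩
  · rintro ⟨h, h'⟩
    exact ⟨⟨h, fun x hx y hy => conn_edgeSet_iff.1 (h'.conn x hx y hy)⟩,
      fun n v c => h'.forest.not_isCycleOf⟩

lemma IsSpanningTreeOf.spanTree {H : Graph α β} (h : H.IsSpanningTreeOf G) :
    G.SpanTree E(H) := by
  obtain ⟨hle, hV, ht⟩ := h
  have ht := (isTreeGraph_iff.1 ht).2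
  refine ⟨hle.edgeSet_mono, (forest_of_le hle subset_rfl).1 ht.forest, fun x hx y hy => ?_⟩
  exact (conn_of_le hle subset_rfl).1 (ht.conn x (hV ▸ hx) y (hV ▸ hy))

lemma SpanTree.isSpanningTreeOf (h : G.SpanTree T) (hV : V(G).Nonempty) :
    (G.restrict T).IsSpanningTreeOf G := by
  have hE : E(G.restrict T) = T := by simpa using h.subset
  refine ⟨restrict_le, rfl, isTreeGraph_iff.2 ⟨hV, subset_rfl, ?_, fun x hx y hy => ?_⟩⟩
  · rw [forest_of_le restrict_le subset_rfl, hE]; exact h.forest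
  · rw [conn_of_le restrict_le subset_rfl, hE]; exact h.conn x hx y hy

end Graph

/-! ### Branches at the root, safety, and rooted subtrees. -/

namespace Graph

variable {α β : Type*} {G : Graph α β} {F F' C T : Set β} {e f : β} {r u v w x y : α} {k : ℕ}
  {L : Set α}

/-- The vertices reached from `r` by the edges of `F`. -/
def reach (G : Graph α β) (F : Set β) (r : α) : Set α := {w | G.Conn F r w}

/-- The component of `v` after deletion of the edges of `F` at `r`. -/
def branch (G : Graph α β) (F : Set β) (r v : α) : Set α :=
  {w | G.Conn (F \ G.incidenceSet r) v w}

lemma mem_branch_self : v ∈ G.branch F r v := Conn.refl v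

lemma branch_eq_of_mem (h : w ∈ G.branch F r v) : G.branch F r w = G.branch F r v := by
  ext x
  exact ⟨fun hx => Conn.trans h hx, fun hx => (Conn.symm h).trans hx⟩

lemma mem_branch_comm : w ∈ G.branch F r v ↔ v ∈ G.branch F r w := conn_comm

lemma branch_mono (h : F ⊆ F') : G.branch F r v ⊆ G.branch F' r v := fun _ hw =>
  Conn.mono (Set.sdiff_subset_sdiff_left h) hw

lemma ne_of_mem_branch (hv : v ≠ r) (h : w ∈ G.branch F r v) : w ≠ r := by
  refine Conn.mem_of_closed (A := {r}ᶜ) ?_ h hv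
  rintro e he a b hab - (rfl : b = r)
  exact he.2 hab.inc_right

lemma branch_subset_reach (hv : v ∈ G.reach F r) : G.branch F r v ⊆ G.reach F r := fun _ hw =>
  Conn.trans hv (Conn.mono Set.sdiff_subset hw)

lemma reach_subset (hr : r ∈ V(G)) : G.reach F r ⊆ V(G) := fun _ hw => Conn.mem_vertexSet hw hr

lemma reach_mono (h : F ⊆ F') : G.reach F r ⊆ G.reach F' r := fun _ hw => Conn.mono h hw

/-- The child is the vertex that follows the last visit to `r` on a walk from `r` to `v`. -/
lemma exists_child (h : G.Conn F r v) (hv : v ≠ r) :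
    ∃ e ∈ F, ∃ c, G.IsLink e r c ∧ c ∈ G.branch F r v := by
  induction h with
  | refl => exact absurd rfl hv
  | @tail y z hy hyz ih =>
    obtain ⟨e, he, hl⟩ := hyz
    by_cases hyr : y = r
    · subst hyr
      exact ⟨e, he, z, hl, mem_branch_self⟩
    · obtain ⟨f, hf, c, hc, hcy⟩ := ih hyr
      refine ⟨f, hf, c, hc, Conn.trans (Conn.symm (hl.conn ⟨he, ?_⟩)) hcy⟩
      intro hinc
      rcases Inc.eq_or_eq_of_isLink hinc hl with h | h
      · exact hyr h.symm
      · exact hv h.symm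

lemma conn_sdiff_of_mem_branch (he : G.Inc e r) (h : w ∈ G.branch F r v) :
    G.Conn (F \ {e}) v w := by
  refine Conn.mono ?_ h
  rintro f ⟨hf, hfr⟩
  exact ⟨hf, by rintro rfl; exact hfr he⟩

/-- In a forest, distinct edges at `r` lead into distinct branches. -/
lemma Forest.eq_of_child (hF : G.Forest F) (he : e ∈ F) (hf : f ∈ F) (hx : G.IsLink e r x)
    (hy : G.IsLink f r y) (hxy : y ∈ G.branch F r x) : e = f := by
  by_contra hne
  refine hF e he r x hx ?_
  exact (hy.conn (F := F \ {e}) ⟨hf, fun h => hne h.symm⟩).trans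
    (conn_sdiff_of_mem_branch hx.inc_left hxy).symm

lemma deleteVerts_conn_iff :
    Relation.ReflTransGen (G.deleteVerts {v}).Adj x y ↔ G.Conn (E(G) \ G.incidenceSet v) x y := by
  constructor <;> intro h
  · refine Relation.ReflTransGen.mono ?_ _ _ h
    rintro a b ⟨e, hl⟩
    simp only [deleteVerts_isLink, Set.mem_singleton_iff] at hl
    refine ⟨e, ⟨hl.1.edge_mem, fun hi => ?_⟩, hl.1⟩
    rcases Inc.eq_or_eq_of_isLink hi hl.1 with h | h
    · exact hl.2.1 h.symm
    · exact hl.2.2 h.symm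
  · refine Relation.ReflTransGen.mono ?_ _ _ h
    rintro a b ⟨e, ⟨he, hi⟩, hl⟩
    refine ⟨e, ?_⟩
    simp only [deleteVerts_isLink, Set.mem_singleton_iff]
    refine ⟨hl, ?_, ?_⟩
    · rintro rfl; exact hi hl.inc_left
    · rintro rfl; exact hi hl.inc_right

lemma mem_cutOff_iff : w ∈ G.cutOff r v ↔
    w ∈ V(G) ∧ w ≠ v ∧ ¬ G.Conn (E(G) \ G.incidenceSet v) r w := by
  simp only [cutOff, Set.mem_ofPred_eq, deleteVerts_conn_iff]
  simp [and_assoc]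

/-- A tree is safe if and only if none of its branches at the root is too large. -/
lemma isSafeTree_iff (hT : G.IsTreeGraph) (hr : r ∈ V(G)) (hV : V(G).Finite) :
    G.IsSafeTree r k ↔
      ∀ v ∈ V(G) \ {r}, k ≤ ((V(G) \ {r}) \ G.branch E(G) r v).ncard + 1 := by
  have hS := (isTreeGraph_iff.1 hT).2
  have hfin : ∀ A : Set α, ((V(G) \ {r}) \ A).Finite := fun A => hV.subset fun x hx => hx.1.1
  constructor
  · rintro ⟨-, -, h⟩ v ⟨hv, hvr⟩
    obtain ⟨e, he, c, hc, hcv⟩ := exists_child (hS.conn r hr v hv) hvr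
    have hcr := ne_of_mem_branch hvr hcv
    -- Safety is applied to the neighbour `c` of the root in the branch of `v`. It cuts off the
    -- whole branch except itself, which accounts for the `+ 1`.
    refine (h c ⟨hc.right_mem, hcr⟩).trans ?_
    have hsub : (V(G) \ {r}) \ G.cutOff r c ⊆
        insert c ((V(G) \ {r}) \ G.branch E(G) r v) := by
      rintro w ⟨⟨hw, hwr⟩, hwc⟩
      by_cases hwc' : w = c
      · exact Or.inl hwc'
      refine Or.inr ⟨⟨hw, hwr⟩, fun hwb => hwc (mem_cutOff_iff.2 ⟨hw, hwc', fun hcon => ?_⟩)⟩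
      refine hS.forest e he r c hc (Conn.trans (y := w) (hcon.mono ?_) ?_)
      · rintro f ⟨hf, hfc⟩
        exact ⟨hf, by rintro rfl; exact hfc hc.inc_right⟩
      · rw [← branch_eq_of_mem hwb] at hcv
        exact conn_sdiff_of_mem_branch hc.inc_left hcv
    exact (Set.ncard_le_ncard hsub ((hfin _).insert _)).trans (Set.ncard_insert_le _ _)
  · intro h
    -- Conversely, what `v` cuts off lies in its own branch and does not contain `v`.
    refine ⟨hT, hr, fun v hv => (h v hv).trans ?_⟩
    have hvB : v ∉ (V(G) \ {r}) \ G.branch E(G) r v := fun h => h.2 mem_branch_self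
    rw [← Set.ncard_insert_of_notMem hvB (hfin _)]
    refine Set.ncard_le_ncard ?_ (hfin _)
    rintro w (rfl | ⟨hw, hwB⟩)
    · exact ⟨hv, fun h => (mem_cutOff_iff.1 h).2.1 rfl⟩
    · refine ⟨hw, fun hcut => (mem_cutOff_iff.1 hcut).2.2 ?_⟩
      -- A vertex `w` of another branch is reached from `r` inside that branch, hence without
      -- meeting `v`.
      obtain ⟨e, he, c, hc, hcw⟩ := exists_child (hS.conn r hr w hw.1) hw.2
      have hnv : ∀ u ∈ G.branch E(G) r w, u ≠ v := by
        rintro u hu rfl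
        exact hwB (mem_branch_comm.1 hu)
      have h1 : G.Conn (E(G) \ G.incidenceSet v) r c := by
        refine hc.conn ⟨he, fun hi => ?_⟩
        rcases Inc.eq_or_eq_of_isLink hi hc with h | h
        · exact hv.2 h
        · exact hnv c hcw h.symm
      refine h1.trans (Conn.symm ?_)
      -- Membership in the branch is carried along the walk, since it is what keeps the walk away
      -- from `v`.
      have h2 : c ∈ {u | u ∈ G.branch E(G) r w ∧ G.Conn (E(G) \ G.incidenceSet v) w u} := by
        refine Conn.mem_of_closed (F := E(G) \ G.incidenceSet r) ?_ hcw
          ⟨mem_branch_self, Conn.refl _⟩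
        rintro f hf a b hab ⟨ha, ha'⟩
        have hb : b ∈ G.branch E(G) r w := Conn.trans ha (hab.conn hf)
        refine ⟨hb, ha'.trans (hab.conn ⟨hf.1, fun hi => ?_⟩)⟩
        rcases Inc.eq_or_eq_of_isLink hi hab with h | h
        · exact hnv a ha h.symm
        · exact hnv b hb h.symm
      exact h2.2

lemma branch_of_le {H : Graph α β} (hH : H ≤ G) :
    H.branch E(H) r v = G.branch E(H) r v := by
  ext w
  have : E(H) \ H.incidenceSet r = E(H) \ G.incidenceSet r := by
    ext e
    simp only [Set.mem_sdiff, mem_incidenceSet]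
    exact and_congr_right fun he => not_congr (hH.inc_congr he)
  simp only [branch, Set.mem_ofPred_eq]
  rw [conn_of_le hH Set.sdiff_subset, this]

/-- `C` is the edge set of a tree that contains `r`. -/
structure RootedTree (G : Graph α β) (r : α) (C : Set β) : Prop where
  subset : C ⊆ E(G)
  forest : G.Forest C
  conn : ∀ e ∈ C, ∀ x y, G.IsLink e x y → x ∈ G.reach C r

lemma IsTreeGraph.rootedTree {X : Graph α β} (hX : X.IsTreeGraph) (hle : X ≤ G) (hr : r ∈ V(X)) :
    G.RootedTree r E(X) := by
  have hS := (isTreeGraph_iff.1 hX).2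
  refine ⟨hle.edgeSet_mono, (forest_of_le hle subset_rfl).1 hS.forest, fun e he x y hxy => ?_⟩
  exact (conn_of_le hle subset_rfl).1 (hS.conn r hr x ((hle.isLink_iff he).2 hxy).left_mem)

lemma IsTreeGraph.reach_eq {X : Graph α β} (hX : X.IsTreeGraph) (hle : X ≤ G) (hr : r ∈ V(X)) :
    G.reach E(X) r = V(X) := by
  have hS := (isTreeGraph_iff.1 hX).2
  ext x
  exact ⟨fun h => ((conn_of_le hle subset_rfl).2 h).mem_vertexSet hr,
    fun h => (conn_of_le hle subset_rfl).1 (hS.conn r hr x h)⟩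

/-- A branch of a forest meets a rooted subtree in a branch of the subtree. -/
lemma Forest.mem_branch_of_subset (hT : G.Forest T) (hCT : C ⊆ T) (hu : u ∈ G.reach C r)
    (hur : u ≠ r) (hw : w ∈ G.reach C r) (h : w ∈ G.branch T r u) : w ∈ G.branch C r u := by
  obtain ⟨e, he, c, hc, hcu⟩ := exists_child hu hur
  obtain ⟨f, hf, d, hd, hdw⟩ := exists_child hw (ne_of_mem_branch hur h)
  -- The children of the root above `u` and `w` in `C` lie in one branch of `T`, and a branch of a
  -- forest is entered by a single edge at the root. So they coincide.
  have hcd : d ∈ G.branch T r c :=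
    Conn.trans (Conn.symm (branch_mono hCT hcu)) (Conn.trans h (branch_mono hCT hdw))
  obtain rfl := hT.eq_of_child (hCT he) (hCT hf) hc hd hcd
  obtain rfl := hc.right_unique hd
  exact Conn.trans hcu (Conn.symm hdw)

/-- All edges of `C` lie in the component of `r`, so every other vertex is isolated in `C`. -/
lemma RootedTree.eq_of_conn_of_notMem (hC : G.RootedTree r C) (hw : w ∉ G.reach C r)
    (h : G.Conn C w x) : x = w := by
  rcases h.symm.eq_or_exists_link with h | ⟨e, he, z, hl⟩
  · exact h
  · exact absurd (hC.conn e he _ _ hl.symm) hw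

lemma RootedTree.insert_edge (hC : G.RootedTree r C) (hl : G.IsLink e v w)
    (hv : v ∈ G.reach C r) (hw : w ∉ G.reach C r) : G.RootedTree r (insert e C) := by
  have hm : G.reach C r ⊆ G.reach (insert e C) r := reach_mono (Set.subset_insert _ _)
  refine ⟨Set.insert_subset hl.edge_mem hC.subset,
    hC.forest.insert_edge hl fun h => hw (Conn.trans hv h), ?_⟩
  rintro f (rfl | hf) x y hxy
  · rcases hxy.eq_and_eq_or_eq_and_eq hl with ⟨rfl, rfl⟩ | ⟨rfl, rfl⟩
    · exact hm hv
    · exact Conn.trans (hm hv) (hl.conn (Set.mem_insert _ _))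
  · exact hm (hC.conn f hf x y hxy)

lemma RootedTree.reach_insert (hC : G.RootedTree r C) (hl : G.IsLink e v w)
    (hv : v ∈ G.reach C r) (hw : w ∉ G.reach C r) :
    G.reach (insert e C) r = insert w (G.reach C r) := by
  have hm : G.reach C r ⊆ G.reach (insert e C) r := reach_mono (Set.subset_insert _ _)
  ext x
  constructor
  · intro hx
    rcases conn_insert_cases hl hx with h | ⟨-, h⟩ | ⟨h, -⟩
    · exact Or.inr h
    · exact Or.inl (hC.eq_of_conn_of_notMem hw h)
    · exact absurd h hw
  · rintro (rfl | hx)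
    · exact Conn.trans (hm hv) (hl.conn (Set.mem_insert _ _))
    · exact hm hx

lemma RootedTree.branch_insert_subset (hC : G.RootedTree r C) (hl : G.IsLink e v w)
    (hw : w ∉ G.reach C r) (hu : u ≠ w) :
    G.branch (insert e C) r u ⊆ insert w (G.branch C r u) := by
  intro x hx
  have hx' : G.Conn (insert e (C \ G.incidenceSet r)) u x := Conn.mono (by
    rintro f ⟨rfl | hf, hf'⟩
    · exact Or.inl rfl
    · exact Or.inr ⟨hf, hf'⟩) hx
  rcases conn_insert_cases hl hx' with h | ⟨-, h⟩ | ⟨h, -⟩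
  · exact Or.inr h
  · exact Or.inl (hC.eq_of_conn_of_notMem hw (h.mono Set.sdiff_subset))
  · exact absurd (hC.eq_of_conn_of_notMem hw (h.symm.mono Set.sdiff_subset)) hu

end Graph

namespace Graph

variable {α β : Type*} {G : Graph α β} {F F' C T : Set β} {e f : β} {r u v w x y : α} {k : ℕ}
  {L : Set α}

/-! ### Pendant vertices -/

section Pendant

variable {X : Graph α β} {q : ℕ} {a : Fin q → α} {ha : ∀ i, a i ∈ V(X)}
  {P : Set (β ⊕ Fin q)} {p p' : α ⊕ Fin q}

/-- A new vertex is mapped to the vertex it is attached to. -/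
def pendantBase (a : Fin q → α) : α ⊕ Fin q → α := Sum.elim id a

/-- Contracting the pendant edges maps walks to walks. -/
lemma addPendant_conn_base (h : (X.addPendant a ha).Conn P p p') :
    X.Conn (Sum.inl ⁻¹' P) (pendantBase a p) (pendantBase a p') := by
  induction h with
  | refl => exact Conn.refl _
  | tail _ hl ih =>
    obtain ⟨e | i, he, hl⟩ := hl
    · obtain ⟨u, w, h, rfl, rfl⟩ := hl
      exact ih.trans (h.conn he)
    · rcases hl with ⟨rfl, rfl⟩ | ⟨rfl, rfl⟩ <;> exact ih

lemma addPendant_conn_inl (h : X.Conn (Sum.inl ⁻¹' P) x y) :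
    (X.addPendant a ha).Conn P (Sum.inl x) (Sum.inl y) := by
  induction h with
  | refl => exact Conn.refl _
  | tail _ hl ih =>
    obtain ⟨e, he, hl⟩ := hl
    exact ih.trans (IsLink.conn (e := Sum.inl e) ⟨_, _, hl, rfl, rfl⟩ he)

lemma addPendant_conn_iff (hP : ∀ i, Sum.inr i ∈ P) :
    (X.addPendant a ha).Conn P p p' ↔
      X.Conn (Sum.inl ⁻¹' P) (pendantBase a p) (pendantBase a p') := by
  refine ⟨addPendant_conn_base, fun h => ?_⟩
  have key : ∀ p, (X.addPendant a ha).Conn P (Sum.inl (pendantBase a p)) p := by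
    rintro (x | i)
    · exact Conn.refl _
    · exact IsLink.conn (e := Sum.inr i) (Or.inl ⟨rfl, rfl⟩) (hP i)
  exact (key p).symm.trans ((addPendant_conn_inl h).trans (key p'))

lemma addPendant_edgeSet_inl : Sum.inl e ∈ E(X.addPendant a ha) ↔ e ∈ E(X) := by
  constructor
  · rintro ⟨p, p', u, w, h, -⟩; exact h.edge_mem
  · intro h
    obtain ⟨u, w, h⟩ := exists_isLink_of_mem_edgeSet h
    exact ⟨_, _, u, w, h, rfl, rfl⟩

lemma addPendant_edgeSet_inr {i : Fin q} : Sum.inr i ∈ E(X.addPendant a ha) :=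
  ⟨_, _, Or.inl ⟨rfl, rfl⟩⟩

lemma addPendant_vertexSet : V(X.addPendant a ha) = pendantBase a ⁻¹' V(X) := by
  ext (x | i)
  · simp [addPendant, pendantBase]
  · simp [addPendant, pendantBase, ha]

lemma addPendant_isTreeGraph (hX : X.IsTreeGraph) : (X.addPendant a ha).IsTreeGraph := by
  obtain ⟨⟨x₀, hx₀⟩, hS⟩ := isTreeGraph_iff.1 hX
  refine isTreeGraph_iff.2 ⟨⟨Sum.inl x₀, Or.inl ⟨x₀, hx₀, rfl⟩⟩, subset_rfl, ?_, ?_⟩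
  · rintro (e | i) he p p' hl hc
    · obtain ⟨u, w, h, rfl, rfl⟩ := hl
      refine hS.forest e h.edge_mem u w h ((addPendant_conn_base hc).mono ?_)
      rintro f ⟨hf, hfe⟩
      refine ⟨addPendant_edgeSet_inl.1 hf, ?_⟩
      rintro rfl
      exact hfe rfl
    -- The only edge at the `i`-th new vertex is the deleted one, so this vertex is isolated.
    · have key : ∀ p, (X.addPendant a ha).Conn (E(X.addPendant a ha) \ {Sum.inr i}) p (Sum.inr i) →
          p = Sum.inr i := by
        intro p hp
        rcases hp.eq_or_exists_link with h | ⟨e | j, he, z, hl⟩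
        · exact h
        · obtain ⟨_, _, _, _, h⟩ := hl
          simp at h
        · rcases hl with ⟨-, h⟩ | ⟨-, h⟩
          · cases h
            exact absurd rfl he.2
          · simp at h
      rcases hl with ⟨rfl, rfl⟩ | ⟨rfl, rfl⟩
      · exact absurd (key _ hc) (by simp)
      · exact absurd (key _ hc.symm) (by simp)
  · intro p hp p' hp'
    rw [addPendant_conn_iff fun i => addPendant_edgeSet_inr]
    rw [addPendant_vertexSet] at hp hp'
    refine (hS.conn _ hp _ hp').mono fun e he => (addPendant_edgeSet_inl (a := a) (ha := ha)).2 he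

/-- No new vertex hangs at the root, so all pendant edges survive the deletion of the edges at the
root, and each new vertex joins the branch of its base. -/
lemma addPendant_branch (har : ∀ i, a i ≠ r) :
    (X.addPendant a ha).branch E(X.addPendant a ha) (Sum.inl r) p =
      pendantBase a ⁻¹' X.branch E(X) r (pendantBase a p) := by
  ext p'
  have hinr : ∀ i : Fin q, ¬ (X.addPendant a ha).Inc (Sum.inr i) (Sum.inl r) := by
    rintro i ⟨p, ⟨h, -⟩ | ⟨h, -⟩⟩
    · exact har i (Sum.inl.inj h).symm
    · simp at h
  have hinl : ∀ e, (X.addPendant a ha).Inc (Sum.inl e) (Sum.inl r) ↔ X.Inc e r := by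
    intro e
    constructor
    · rintro ⟨p, u, w, h, h1, -⟩
      cases h1
      exact h.inc_left
    · rintro ⟨w, h⟩
      exact ⟨_, _, _, h, rfl, rfl⟩
  simp only [branch, Set.mem_ofPred_eq, Set.mem_preimage]
  have hP : ∀ i, Sum.inr i ∈ E(X.addPendant a ha) \ (X.addPendant a ha).incidenceSet (Sum.inl r) :=
    fun i => ⟨addPendant_edgeSet_inr, hinr i⟩
  rw [addPendant_conn_iff hP]
  have : Sum.inl ⁻¹' (E(X.addPendant a ha) \ (X.addPendant a ha).incidenceSet (Sum.inl r)) =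
      E(X) \ X.incidenceSet r := by
    ext e
    simp only [Set.mem_preimage, Set.mem_sdiff, mem_incidenceSet, hinl, addPendant_edgeSet_inl]
  rw [this]

lemma ncard_preimage_pendantBase {S : Set α} (hS : S.Finite) :
    (pendantBase a ⁻¹' S).ncard = S.ncard + {i | a i ∈ S}.ncard := by
  have : pendantBase a ⁻¹' S = Sum.inl '' S ∪ Sum.inr '' {i | a i ∈ S} := by
    ext (x | i) <;> simp [pendantBase]
  rw [this, Set.ncard_union_eq _ (hS.image _) (Set.toFinite _),
    Set.ncard_image_of_injective _ Sum.inl_injective,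
    Set.ncard_image_of_injective _ Sum.inr_injective]
  rw [Set.disjoint_left]
  rintro _ ⟨x, -, rfl⟩ ⟨i, -, h⟩
  simp at h

/-- This expresses safety of the enlarged tree inside `X`: outside a branch, old and new vertices
are counted separately. -/
lemma addPendant_isSafeTree_iff (hX : X.IsTreeGraph) (hr : r ∈ V(X)) (hV : V(X).Finite)
    (har : ∀ i, a i ≠ r) : (X.addPendant a ha).IsSafeTree (Sum.inl r) k ↔
      ∀ v ∈ V(X) \ {r}, k ≤ ((V(X) \ {r}) \ X.branch E(X) r v).ncard +
        {i | a i ∉ X.branch E(X) r v}.ncard + 1 := by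
  have hV' : V(X.addPendant a ha) \ {Sum.inl r} = pendantBase a ⁻¹' (V(X) \ {r}) := by
    rw [addPendant_vertexSet]
    ext (x | i)
    · simp [pendantBase]
    · simp [pendantBase, har]
  have hfin : V(X.addPendant a ha).Finite :=
    ((hV.image _).union (Set.finite_range _))
  rw [isSafeTree_iff (addPendant_isTreeGraph hX) (Or.inl ⟨r, hr, rfl⟩) hfin, hV']
  have key : ∀ p, (pendantBase a ⁻¹' (V(X) \ {r}) \ (X.addPendant a ha).branch
      E(X.addPendant a ha) (Sum.inl r) p).ncard =
      ((V(X) \ {r}) \ X.branch E(X) r (pendantBase a p)).ncard +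
        {i | a i ∉ X.branch E(X) r (pendantBase a p)}.ncard := by
    intro p
    rw [addPendant_branch har, ← Set.preimage_sdiff,
      ncard_preimage_pendantBase (hV.subset fun x hx => hx.1.1)]
    congr 2
    ext i
    simp [ha, har]
  simp only [key]
  exact ⟨fun h v hv => h (Sum.inl v) hv, fun h p hp => h _ hp⟩

end Pendant

/-! ### Partial certificates -/

/-- A rooted tree without large branches that can be completed to a safe tree on `2 * k - 2`
vertices besides the root by attaching new vertices to vertices of `L`. -/
structure IsPartialCertificate (G : Graph α β) (r : α) (k : ℕ) (L : Set α) (C : Set β) : Prop where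
  tree : G.RootedTree r C
  card_le : (G.reach C r \ {r}).ncard ≤ 2 * k - 2
  branch_le : ∀ v ∈ G.reach C r \ {r}, (G.branch C r v).ncard ≤ k - 1
  room : 2 * k - 2 ≤ (G.reach C r \ {r}).ncard ∨
    (∃ u ∈ L ∩ (G.reach C r \ {r}), ∃ v ∈ L ∩ (G.reach C r \ {r}), v ∉ G.branch C r u) ∨
    ∃ v ∈ L ∩ (G.reach C r \ {r}), k - 1 ≤ ((G.reach C r \ {r}) \ G.branch C r v).ncard

lemma branch_subset_reach_sdiff (hv : v ∈ G.reach C r \ {r}) :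
    G.branch C r v ⊆ G.reach C r \ {r} := fun _ hw =>
  ⟨branch_subset_reach hv.1 hw, ne_of_mem_branch hv.2 hw⟩

/-- The enlarged tree has `2k - 2` non-root vertices, at least `k - 1` of them outside each branch,
so at most `k - 1` inside. If there are new vertices, either they hang on two different branches, or
all hang on one, and then the `k - 1` vertices outside that branch are old. -/
lemma IsCompactCertificate.isPartialCertificate {X : Graph α β}
    (h : G.IsCompactCertificate r k X) (hV : V(G).Finite) (hk : 1 ≤ k) :
    G.IsPartialCertificate r k (G.largeVerts r k) E(X) := by
  obtain ⟨hle, hr, hcard, ht, -, a, ha, haL, hsafe⟩ := h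
  have hR := ht.reach_eq hle hr
  have hVX : V(X).Finite := hV.subset hle.vertexSet_mono
  have hU : (V(X) \ {r}).Finite := hVX.subset Set.sdiff_subset
  have har : ∀ i, a i ≠ r := fun i => (haL i).1.2
  rw [addPendant_isSafeTree_iff ht hr hVX har] at hsafe
  have hb : ∀ v, X.branch E(X) r v = G.branch E(X) r v := fun v => branch_of_le hle
  simp only [hb] at hsafe
  have hsum : ∀ v ∈ V(X) \ {r}, ((V(X) \ {r}) \ G.branch E(X) r v).ncard +
      (G.branch E(X) r v).ncard = (V(X) \ {r}).ncard := fun v hv =>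
    Set.ncard_sdiff_add_ncard_of_subset (by rw [← hR] at hv ⊢; exact branch_subset_reach_sdiff hv) hU
  have hq : ∀ S : Set α, {i | a i ∉ S}.ncard ≤ 2 * k - 2 - (V(X) \ {r}).ncard := fun S => by
    have := Set.ncard_le_ncard (Set.subset_univ {i | a i ∉ S}) (Set.toFinite _)
    simpa [Set.ncard_univ] using this
  refine ⟨ht.rootedTree hle hr, by rwa [hR], fun v hv => ?_, ?_⟩
  · rw [hR] at hv
    have h1 := hsafe v hv
    have h2 := hsum v hv
    have h3 := hq (G.branch E(X) r v)
    omega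
  · rw [hR]
    by_cases hfull : 2 * k - 2 ≤ (V(X) \ {r}).ncard
    · exact Or.inl hfull
    right
    let i₀ : Fin (2 * k - 2 - (V(X) \ {r}).ncard) := ⟨0, by omega⟩
    have hm : ∀ i, a i ∈ G.largeVerts r k ∩ (V(X) \ {r}) := fun i => ⟨haL i, ha i, har i⟩
    by_cases hall : ∀ i, a i ∈ G.branch E(X) r (a i₀)
    · right
      refine ⟨a i₀, hm i₀, ?_⟩
      have h1 := hsafe _ (hm i₀).2
      have h0 : {i | a i ∉ G.branch E(X) r (a i₀)} = ∅ := by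
        ext i; simpa using hall i
      rw [h0, Set.ncard_empty] at h1
      omega
    · push Not at hall
      obtain ⟨j, hj⟩ := hall
      exact Or.inl ⟨a i₀, hm i₀, a j, hm j, hj⟩

/-- A spanning tree that contains a full partial certificate is safe. -/
lemma IsPartialCertificate.isSafeTree (h : G.IsPartialCertificate r k L C) (hV : V(G).Finite)
    (hr : r ∈ V(G)) (hk : 1 ≤ k) (hfull : 2 * k - 2 ≤ (G.reach C r \ {r}).ncard)
    (hT : G.SpanTree T) (hCT : C ⊆ T) : (G.restrict T).IsSafeTree r k := by
  have hST := hT.isSpanningTreeOf ⟨r, hr⟩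
  rw [isSafeTree_iff hST.2.2 hr hV]
  intro v hv
  rw [branch_of_le restrict_le]
  have hE : E(G.restrict T) = T := by simpa using hT.subset
  rw [hE]
  change v ∈ V(G) \ {r} at hv
  change k ≤ ((V(G) \ {r}) \ _).ncard + 1
  have hfin : ∀ A : Set α, ((V(G) \ {r}) \ A).Finite := fun A => hV.subset fun x hx => hx.1.1
  have hUfin : (G.reach C r \ {r}).Finite := hV.subset (Set.sdiff_subset.trans (reach_subset hr))
  -- If the branch of `v` in `T` meets `C`, it does so in one branch of `C`, which has at most `k -
  -- 1` of the at least `2k - 2` vertices. Otherwise all these vertices lie outside it.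
  by_cases hex : ∃ u ∈ G.reach C r \ {r}, u ∈ G.branch T r v
  · obtain ⟨u, hu, huv⟩ := hex
    rw [← branch_eq_of_mem huv]
    have hsub : (G.reach C r \ {r}) \ G.branch C r u ⊆ (V(G) \ {r}) \ G.branch T r u := by
      rintro w ⟨⟨hw, hwr⟩, hwu⟩
      exact ⟨⟨reach_subset hr hw, hwr⟩,
        fun h => hwu (hT.forest.mem_branch_of_subset hCT hu.1 hu.2 hw h)⟩
    have h1 := Set.ncard_le_ncard hsub (hfin _)
    have h2 := Set.ncard_sdiff_add_ncard_of_subset (branch_subset_reach_sdiff hu) hUfin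
    have h3 := h.branch_le u hu
    omega
  · push Not at hex
    have hsub : G.reach C r \ {r} ⊆ (V(G) \ {r}) \ G.branch T r v := fun w hw =>
      ⟨⟨reach_subset hr hw.1, hw.2⟩, hex w hw⟩
    have h1 := Set.ncard_le_ncard hsub (hfin _)
    omega

/-- Only the branch that receives `w` changes, so the bound has to be checked for this one alone. -/
lemma RootedTree.branch_ncard_insert_le {m : ℕ} (h : G.RootedTree r C) (hV : V(G).Finite)
    (hr : r ∈ V(G)) (hl : G.IsLink e v w) (hv : v ∈ G.reach C r) (hw : w ∉ G.reach C r)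
    (hC : ∀ u ∈ G.reach C r \ {r}, (G.branch C r u).ncard ≤ m)
    (hb : (G.branch (insert e C) r w).ncard ≤ m) :
    ∀ u ∈ G.reach (insert e C) r \ {r}, (G.branch (insert e C) r u).ncard ≤ m := by
  have hRfin : ∀ {F}, (G.reach F r).Finite := hV.subset (reach_subset hr)
  rintro u ⟨hu, hur⟩
  rw [h.reach_insert hl hv hw] at hu
  by_cases hwu : w ∈ G.branch (insert e C) r u
  · rwa [← branch_eq_of_mem hwu]
  · have huw : u ≠ w := by rintro rfl; exact hwu mem_branch_self
    have hu' := hu.resolve_left huw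
    refine (Set.ncard_le_ncard ?_ (hRfin.subset (branch_subset_reach hu'))).trans (hC u ⟨hu', hur⟩)
    intro x hx
    refine (h.branch_insert_subset hl hw huw hx).resolve_left ?_
    rintro rfl
    exact hwu hx

/-- The witnesses of `room` persist: the insertion adds nothing but `w` to the branch of an old
vertex, so old vertices in different branches stay apart. -/
lemma IsPartialCertificate.insert_edge (h : G.IsPartialCertificate r k L C) (hV : V(G).Finite)
    (hr : r ∈ V(G)) (hl : G.IsLink e v w) (hv : v ∈ G.reach C r) (hw : w ∉ G.reach C r)
    (hcard : (G.reach C r \ {r}).ncard < 2 * k - 2)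
    (hb : (G.branch (insert e C) r w).ncard ≤ k - 1) :
    G.IsPartialCertificate r k L (insert e C) ∧
      (G.reach (insert e C) r \ {r}).ncard = (G.reach C r \ {r}).ncard + 1 := by
  have hRfin : ∀ {F}, (G.reach F r).Finite := hV.subset (reach_subset hr)
  have hreach := h.tree.reach_insert hl hv hw
  have hwr : w ≠ r := by rintro rfl; exact hw (Conn.refl _)
  have hU : G.reach (insert e C) r \ {r} = insert w (G.reach C r \ {r}) := by
    rw [hreach, Set.insert_sdiff_of_notMem _ (by simpa using hwr)]
  have hc : (G.reach (insert e C) r \ {r}).ncard = (G.reach C r \ {r}).ncard + 1 := by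
    rw [hU, Set.ncard_insert_of_notMem (fun h => hw h.1) (hRfin.subset Set.sdiff_subset)]
  have hne : ∀ u ∈ G.reach C r, u ≠ w := by rintro u hu rfl; exact hw hu
  have hsub : G.reach C r \ {r} ⊆ G.reach (insert e C) r \ {r} := hU ▸ Set.subset_insert _ _
  refine ⟨⟨h.tree.insert_edge hl hv hw, by omega,
    h.tree.branch_ncard_insert_le hV hr hl hv hw h.branch_le hb, ?_⟩, hc⟩
  · rcases h.room with h' | ⟨u, hu, u', hu', hn⟩ | ⟨u, hu, hle⟩
    · omega
    · refine Or.inr (Or.inl ⟨u, ⟨hu.1, hsub hu.2⟩, u', ⟨hu'.1, hsub hu'.2⟩, fun hm => ?_⟩)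
      rcases h.tree.branch_insert_subset hl hw (hne u hu.2.1) hm with h | h
      · exact hne u' hu'.2.1 h
      · exact hn h
    · refine Or.inr (Or.inr ⟨u, ⟨hu.1, hsub hu.2⟩, hle.trans (Set.ncard_le_ncard ?_
        (hRfin.subset fun x hx => hx.1.1))⟩)
      rintro x ⟨hx, hxb⟩
      refine ⟨hsub hx, fun hm => ?_⟩
      rcases h.tree.branch_insert_subset hl hw (hne u hu.2.1) hm with h | h
      · exact hne x hx.1 h
      · exact hxb h

/-- A partial certificate that is not full has a vertex of `L` in a branch that may grow. -/
lemma IsPartialCertificate.exists_small_branch (h : G.IsPartialCertificate r k L C)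
    (hV : V(G).Finite) (hr : r ∈ V(G)) (hcard : (G.reach C r \ {r}).ncard < 2 * k - 2) :
    ∃ v ∈ L ∩ (G.reach C r \ {r}), (G.branch C r v).ncard < k - 1 := by
  have hUfin : (G.reach C r \ {r}).Finite := hV.subset (Set.sdiff_subset.trans (reach_subset hr))
  rcases h.room with h' | ⟨u, hu, v, hv, hn⟩ | ⟨u, hu, hle⟩
  · omega
  -- Two disjoint branches among fewer than `2k - 2` vertices cannot both have `k - 1` vertices.
  · have hd : Disjoint (G.branch C r u) (G.branch C r v) := by
      rw [Set.disjoint_left]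
      intro x hx hx'
      exact hn (Conn.trans hx (Conn.symm hx'))
    have h1 := Set.ncard_union_eq hd (hUfin.subset (branch_subset_reach_sdiff hu.2))
      (hUfin.subset (branch_subset_reach_sdiff hv.2))
    have h2 := Set.ncard_le_ncard (Set.union_subset (branch_subset_reach_sdiff hu.2)
      (branch_subset_reach_sdiff hv.2)) hUfin
    by_cases h3 : (G.branch C r u).ncard < k - 1
    · exact ⟨u, hu, h3⟩
    · exact ⟨v, hv, by omega⟩
  · have h2 := Set.ncard_sdiff_add_ncard_of_subset (branch_subset_reach_sdiff hu.2) hUfin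
    exact ⟨u, hu, by omega⟩

end Graph

/-! ### Exchanges between disjoint spanning trees, and growth of certificates. -/

namespace Graph

variable {α β : Type*} {G : Graph α β} {F F' C C₁ C₂ T T₁ T₂ : Set β} {e f : β}
  {r u v w x y : α} {k : ℕ} {L : Set α}

/-- `T₁`, `T₂` are the edge sets of disjoint spanning trees that contain `C₁` and `C₂`. -/
structure Completes (G : Graph α β) (C₁ C₂ T₁ T₂ : Set β) : Prop where
  left : G.SpanTree T₁
  right : G.SpanTree T₂
  disjoint : Disjoint T₁ T₂
  subset_left : C₁ ⊆ T₁
  subset_right : C₂ ⊆ T₂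

/-- There are disjoint spanning trees that contain `C₁` and `C₂`. -/
def Completable (G : Graph α β) (C₁ C₂ : Set β) : Prop := ∃ T₁ T₂, G.Completes C₁ C₂ T₁ T₂

lemma Completable.symm (h : G.Completable C₁ C₂) : G.Completable C₂ C₁ := by
  obtain ⟨T₁, T₂, h⟩ := h
  exact ⟨T₂, T₁, h.right, h.left, h.disjoint.symm, h.subset_right, h.subset_left⟩

lemma isCompletablePair_iff {X₁ X₂ : Graph α β} (hV : V(G).Nonempty) :
    G.IsCompletablePair X₁ X₂ ↔ G.Completable E(X₁) E(X₂) := by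
  constructor
  · rintro ⟨T₁, T₂, h₁, h₂, hd, hs₁, hs₂⟩
    exact ⟨E(T₁), E(T₂), h₁.spanTree, h₂.spanTree, hd, hs₁, hs₂⟩
  · rintro ⟨T₁, T₂, h₁, h₂, hd, hs₁, hs₂⟩
    have e₁ : E(G.restrict T₁) = T₁ := by simpa using h₁.subset
    have e₂ : E(G.restrict T₂) = T₂ := by simpa using h₂.subset
    exact ⟨G.restrict T₁, G.restrict T₂, h₁.isSpanningTreeOf hV, h₂.isSpanningTreeOf hV,
      by rwa [e₁, e₂], by rwa [e₁], by rwa [e₂]⟩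

lemma Completes.isSafePair (h : G.Completes C₁ C₂ T₁ T₂) (hV : V(G).Finite) (hr : r ∈ V(G))
    (hk : 1 ≤ k) (h₁ : G.IsPartialCertificate r k L C₁) (h₂ : G.IsPartialCertificate r k L C₂)
    (hf₁ : 2 * k - 2 ≤ (G.reach C₁ r \ {r}).ncard)
    (hf₂ : 2 * k - 2 ≤ (G.reach C₂ r \ {r}).ncard) :
    G.IsSafePair r k (G.restrict T₁) (G.restrict T₂) := by
  have e₁ : E(G.restrict T₁) = T₁ := by simpa using h.left.subset
  have e₂ : E(G.restrict T₂) = T₂ := by simpa using h.right.subset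
  exact ⟨h.left.isSpanningTreeOf ⟨r, hr⟩, h.right.isSpanningTreeOf ⟨r, hr⟩,
    by rw [e₁, e₂]; exact h.disjoint, h₁.isSafeTree hV hr hk hf₁ h.left h.subset_left,
    h₂.isSafeTree hV hr hk hf₂ h.right h.subset_right⟩

lemma RootedTree.notMem_of_isLink (h : G.RootedTree r C) (hw : w ∉ G.reach C r)
    (hl : G.IsLink e v w) : e ∉ C := fun he => hw (h.conn e he _ _ hl.symm)

/-- Deleting all edges of `T₁` at `w` separates `v` from `w`, so one such edge does. It is not in
`C₁`, whose edges avoid `w`, and it gives way to `e`. -/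
lemma Completes.exchange_unused (h : G.Completes C₁ C₂ T₁ T₂) (hE : E(G).Finite)
    (h₁ : G.RootedTree r C₁) (hl : G.IsLink e v w) (hv : v ∈ G.reach C₁ r)
    (hw : w ∉ G.reach C₁ r) (he₂ : e ∉ T₂) :
    G.Completable (insert e C₁) C₂ := by
  have hsep : ¬ G.Conn (T₁ \ (T₁ ∩ G.incidenceSet w)) v w := fun hc => by
    rcases hc.eq_or_exists_link with hvw | ⟨g, hg, z, hgl⟩
    · exact hw (hvw ▸ hv)
    · exact hg.2 ⟨hg.1, hgl.inc_right⟩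
  obtain ⟨f, ⟨⟨-, hfw⟩, hfT⟩, hfsep⟩ := h.left.forest.exists_separating h.left.subset
    (hE.subset (Set.inter_subset_left.trans h.left.subset))
    (h.left.conn v hl.left_mem w hl.right_mem) hsep
  obtain ⟨z, hfz⟩ := hfw
  have hfC : f ∉ C₁ := h₁.notMem_of_isLink hw hfz.symm
  refine ⟨_, T₂, h.left.exchange hfT hl hfsep, h.right, ?_,
    Set.insert_subset_insert fun g hg => ⟨h.subset_left hg, ?_⟩, h.subset_right⟩
  · rw [Set.disjoint_left]
    rintro g (rfl | hg) hg₂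
    · exact he₂ hg₂
    · exact Set.disjoint_left.1 h.disjoint hg.1 hg₂
  · rintro rfl
    exact hfC hg

/-- A second edge of `T` leaving the branch would have to end at `v`, and a forest has only one edge
from `v` into each branch. -/
lemma branch_closed_of_child (hT : G.Forest T) (he : e ∈ T) (hl : G.IsLink e v w)
    (hvw : w ≠ v) : ∀ g ∈ T \ {e}, ∀ a b, G.IsLink g a b → a ∈ G.branch T v w →
      b ∈ G.branch T v w := by
  intro g hg a b hab ha
  by_cases hgv : G.Inc g v
  · exfalso
    have hav := ne_of_mem_branch hvw ha
    have hvb : v = b := (Inc.eq_or_eq_of_isLink hgv hab).resolve_left (Ne.symm hav)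
    subst hvb
    exact hg.2 (hT.eq_of_child he hg.1 hl hab.symm ha).symm
  · exact Conn.trans ha (hab.conn ⟨hg.1, hgv⟩)

/-- Moving `e` from `T₂` to `T₁` splits `T₂` at the boundary of the branch beyond `e`. The path of
`T₁` from `v` to `w` crosses this boundary in an edge `f`, which leaves `T₁` and repairs `T₂`. One
end of `f` lies in the branch, hence outside the tree of `C₁`, so `f` is not in `C₁`. -/
lemma Completes.exchange_used (h : G.Completes C₁ C₂ T₁ T₂) (hE : E(G).Finite)
    (h₁ : G.RootedTree r C₁) (h₂ : G.RootedTree r C₂) (hl : G.IsLink e v w)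
    (hw₂ : w ∉ G.reach C₂ r) (hvw : w ≠ v) (he : e ∈ T₂)
    (hA : Disjoint (G.branch T₂ v w) (G.reach C₁ r)) :
    G.Completable (insert e C₁) C₂ := by
  have hclosed := branch_closed_of_child h.right.forest he hl hvw
  have hvA : v ∉ G.branch T₂ v w := fun hm => ne_of_mem_branch hvw hm rfl
  have hsep : ¬ G.Conn (T₁ \ {f | f ∈ T₁ ∧ ∃ a ∈ G.branch T₂ v w, ∃ b ∉ G.branch T₂ v w,
      G.IsLink f a b}) v w := fun hc => hvA <| hc.symm.mem_of_closed (A := G.branch T₂ v w) (by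
    intro g hg a b hab ha
    by_contra hb
    exact hg.2 ⟨hg.1, a, ha, b, hb, hab⟩) mem_branch_self
  obtain ⟨f, ⟨⟨-, a, ha, b, hb, hab⟩, hfT⟩, hfsep⟩ := h.left.forest.exists_separating h.left.subset
    (hE.subset ((Set.sep_subset _ _).trans h.left.subset))
    (h.left.conn v hl.left_mem w hl.right_mem) hsep
  have hfC : f ∉ C₁ := fun hf => Set.disjoint_left.1 hA ha (h₁.conn f hf a b hab)
  have heC : e ∉ C₂ := h₂.notMem_of_isLink hw₂ hl
  refine ⟨_, _, h.left.exchange hfT hl hfsep, h.right.exchange he hab fun hc =>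
    hb (hc.mem_of_closed hclosed ha), ?_, Set.insert_subset_insert fun g hg =>
      ⟨h.subset_left hg, ?_⟩, fun g hg => Or.inr ⟨h.subset_right hg, ?_⟩⟩
  · rw [Set.disjoint_left]
    rintro g (rfl | hg) (rfl | hg')
    · exact Set.disjoint_left.1 h.disjoint hfT he
    · exact hg'.2 rfl
    · exact hg.2 rfl
    · exact Set.disjoint_left.1 h.disjoint hg.1 hg'.1
  · rintro rfl
    exact hfC hg
  · rintro rfl
    exact heC hg

/-- A completable pair can be extended at a vertex with many neighbours. -/
lemma Completable.exists_extension (h : G.Completable C₁ C₂) (hV : V(G).Finite)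
    (hE : E(G).Finite) (hr : r ∈ V(G)) (h₁ : G.RootedTree r C₁) (h₂ : G.RootedTree r C₂)
    (hv : v ∈ G.reach C₁ r) (hcard : (G.reach C₁ r).ncard + (G.reach C₂ r).ncard +
      (G.reach C₁ r).ncard < {w | G.Adj v w}.ncard) :
    ∃ e w, G.IsLink e v w ∧ w ∉ G.reach C₁ r ∧ w ∉ G.reach C₂ r ∧
      G.Completable (insert e C₁) C₂ := by
  obtain ⟨T₁, T₂, hc⟩ := h
  by_contra hno
  push Not at hno
  have hRfin : ∀ {F}, (G.reach F r).Finite := hV.subset (reach_subset hr)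
  -- If both exchanges fail at `w`, the branch of `T₂` beyond the edge from `v` to `w` contains a
  -- vertex of the first certificate.
  have hN : ∀ w ∈ {w | G.Adj v w} \ (G.reach C₁ r ∪ G.reach C₂ r), ∃ e u, G.IsLink e v w ∧
      e ∈ T₂ ∧ u ∈ G.branch T₂ v w ∧ u ∈ G.reach C₁ r := by
    rintro w ⟨⟨e, hl⟩, hw⟩
    rw [Set.mem_union, not_or] at hw
    have hnc := hno e w hl hw.1 hw.2
    have he : e ∈ T₂ := by_contra fun he => hnc (hc.exchange_unused hE h₁ hl hv hw.1 he)
    have hvw : w ≠ v := by rintro rfl; exact hw.1 hv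
    by_contra hd
    push Not at hd
    exact hnc (hc.exchange_used hE h₁ h₂ hl hw.2 hvw he
      (Set.disjoint_left.2 fun u hu => hd e u hl he hu))
  choose! ε μ hl he hb hR using hN
  -- Branches beyond different neighbours are disjoint, so the chosen vertices of the first
  -- certificate are distinct.
  have h1 : ({w | G.Adj v w} \ (G.reach C₁ r ∪ G.reach C₂ r)).ncard ≤ (G.reach C₁ r).ncard := by
    refine Set.ncard_le_ncard_of_injOn μ hR ?_ hRfin
    intro w hw w' hw' hww
    have : w' ∈ G.branch T₂ v w :=
      Conn.trans (hb w hw) (by rw [hww]; exact Conn.symm (hb w' hw'))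
    have hεε := hc.right.forest.eq_of_child (he w hw) (he w' hw') (hl w hw) (hl w' hw') this
    have hlw := hl w' hw'
    rw [← hεε] at hlw
    exact (hl w hw).right_unique hlw
  have h2 := Set.ncard_union_le (G.reach C₁ r) (G.reach C₂ r)
  have h3 : {w | G.Adj v w}.ncard ≤ ({w | G.Adj v w} \ (G.reach C₁ r ∪ G.reach C₂ r)).ncard +
      (G.reach C₁ r ∪ G.reach C₂ r).ncard :=
    Set.ncard_le_ncard_sdiff_add_ncard _ _ (hRfin.union hRfin)
  omega

/-- A completable pair of partial certificates, the first of which is not full, can be extended. -/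
lemma IsPartialCertificate.exists_insert (h₁ : G.IsPartialCertificate r k (G.largeVerts r k) C₁)
    (h₂ : G.IsPartialCertificate r k (G.largeVerts r k) C₂) (hV : V(G).Finite)
    (hE : E(G).Finite) (hr : r ∈ V(G)) (hc : G.Completable C₁ C₂)
    (hcard : (G.reach C₁ r \ {r}).ncard < 2 * k - 2) :
    ∃ e v w, G.IsLink e v w ∧ e ∉ C₂ ∧ v ∈ G.reach C₁ r ∧ w ∉ G.reach C₁ r ∧
      (G.branch (insert e C₁) r w).ncard ≤ k - 1 ∧ G.Completable (insert e C₁) C₂ := by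
  obtain ⟨v, ⟨hvL, hvR, hvr⟩, hb⟩ := h₁.exists_small_branch hV hr hcard
  have hRfin : ∀ {F}, (G.reach F r).Finite := hV.subset (reach_subset hr)
  have hR : ∀ F, (G.reach F r).ncard = (G.reach F r \ {r}).ncard + 1 := fun F =>
    (Set.ncard_sdiff_singleton_add_one (Conn.refl r) hRfin).symm
  have hc₂ := h₂.card_le
  have hN := hvL.2
  -- With the root, the first tree has at most `2k - 2` vertices and the second at most `2k - 1`.
  -- The required bound is `2(2k - 2) + (2k - 1) = 6k - 5 < 8k - 7`, where `hcard` forces `k ≥ 2`.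
  obtain ⟨e, w, hl, hw₁, hw₂, hc'⟩ := hc.exists_extension hV hE hr h₁.tree h₂.tree hvR
    (by rw [hR, hR]; omega)
  refine ⟨e, v, w, hl, h₂.tree.notMem_of_isLink hw₂ hl, hvR, hw₁, ?_, hc'⟩
  have hwr : w ≠ r := by rintro rfl; exact hw₁ (Conn.refl _)
  have hvw : w ∈ G.branch (insert e C₁) r v := by
    refine hl.conn ⟨Set.mem_insert _ _, fun hi => ?_⟩
    rcases Inc.eq_or_eq_of_isLink hi hl with h | h
    · exact hvr h.symm
    · exact hwr h.symm
  rw [branch_eq_of_mem hvw]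
  have hne : v ≠ w := by rintro rfl; exact hw₁ hvR
  have := Set.ncard_le_ncard (h₁.tree.branch_insert_subset hl hw₁ hne)
    ((hRfin.subset (branch_subset_reach hvR)).insert _)
  have := Set.ncard_insert_le w (G.branch C₁ r v)
  omega

lemma IsPartialCertificate.exists_full (h₁ : G.IsPartialCertificate r k (G.largeVerts r k) C₁)
    (h₂ : G.IsPartialCertificate r k (G.largeVerts r k) C₂) (hV : V(G).Finite)
    (hE : E(G).Finite) (hr : r ∈ V(G)) (hc : G.Completable C₁ C₂) :
    ∃ C, G.IsPartialCertificate r k (G.largeVerts r k) C ∧ G.Completable C C₂ ∧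
      2 * k - 2 ≤ (G.reach C r \ {r}).ncard := by
  generalize hn : 2 * k - 2 - (G.reach C₁ r \ {r}).ncard = n
  induction n generalizing C₁ with
  | zero => exact ⟨C₁, h₁, hc, by omega⟩
  | succ n ih =>
    obtain ⟨e, v, w, hl, -, hv, hw, hb, hc'⟩ := h₁.exists_insert h₂ hV hE hr hc (by omega)
    obtain ⟨h', hcard⟩ := h₁.insert_edge hV hr hl hv hw (by omega) hb
    exact ih h' hc' (by omega)

/-- The certificate held fixed in `exists_full` may be full or not. So the first one is filled, then
the roles are swapped. -/
lemma exists_isSafePair_of_certificates {X₁ X₂ : Graph α β} (hV : V(G).Finite)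
    (hE : E(G).Finite) (hr : r ∈ V(G)) (hk : 1 ≤ k) (h₁ : G.IsCompactCertificate r k X₁)
    (h₂ : G.IsCompactCertificate r k X₂) (hc : G.IsCompletablePair X₁ X₂) :
    ∃ T₁ T₂ : Graph α β, G.IsSafePair r k T₁ T₂ := by
  have p₁ := h₁.isPartialCertificate hV hk
  have p₂ := h₂.isPartialCertificate hV hk
  rw [isCompletablePair_iff ⟨r, hr⟩] at hc
  obtain ⟨D₁, q₁, hc₁, hf₁⟩ := p₁.exists_full p₂ hV hE hr hc
  obtain ⟨D₂, q₂, hc₂, hf₂⟩ := p₂.exists_full q₁ hV hE hr hc₁.symm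
  obtain ⟨T₂, T₁, h⟩ := hc₂
  exact ⟨_, _, h.isSafePair hV hr hk q₂ q₁ hf₂ hf₁⟩

end Graph

namespace Graph

variable {α β : Type*} {G : Graph α β} {F C T : Set β} {e f : β}
  {r u v w x y : α} {k : ℕ} {L : Set α}

/-! ### From safe trees to certificates -/

/-- The tree with the edge set `C` that contains `r`. -/
def rootedSubgraph (G : Graph α β) (C : Set β) (r : α) : Graph α β :=
  (G.restrict C).induce (G.reach C r)

lemma rootedSubgraph_le (hr : r ∈ V(G)) : G.rootedSubgraph C r ≤ G :=
  (induce_le (G := G.restrict C) (reach_subset (G := G) hr)).trans restrict_le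

lemma RootedTree.edgeSet_rootedSubgraph (h : G.RootedTree r C) :
    E(G.rootedSubgraph C r) = C := by
  ext e
  constructor
  · rintro ⟨x, y, hl, -⟩
    exact hl.1
  · intro he
    obtain ⟨x, y, hl⟩ := exists_isLink_of_mem_edgeSet (h.subset he)
    exact ⟨x, y, ⟨he, hl⟩, h.conn e he x y hl, h.conn e he y x hl.symm⟩

lemma RootedTree.isTreeGraph (h : G.RootedTree r C) (hr : r ∈ V(G)) :
    (G.rootedSubgraph C r).IsTreeGraph := by
  have hle := rootedSubgraph_le (C := C) hr
  refine isTreeGraph_iff.2 ⟨⟨r, Conn.refl r⟩, subset_rfl, ?_, fun x hx y hy => ?_⟩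
  · rw [forest_of_le hle subset_rfl, h.edgeSet_rootedSubgraph]
    exact h.forest
  · rw [conn_of_le hle subset_rfl, h.edgeSet_rootedSubgraph]
    exact (Conn.symm hx).trans hy

/-- A rooted subtree of `F` that can be pruned from a certificate: vertices of `L` are leaves. -/
structure IsSeed (G : Graph α β) (r : α) (k : ℕ) (L : Set α) (F C : Set β) : Prop where
  tree : G.RootedTree r C
  subset : C ⊆ F
  card_le : (G.reach C r \ {r}).ncard ≤ 2 * k - 2
  branch_le : ∀ v ∈ G.reach C r \ {r}, (G.branch C r v).ncard ≤ k - 1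
  leaf : ∀ v ∈ L, ∀ e ∈ C, ∀ f ∈ C, G.Inc e v → G.Inc f v → e = f

lemma isSeed_empty : G.IsSeed r k L F ∅ := by
  have : G.reach ∅ r \ {r} = ∅ := by
    ext x
    simp only [Set.mem_sdiff, Set.mem_singleton_iff, Set.mem_empty_iff_false, iff_false, not_and,
      not_not]
    intro hx
    rcases Conn.eq_or_exists_link hx with h | ⟨e, he, -⟩
    · exact h.symm
    · exact absurd he (Set.notMem_empty _)
  refine ⟨⟨Set.empty_subset _, fun e he => absurd he (Set.notMem_empty _),
    fun e he => absurd he (Set.notMem_empty _)⟩, Set.empty_subset _, by simp [this],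
    by simp [this], fun v _ e he => absurd he (Set.notMem_empty _)⟩

/-- Growing at a vertex outside `L` keeps the vertices of `L` leaves, since the new vertex `w` met
no edge of `C` before. -/
lemma IsSeed.insert_edge (h : G.IsSeed r k L F C) (hV : V(G).Finite) (hr : r ∈ V(G))
    (hl : G.IsLink e v w) (he : e ∈ F) (hv : v ∈ G.reach C r) (hvL : v ∉ L)
    (hw : w ∉ G.reach C r) (hcard : (G.reach C r \ {r}).ncard < 2 * k - 2)
    (hb : v ≠ r → (G.branch C r v).ncard < k - 1) : G.IsSeed r k L F (insert e C) := by
  have hRfin : ∀ {F}, (G.reach F r).Finite := hV.subset (reach_subset hr)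
  have hwr : w ≠ r := by rintro rfl; exact hw (Conn.refl _)
  have hne : v ≠ w := by rintro rfl; exact hw hv
  have hnC : ∀ g ∈ C, ¬ G.Inc g w := by
    rintro g hg ⟨z, hz⟩
    exact hw (h.tree.conn g hg _ _ hz)
  refine ⟨h.tree.insert_edge hl hv hw, Set.insert_subset he h.subset, ?_,
    h.tree.branch_ncard_insert_le hV hr hl hv hw h.branch_le ?_, ?_⟩
  · rw [h.tree.reach_insert hl hv hw, Set.insert_sdiff_of_notMem _ (by simpa using hwr)]
    have := Set.ncard_insert_le w (G.reach C r \ {r})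
    omega
  · by_cases hvr : v = r
    · subst hvr
      -- An edge at the root opens a branch with one vertex; `hcard` gives `k ≥ 2`, so this is
      -- within the bound `k - 1`.
      have : G.branch (insert e C) v w ⊆ {w} := by
        intro x hx
        refine h.tree.eq_of_conn_of_notMem hw (Conn.mono ?_ hx)
        rintro g ⟨rfl | hg, hg'⟩
        · exact absurd hl.inc_left hg'
        · exact hg
      have := Set.ncard_le_ncard this
      rw [Set.ncard_singleton] at this
      omega
    · have hvw : w ∈ G.branch (insert e C) r v := by
        refine hl.conn ⟨Set.mem_insert _ _, fun hi => ?_⟩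
        rcases Inc.eq_or_eq_of_isLink hi hl with h | h
        · exact hvr h.symm
        · exact hwr h.symm
      rw [branch_eq_of_mem hvw]
      have := Set.ncard_le_ncard (h.tree.branch_insert_subset hl hw hne)
        ((hRfin.subset (branch_subset_reach hv)).insert _)
      have := Set.ncard_insert_le w (G.branch C r v)
      have := hb hvr
      omega
  · have key : ∀ x ∈ L, ∀ g ∈ C, G.Inc g x → G.Inc e x → False := by
      intro x hx g hg hgx hex
      rcases Inc.eq_or_eq_of_isLink hex hl with rfl | rfl
      · exact hvL hx
      · exact hnC g hg hgx
    rintro x hx g (rfl | hg) g' (rfl | hg') hgx hgx'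
    · rfl
    · exact (key x hx g' hg' hgx' hgx).elim
    · exact (key x hx g hg hgx hgx').elim
    · exact h.leaf x hx g hg g' hg' hgx hgx'

lemma exists_maximal_isSeed (hF : F.Finite) : ∃ C, Maximal (G.IsSeed r k L F) C :=
  (hF.finite_subsets.subset fun _ h => IsSeed.subset h).exists_maximal ⟨∅, isSeed_empty⟩

/-- A maximal seed of a safe spanning tree is a partial certificate. -/
lemma IsSeed.isPartialCertificate (hC : Maximal (G.IsSeed r k L F) C) (hV : V(G).Finite)
    (hr : r ∈ V(G)) (hrL : r ∉ L) (hF : G.SpanTree F) (hcard : 2 * k - 2 ≤ (V(G) \ {r}).ncard)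
    (hsafe : ∀ v ∈ V(G) \ {r}, k ≤ ((V(G) \ {r}) \ G.branch F r v).ncard + 1) :
    G.IsPartialCertificate r k L C := by
  obtain ⟨h, hmax⟩ := hC
  refine ⟨h.tree, h.card_le, h.branch_le, ?_⟩
  by_contra hroom
  push Not at hroom
  obtain ⟨hlt, htwo, hone⟩ := hroom
  have hUfin : (G.reach C r \ {r}).Finite := hV.subset (Set.sdiff_subset.trans (reach_subset hr))
  -- By maximality, edges of `F` can leave the seed only at vertices of `L` or from branches that
  -- already have `k - 1` vertices.
  have hstep : ∀ e v w, G.IsLink e v w → e ∈ F → v ∈ G.reach C r → v ∉ L →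
      (v ≠ r → (G.branch C r v).ncard < k - 1) → w ∈ G.reach C r := by
    intro e v w hl he hv hvL hb
    by_contra hw
    exact hw (h.tree.conn e (hmax (h.insert_edge hV hr hl he hv hvL hw hlt hb)
      (Set.subset_insert _ _) (Set.mem_insert _ _)) _ _ hl.symm)
  have hchild : ∀ w ∈ V(G) \ {r}, ∃ c ∈ G.reach C r \ {r}, w ∈ G.branch F r c := by
    rintro w ⟨hw, hwr⟩
    obtain ⟨e, he, c, hc, hcw⟩ := exists_child (hF.conn r hr w hw) hwr
    exact ⟨c, ⟨hstep e r c hc he (Conn.refl r) hrL fun h => absurd rfl h,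
      ne_of_mem_branch hwr hcw⟩, mem_branch_comm.1 hcw⟩
  -- A branch that is not saturated and misses `L` is therefore a whole branch of `F`.
  have hsmall : ∀ u ∈ G.reach C r \ {r}, (G.branch C r u).ncard < k - 1 →
      (∀ x ∈ G.branch C r u, x ∉ L) → G.branch F r u ⊆ G.branch C r u := by
    intro u hu hcu huL w hw
    refine Conn.mem_of_closed (F := F \ G.incidenceSet r) ?_ hw mem_branch_self
    intro g hg a b hab ha
    have ha' := branch_subset_reach_sdiff hu ha
    have hb : b ∈ G.reach C r := hstep g a b hab hg.1 ha'.1 (huL a ha) fun _ => by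
      rwa [branch_eq_of_mem ha]
    rw [← branch_eq_of_mem ha]
    exact hF.forest.mem_branch_of_subset h.subset ha'.1 ha'.2 hb (hab.conn hg)
  -- If one branch contains all of `L` in the seed and fewer than `k - 1` vertices lie outside it,
  -- all other branches are whole branches of `F`. Then `F` too has fewer than `k - 1` vertices
  -- outside the branch of `v₀`, against safety.
  have key : ∀ v₀ ∈ G.reach C r \ {r}, (∀ u ∈ L ∩ (G.reach C r \ {r}), u ∈ G.branch C r v₀) →
      ((G.reach C r \ {r}) \ G.branch C r v₀).ncard < k - 1 → False := by
    intro v₀ hv₀ hL hlt'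
    have hfin : ((G.reach C r \ {r}) \ G.branch C r v₀).Finite := hUfin.subset Set.sdiff_subset
    have hs := hsafe v₀ ⟨reach_subset hr hv₀.1, hv₀.2⟩
    have hsub : (V(G) \ {r}) \ G.branch F r v₀ ⊆ (G.reach C r \ {r}) \ G.branch C r v₀ := by
      rintro w ⟨hw, hwv⟩
      obtain ⟨c, hc, hwc⟩ := hchild w hw
      have hcv : c ∉ G.branch C r v₀ := fun hm =>
        hwv (Conn.trans (branch_mono h.subset hm) hwc)
      have hB : G.branch C r c ⊆ (G.reach C r \ {r}) \ G.branch C r v₀ := fun x hx =>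
        ⟨branch_subset_reach_sdiff hc hx, fun hx' => hcv (Conn.trans hx' (Conn.symm hx))⟩
      exact hB (hsmall c hc ((Set.ncard_le_ncard hB hfin).trans_lt hlt')
        (fun x hx hxL => (hB hx).2 (hL x ⟨hxL, (hB hx).1⟩)) hwc)
    have := Set.ncard_le_ncard hsub hfin
    omega
  -- The exceptional branch is the one that meets `L`, or else a saturated one. If there is neither,
  -- the seed spans everything and has at least `2k - 2` vertices.
  by_cases hL : ∃ v₀, v₀ ∈ L ∩ (G.reach C r \ {r})
  · obtain ⟨v₀, hv₀⟩ := hL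
    exact key v₀ hv₀.2 (fun u hu => htwo v₀ hv₀ u hu) (hone v₀ hv₀)
  · push Not at hL
    by_cases hbig : ∃ v₀ ∈ G.reach C r \ {r}, k - 1 ≤ (G.branch C r v₀).ncard
    · obtain ⟨v₀, hv₀, hb⟩ := hbig
      refine key v₀ hv₀ (fun u hu => absurd hu (hL u)) ?_
      have := Set.ncard_sdiff_add_ncard_of_subset (branch_subset_reach_sdiff hv₀) hUfin
      omega
    · push Not at hbig
      have hsub : V(G) \ {r} ⊆ G.reach C r \ {r} := by
        intro w hw
        obtain ⟨c, hc, hwc⟩ := hchild w hw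
        exact branch_subset_reach_sdiff hc (hsmall c hc (hbig c hc)
          (fun x hx hxL => hL x ⟨hxL, branch_subset_reach_sdiff hc hx⟩) hwc)
      have := Set.ncard_le_ncard hsub hUfin
      omega

lemma ncard_setOf_fin_val_lt {q j : ℕ} (h : j ≤ q) : {i : Fin q | (i : ℕ) < j}.ncard = j := by
  rw [← Set.ncard_image_of_injective _ Fin.val_injective]
  have : Fin.val '' {i : Fin q | (i : ℕ) < j} = ↑(Finset.range j) := by
    ext x
    simp only [Set.mem_image, Set.mem_ofPred_eq, Finset.coe_range, Set.mem_Iio]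
    exact ⟨by rintro ⟨i, hi, rfl⟩; exact hi, fun hx => ⟨⟨x, hx.trans_le h⟩, hx, rfl⟩⟩
  rw [this, Set.ncard_coe_finset, Finset.card_range]

/-- The new vertices of a certificate can be distributed to the vertices of `L`. -/
lemma IsPartialCertificate.exists_distribution (h : G.IsPartialCertificate r k L C)
    (hV : V(G).Finite) (hr : r ∈ V(G)) :
    ∃ a : Fin (2 * k - 2 - (G.reach C r \ {r}).ncard) → α,
      (∀ i, a i ∈ L ∩ (G.reach C r \ {r})) ∧ ∀ v ∈ G.reach C r \ {r},
        k ≤ ((G.reach C r \ {r}) \ G.branch C r v).ncard + {i | a i ∉ G.branch C r v}.ncard + 1 := by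
  have hUfin : (G.reach C r \ {r}).Finite := hV.subset (Set.sdiff_subset.trans (reach_subset hr))
  have hcard := h.card_le
  have hsum : ∀ v ∈ G.reach C r \ {r}, ((G.reach C r \ {r}) \ G.branch C r v).ncard +
      (G.branch C r v).ncard = (G.reach C r \ {r}).ncard := fun v hv =>
    Set.ncard_sdiff_add_ncard_of_subset (branch_subset_reach_sdiff hv) hUfin
  have hb := h.branch_le
  generalize hq : 2 * k - 2 - (G.reach C r \ {r}).ncard = q
  have huniv : ∀ p : Fin q → Prop, (∀ i, p i) → {i | p i}.ncard = q := by
    intro p hp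
    have : {i | p i} = Set.univ := by ext i; simpa using hp i
    rw [this, Set.ncard_univ, Nat.card_fin]
  by_cases hfull : 2 * k - 2 ≤ (G.reach C r \ {r}).ncard
  · obtain rfl : q = 0 := by omega
    refine ⟨fun i => i.elim0, fun i => i.elim0, fun v hv => ?_⟩
    have := hsum v hv
    have := hb v hv
    omega
  rcases h.room with h' | ⟨u, hu, v, hv, huv⟩ | ⟨v₀, hv₀, hle⟩
  · exact absurd h' hfull
  · have hd : Disjoint (G.branch C r u) (G.branch C r v) := by
      rw [Set.disjoint_left]
      intro x hx hx'
      exact huv (Conn.trans hx (Conn.symm hx'))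
    have h1 := Set.ncard_union_eq hd (hUfin.subset (branch_subset_reach_sdiff hu.2))
      (hUfin.subset (branch_subset_reach_sdiff hv.2))
    have h2 := Set.ncard_le_ncard (Set.union_subset (branch_subset_reach_sdiff hu.2)
      (branch_subset_reach_sdiff hv.2)) hUfin
    have hbu := hb u hu.2
    have hbv := hb v hv.2
    -- The branch of `u` is filled up to `k - 1` as far as the new vertices suffice. If some remain
    -- for `v`, its branch ends up among the other `k - 1` of the `2k - 2` vertices.
    let j := min q (k - 1 - (G.branch C r u).ncard)
    have hjq : j ≤ q := min_le_left _ _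
    have hj := ncard_setOf_fin_val_lt hjq
    have hj' : {i : Fin q | ¬ (i : ℕ) < j}.ncard = q - j := by
      have := Set.ncard_add_ncard_compl {i : Fin q | (i : ℕ) < j}
      rw [Nat.card_fin, hj] at this
      have h' : {i : Fin q | (i : ℕ) < j}ᶜ = {i : Fin q | ¬ (i : ℕ) < j} := rfl
      rw [h'] at this
      omega
    refine ⟨fun i => if (i : ℕ) < j then u else v, fun i => ?_, fun x hx => ?_⟩
    · by_cases hi : (i : ℕ) < j <;> simp only [hi, if_true, if_false, hu, hv]
    · have hbx := hb x hx
      have hsx := hsum x hx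
      by_cases hux : u ∈ G.branch C r x
      · have hvx : v ∉ G.branch C r x := by rwa [← branch_eq_of_mem hux]
        have hset : {i : Fin q | (if (i : ℕ) < j then u else v) ∉ G.branch C r x} =
            {i : Fin q | ¬ (i : ℕ) < j} := by
          ext i
          by_cases hi : (i : ℕ) < j
          · simp [hi, hux]
          · simpa [hvx, if_neg hi] using not_lt.1 hi
        rw [hset, hj']
        rw [← branch_eq_of_mem hux] at hsx ⊢
        omega
      · by_cases hvx : v ∈ G.branch C r x
        · have hset : {i : Fin q | (if (i : ℕ) < j then u else v) ∉ G.branch C r x} =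
              {i : Fin q | (i : ℕ) < j} := by
            ext i; by_cases hi : (i : ℕ) < j <;> simp [hi, hux, hvx]
          rw [hset, hj]
          rw [← branch_eq_of_mem hvx] at hsx ⊢
          omega
        · rw [huniv _ fun i => by
            by_cases hi : (i : ℕ) < j <;> simp only [hi, if_true, if_false, hux, hvx,
              not_false_eq_true]]
          omega
  · refine ⟨fun _ => v₀, fun _ => hv₀, fun x hx => ?_⟩
    have hbx := hb x hx
    have hsx := hsum x hx
    by_cases hm : v₀ ∈ G.branch C r x
    · rw [← branch_eq_of_mem hm]
      omega
    · rw [huniv _ fun _ => hm]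
      omega

/-- The certificate is a maximal seed of `T`; because it lies inside `T`, the given trees will
complete it. -/
lemma IsSafeTree.exists_isCompactCertificate {T : Graph α β} (hT : T.IsSafeTree r k)
    (hTG : T.IsSpanningTreeOf G) (hV : V(G).Finite) (hE : E(G).Finite) (hr : r ∈ V(G))
    (hcard : 2 * k - 2 ≤ (V(G) \ {r}).ncard) :
    ∃ X, G.IsCompactCertificate r k X ∧ E(X) ⊆ E(T) := by
  have hS := hTG.spanTree
  have hsafe := (isSafeTree_iff hT.1 hT.2.1 (by rw [hTG.2.1]; exact hV)).1 hT
  simp only [branch_of_le hTG.1, hTG.2.1] at hsafe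
  obtain ⟨C, hC⟩ := exists_maximal_isSeed (G := G) (r := r) (k := k) (L := G.largeVerts r k)
    (hE.subset hS.subset)
  have hP := IsSeed.isPartialCertificate hC hV hr (fun h => h.1.2 rfl) hS hcard hsafe
  have hEX := hP.tree.edgeSet_rootedSubgraph
  have hle := rootedSubgraph_le (C := C) hr
  have hVX : V(G.rootedSubgraph C r) = G.reach C r := rfl
  have htree := hP.tree.isTreeGraph hr
  have hdistr := hP.exists_distribution hV hr
  rw [← hVX] at hdistr
  obtain ⟨a, ha, hdist⟩ := hdistr
  refine ⟨G.rootedSubgraph C r, ⟨hle, Conn.refl r, hP.card_le, htree, ?_, a,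
    fun i => (ha i).2.1, fun i => (ha i).1, ?_⟩, hEX.le.trans hC.1.subset⟩
  · rintro v ⟨hv, hvL⟩
    refine ⟨hv, Set.ncard_eq_one.2 ?_⟩
    rcases Conn.eq_or_exists_link hv with h | ⟨e, he, z, hl⟩
    · exact absurd h.symm hvL.1.2
    · have hinc : ∀ g, (G.rootedSubgraph C r).Inc g v ↔ g ∈ C ∧ G.Inc g v := by
        intro g
        constructor
        · intro h
          exact ⟨hEX ▸ h.edge_mem, h.mono hle⟩
        · rintro ⟨hg, h⟩
          exact (hle.inc_congr (by rwa [hEX])).2 h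
      refine ⟨e, Set.ext fun g => ?_⟩
      rw [mem_incidenceSet, hinc, Set.mem_singleton_iff]
      constructor
      · rintro ⟨hg, h⟩
        exact hC.1.leaf v hvL g hg e he h hl.inc_right
      · rintro rfl
        exact ⟨he, hl.inc_right⟩
  · rw [addPendant_isSafeTree_iff htree (Conn.refl r) (hV.subset (reach_subset hr))
      fun i => (ha i).2.2]
    intro v hv
    rw [branch_of_le hle, hEX]
    exact hdist v hv

theorem exists_isSafePair_iff (hV : V(G).Finite) (hE : E(G).Finite) (hr : r ∈ V(G)) (hk : 1 ≤ k)
    (hcard : 2 * k - 2 ≤ (V(G) \ {r}).ncard) :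
    (∃ T₁ T₂ : Graph α β, G.IsSafePair r k T₁ T₂) ↔
      ∃ X₁ X₂ : Graph α β, G.IsCompactCertificate r k X₁ ∧ G.IsCompactCertificate r k X₂ ∧
        G.IsCompletablePair X₁ X₂ := by
  constructor
  · rintro ⟨T₁, T₂, h₁, h₂, hd, hs₁, hs₂⟩
    obtain ⟨X₁, hX₁, he₁⟩ := hs₁.exists_isCompactCertificate h₁ hV hE hr hcard
    obtain ⟨X₂, hX₂, he₂⟩ := hs₂.exists_isCompactCertificate h₂ hV hE hr hcard
    exact ⟨X₁, X₂, hX₁, hX₂, T₁, T₂, h₁, h₂, hd, he₁, he₂⟩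
  · rintro ⟨X₁, X₂, h₁, h₂, hc⟩
    exact exists_isSafePair_of_certificates hV hE hr hk h₁ h₂ hc

end Graph

/-- An increasing sequence of subsets of a finite set `S` that is constant from the first
repetition on is constant from the index `S.ncard` on. -/
lemma Set.subset_of_stabilising {γ : Type*} {A : ℕ → Set γ} {S : Set γ} {n : ℕ} (hS : S.Finite)
    (hmono : Monotone A) (hA : ∀ d, A d ⊆ S) (hst : ∀ d, A d = A (d + 1) → A (d + 1) = A (d + 2))
    (hn : S.ncard ≤ n) (d : ℕ) : A d ⊆ A n := by
  have hfin : ∀ d, (A d).Finite := fun d => hS.subset (hA d)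
  have key : ∀ {i j}, i ≤ j → (A i).ncard = (A j).ncard → A i = A j := fun hij h =>
    Set.eq_of_subset_of_ncard_le (hmono hij) h.ge (hfin _)
  have hstab := @Nat.stabilises_of_monotone (fun d => (A d).ncard) S.ncard
  have h1 := fun n => @hstab n (fun i j hij => Set.ncard_le_ncard (hmono hij) (hfin _))
    (fun d => Set.ncard_le_ncard (hA d) hS)
    (fun d h => congrArg Set.ncard (hst d (key (Nat.le_succ d) h)))
  rcases le_total d n with h | h
  · exact hmono h
  · have h2 := h1 n hn
    have h3 := h1 d (hn.trans h)
    exact (key h (h2.trans h3.symm)).ge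

namespace Graph

variable {α β : Type*} {G : Graph α β} {F C T : Set β} {e f : β} {x y : α} {c d : ℕ}
  {lock own : β → ℕ}

/-! ### Matroid union -/

/-- The edges of colour `c`. -/
def cls (G : Graph α β) (o : β → ℕ) (c : ℕ) : Set β := {e | e ∈ E(G) ∧ o e = c}

/-- The ends of `e` are connected in `F`. -/
def Spans (G : Graph α β) (F : Set β) (e : β) : Prop := ∀ x y, G.IsLink e x y → G.Conn F x y

lemma IsLink.spans_iff (h : G.IsLink e x y) : G.Spans F e ↔ G.Conn F x y := by
  refine ⟨fun hs => hs x y h, fun hc u v huv => ?_⟩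
  rcases huv.eq_and_eq_or_eq_and_eq h with ⟨rfl, rfl⟩ | ⟨rfl, rfl⟩
  · exact hc
  · exact hc.symm

lemma Spans.mono (h : G.Spans F e) (hF : F ⊆ C) : G.Spans C e := fun x y hl => (h x y hl).mono hF

lemma spans_of_mem (h : e ∈ F) : G.Spans F e := fun _ _ hl => hl.conn h

/-- The colours `1` and `2` form forests; edges locked to a colour have that colour. -/
structure IsTwoForest (G : Graph α β) (lock own : β → ℕ) : Prop where
  le_two : ∀ e ∈ E(G), own e ≤ 2
  forest : ∀ c, c = 1 ∨ c = 2 → G.Forest (G.cls own c)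
  locked : ∀ e ∈ E(G), lock e ≠ 0 → own e = lock e

/-- The edges reached from uncoloured edges after `d` exchanges: `e` leads to an unlocked edge `f`
of another colour that lies on the cycle closed by `e` in the colour of `f`. -/
def level (G : Graph α β) (lock own : β → ℕ) : ℕ → Set β
  | 0 => G.cls own 0
  | d + 1 => level G lock own d ∪ {f | f ∈ E(G) ∧ own f ≠ 0 ∧ lock f = 0 ∧
      ∃ e ∈ level G lock own d, own e ≠ own f ∧ ¬ G.Spans (G.cls own (own f) \ {f}) e}

/-- The edge `e` of level at most `d` may receive the colour `c`. -/
structure Augments (G : Graph α β) (lock own : β → ℕ) (d : ℕ) (e : β) (c : ℕ) : Prop where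
  mem : e ∈ G.level lock own d
  colour : c = 1 ∨ c = 2
  ne : own e ≠ c
  free : ¬ G.Spans (G.cls own c) e

lemma level_mono : Monotone (G.level lock own) :=
  monotone_nat_of_le_succ fun _ => Set.subset_union_left

lemma level_subset (d : ℕ) : G.level lock own d ⊆ E(G) := by
  induction d with
  | zero => exact fun e he => he.1
  | succ d ih => exact Set.union_subset ih fun e he => he.1

/-- A level is determined by the preceding one, so the increasing sequence is constant from its
first repetition, which occurs within `E(G).ncard` steps. -/
lemma level_subset_level (hE : E(G).Finite) {m : ℕ} (hm : E(G).ncard ≤ m) (d : ℕ) :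
    G.level lock own d ⊆ G.level lock own m := by
  refine Set.subset_of_stabilising hE level_mono level_subset (fun d h => ?_) hm d
  have hs : G.level lock own (d + 2) = G.level lock own (d + 1) ∪ {f | f ∈ E(G) ∧ own f ≠ 0 ∧
      lock f = 0 ∧ ∃ e ∈ G.level lock own (d + 1), own e ≠ own f ∧
        ¬ G.Spans (G.cls own (own f) \ {f}) e} := rfl
  rw [hs, ← h]
  exact h

lemma IsTwoForest.lock_eq_zero (h : G.IsTwoForest lock own) (he : e ∈ G.level lock own d) :
    lock e = 0 := by
  induction d with
  | zero =>
    by_contra h0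
    exact h0 ((h.locked e he.1 h0).symm.trans he.2)
  | succ d ih => exact he.elim ih fun he => he.2.2.1

lemma IsTwoForest.eq_one_or_two (h : G.IsTwoForest lock own) (he : e ∈ E(G)) (h0 : own e ≠ 0) :
    own e = 1 ∨ own e = 2 := by
  have := h.le_two e he
  omega

open Classical in
lemma cls_update_self (he : e ∈ E(G)) :
    G.cls (Function.update own e c) c = insert e (G.cls own c) := by
  ext f
  by_cases hf : f = e
  · subst hf; simp [cls, he]
  · simp [cls, hf]

open Classical in
lemma cls_update_of_ne {c' : ℕ} (hc : c' ≠ c) :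
    G.cls (Function.update own e c) c' = G.cls own c' \ {e} := by
  ext f
  by_cases hf : f = e
  · subst hf; simp [cls, hc.symm]
  · simp [cls, hf]

open Classical in
lemma IsTwoForest.update (h : G.IsTwoForest lock own) (ha : G.Augments lock own d e c) :
    G.IsTwoForest lock (Function.update own e c) := by
  refine ⟨fun f hfE => ?_, fun c' hc' => ?_, fun f hfE hf => ?_⟩
  · by_cases hf : f = e
    · subst hf
      rw [Function.update_self]
      rcases ha.colour with h | h <;> omega
    · rw [Function.update_of_ne hf]
      exact h.le_two f hfE
  · by_cases hcc : c' = c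
    · subst hcc
      have heE := level_subset _ ha.mem
      rw [cls_update_self heE]
      obtain ⟨x, y, hl⟩ := exists_isLink_of_mem_edgeSet heE
      exact (h.forest c' hc').insert_edge hl fun hc => ha.free (hl.spans_iff.2 hc)
    · rw [cls_update_of_ne hcc]
      exact (h.forest c' hc').subset Set.sdiff_subset
  · have hfe : f ≠ e := by
      rintro rfl
      exact hf (h.lock_eq_zero ha.mem)
    rw [Function.update_of_ne hfe]
    exact h.locked f hfE hf

open Classical in
/-- Colouring a free edge of minimal level either colours a new edge or decreases the level. -/
lemma IsTwoForest.augment (h : G.IsTwoForest lock own) (ha : G.Augments lock own d e c)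
    (hmin : ∀ d' < d, ∀ e' c', ¬ G.Augments lock own d' e' c') :
    (d = 0 ∧ G.cls (Function.update own e c) 0 = G.cls own 0 \ {e} ∧ e ∈ G.cls own 0) ∨
      ∃ d', d = d' + 1 ∧ G.cls (Function.update own e c) 0 ⊆ G.cls own 0 ∧
        ∃ e' c', G.Augments lock (Function.update own e c) d' e' c' := by
  have hc0 : (0 : ℕ) ≠ c := by rcases ha.colour with h | h <;> omega
  cases d with
  | zero => exact Or.inl ⟨rfl, cls_update_of_ne hc0, ha.mem⟩
  | succ d =>
    refine Or.inr ⟨d, rfl, by rw [cls_update_of_ne hc0]; exact Set.sdiff_subset, ?_⟩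
    have hed : e ∉ G.level lock own d := fun hm =>
      hmin d (Nat.lt_succ_self d) e c ⟨hm, ha.colour, ha.ne, ha.free⟩
    -- The edge `e'` of level `d` leads to `e`. Once `e` has left its old colour, `e'` is free in
    -- that colour, and this is the augmentation of smaller level.
    obtain ⟨heE, he0, hel, e', he', hne, hfree⟩ := ha.mem.resolve_left hed
    have hsub : ∀ j ≤ d, G.level lock own j ⊆ G.level lock (Function.update own e c) j := by
      intro j hj
      induction j with
      | zero =>
        intro g hg
        have hge : g ≠ e := by rintro rfl; exact he0 hg.2
        exact ⟨hg.1, by rw [Function.update_of_ne hge]; exact hg.2⟩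
      | succ j ih =>
        have ih := ih (by omega)
        intro f hf
        have hfe : f ≠ e := by rintro rfl; exact hed (level_mono hj hf)
        rcases hf with hf | ⟨hfE, hf0, hfl, g, hg, hgf, hgs⟩
        · exact Or.inl (ih hf)
        have hge : g ≠ e := by rintro rfl; exact hed (level_mono (by omega) hg)
        refine Or.inr ⟨hfE, by rwa [Function.update_of_ne hfe], hfl, g, ih hg, ?_, ?_⟩
        · rwa [Function.update_of_ne hfe, Function.update_of_ne hge]
        · rw [Function.update_of_ne hfe]
          by_cases hcf : own f = c
          -- The critical case: `e` joins the colour of `f` and might bypass `f` on the cycle closed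
          -- by `g`. Then `g` together with colour `c` would span `e`. By minimality of the level,
          -- `g` is itself spanned by colour `c`, so `e` would not be free.
          · rw [hcf, cls_update_self heE, ← hcf]
            obtain ⟨x, y, hxy⟩ := exists_isLink_of_mem_edgeSet (level_subset _ hg)
            obtain ⟨a, b, hab⟩ := exists_isLink_of_mem_edgeSet heE
            rw [hxy.spans_iff] at hgs ⊢
            intro hcon
            rw [Set.insert_sdiff_of_notMem _ (by simpa using Ne.symm hfe)] at hcon
            have h1 := conn_exchange hab hxy hcon hgs
            have hgc : G.Conn (G.cls own (own f)) x y := by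
              by_contra hn
              exact hmin j (by omega) g (own f) ⟨hg, h.eq_one_or_two hfE hf0, hgf,
                fun hs => hn (hs x y hxy)⟩
            refine ha.free (hab.spans_iff.2 (h1.of_forall_link fun i hi u v huv => ?_))
            rcases hi with rfl | hi
            · rw [← hcf]
              exact (hxy.spans_iff.2 hgc) u v huv
            · rw [← hcf]
              exact huv.conn hi.1
          · rw [cls_update_of_ne hcf]
            exact fun hs => hgs (hs.mono (Set.sdiff_subset_sdiff_left Set.sdiff_subset))
    have hee : e' ≠ e := by rintro rfl; exact hne rfl
    refine ⟨e', own e, hsub d le_rfl he', h.eq_one_or_two heE he0, ?_, ?_⟩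
    · rwa [Function.update_of_ne hee]
    · rw [cls_update_of_ne ha.ne]
      exact hfree

/-- An edge of `T` with ends not connected in `F` would extend `F` to a forest larger than a
spanning tree. -/
lemma Forest.spans_of_ncard_le (hF : G.Forest F) (hFE : F ⊆ E(G)) (hE : E(G).Finite)
    (hT : G.SpanTree T) (hcard : T.ncard ≤ F.ncard) : G.SpanTree F := by
  refine ⟨hFE, hF, fun x hx y hy => (hT.conn x hx y hy).of_forall_link fun e he a b hab => ?_⟩
  by_contra hn
  have heF : e ∉ F := fun he => hn (hab.conn he)
  have h1 := (hF.insert_edge hab hn).ncard_le (Set.insert_subset hab.edge_mem hFE)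
    ((hE.subset hFE).insert e) (hE.subset hT.subset) hT.subset
    fun g _ u v huv => hT.conn u huv.left_mem v huv.right_mem
  rw [Set.ncard_insert_of_notMem heF (hE.subset hFE)] at h1
  omega

/-- If no edge can be recoloured and the locked edges are completable, then the two forests are
spanning trees. -/
lemma IsTwoForest.completes (h : G.IsTwoForest lock own) (hE : E(G).Finite)
    (hno : ∀ d e c, ¬ G.Augments lock own d e c)
    (hc : G.Completable (G.cls lock 1) (G.cls lock 2)) :
    G.Completes (G.cls lock 1) (G.cls lock 2) (G.cls own 1) (G.cls own 2) := by
  obtain ⟨T₁, T₂, hT⟩ := hc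
  -- The set reachable in the exchange digraph; it is the tight set in the rank formula for matroid
  -- union.
  let R : Set β := ⋃ d, G.level lock own d
  have hclsE : ∀ {o : β → ℕ} {c}, G.cls o c ⊆ E(G) := fun he => he.1
  have hfin : ∀ {A : Set β}, A ⊆ E(G) → A.Finite := fun hA => hE.subset hA
  have hlock : ∀ c, c = 1 ∨ c = 2 → G.cls lock c ⊆ G.cls own c := by
    rintro c hc e ⟨he, rfl⟩
    exact ⟨he, h.locked e he (by omega)⟩
  have hspan : ∀ c, c = 1 ∨ c = 2 → ∀ e ∈ R,
      G.Spans ((G.cls own c ∩ R) ∪ G.cls lock c) e := by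
    intro c hc e he
    obtain ⟨d, hd⟩ := Set.mem_iUnion.1 he
    have heE := level_subset _ hd
    by_cases hec : own e = c
    · exact spans_of_mem (Or.inl ⟨⟨heE, hec⟩, he⟩)
    obtain ⟨x, y, hxy⟩ := exists_isLink_of_mem_edgeSet heE
    have hcon : G.Conn (G.cls own c) x y := by
      by_contra hn
      exact hno d e c ⟨hd, hc, hec, fun hs => hn (hs x y hxy)⟩
    rw [hxy.spans_iff]
    by_contra hn
    -- Otherwise the cycle closed by `e` in colour `c` contains an unlocked edge `f` outside `R`,
    -- but `e` leads to `f`, one level further.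
    obtain ⟨f, ⟨hfS, hf⟩, hsep⟩ := (h.forest c hc).exists_separating hclsE
      (hfin (A := G.cls own c \ (R ∪ G.cls lock c)) (Set.sdiff_subset.trans hclsE)) hcon
      (fun hcon' => hn (hcon'.mono (by
        rintro g ⟨hg, hg'⟩
        by_contra hgn
        refine hg' ⟨hg, fun hgR => hgn ?_⟩
        exact hgR.imp (fun h => ⟨hg, h⟩) id)))
    refine hfS.2 (Or.inl (Set.mem_iUnion.2 ⟨d + 1, Or.inr ⟨hf.1, ?_, ?_, e, hd, ?_, ?_⟩⟩))
    · have := hf.2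
      omega
    · by_contra h0
      exact hfS.2 (Or.inr ⟨hf.1, (h.locked f hf.1 h0).symm.trans hf.2⟩)
    · rwa [hf.2]
    · rw [hf.2, hxy.spans_iff]
      exact hsep
  have hcount : ∀ c, c = 1 ∨ c = 2 → ∀ T, G.SpanTree T → G.cls lock c ⊆ T →
      ((T ∩ R) ∪ G.cls lock c).ncard ≤ ((G.cls own c ∩ R) ∪ G.cls lock c).ncard := by
    intro c hc T hT hcT
    have hsub : (T ∩ R) ∪ G.cls lock c ⊆ T := Set.union_subset Set.inter_subset_left hcT
    have hsub' : (G.cls own c ∩ R) ∪ G.cls lock c ⊆ E(G) :=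
      Set.union_subset (Set.inter_subset_left.trans hclsE) hclsE
    refine (hT.forest.subset hsub).ncard_le (hsub.trans hT.subset) (hfin (hsub.trans hT.subset))
      (hfin hsub') hsub' ?_
    rintro e (he | he) x y hxy
    · exact hspan c hc e he.2 x y hxy
    · exact hxy.conn (Or.inr he)
  -- Outside `R` every edge is coloured, so the remaining edges of `T₁` and `T₂` are among the
  -- remaining coloured edges. With `hcount` this gives that the two colours together have at least
  -- as many edges as `T₁` and `T₂`, so neither colour is smaller than a spanning tree.
  have hrest : (T₁ \ ((T₁ ∩ R) ∪ G.cls lock 1)) ∪ (T₂ \ ((T₂ ∩ R) ∪ G.cls lock 2)) ⊆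
      (G.cls own 1 \ ((G.cls own 1 ∩ R) ∪ G.cls lock 1)) ∪
        (G.cls own 2 \ ((G.cls own 2 ∩ R) ∪ G.cls lock 2)) := by
    have key : ∀ e ∈ E(G), e ∉ R → e ∉ G.cls lock 1 → e ∉ G.cls lock 2 →
        e ∈ (G.cls own 1 \ ((G.cls own 1 ∩ R) ∪ G.cls lock 1)) ∪
        (G.cls own 2 \ ((G.cls own 2 ∩ R) ∪ G.cls lock 2)) := by
      intro e heE heR h1 h2
      have h0 : own e ≠ 0 := fun h0 => heR (Set.mem_iUnion.2 ⟨0, heE, h0⟩)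
      rcases h.eq_one_or_two heE h0 with hc | hc
      · exact Or.inl ⟨⟨heE, hc⟩, fun h => h.elim (fun h => heR h.2) h1⟩
      · exact Or.inr ⟨⟨heE, hc⟩, fun h => h.elim (fun h => heR h.2) h2⟩
    rintro e (⟨he, hn⟩ | ⟨he, hn⟩)
    · exact key e (hT.left.subset he) (fun hR => hn (Or.inl ⟨he, hR⟩)) (fun hl => hn (Or.inr hl))
        fun hl => Set.disjoint_left.1 hT.disjoint he (hT.subset_right hl)
    · exact key e (hT.right.subset he) (fun hR => hn (Or.inl ⟨he, hR⟩))
        (fun hl => Set.disjoint_left.1 hT.disjoint (hT.subset_left hl) he)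
        (fun hl => hn (Or.inr hl))
  have hdisj : Disjoint (T₁ \ ((T₁ ∩ R) ∪ G.cls lock 1)) (T₂ \ ((T₂ ∩ R) ∪ G.cls lock 2)) :=
    hT.disjoint.mono Set.sdiff_subset Set.sdiff_subset
  have r1 := Set.ncard_le_ncard hrest (hfin (Set.union_subset (Set.sdiff_subset.trans hclsE)
    (Set.sdiff_subset.trans hclsE)))
  rw [Set.ncard_union_eq hdisj (hfin (Set.sdiff_subset.trans hT.left.subset))
    (hfin (Set.sdiff_subset.trans hT.right.subset))] at r1
  have r2 := r1.trans (Set.ncard_union_le _ _)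
  have s1 := Set.ncard_sdiff_add_ncard_of_subset (s := (T₁ ∩ R) ∪ G.cls lock 1) (t := T₁)
    (Set.union_subset Set.inter_subset_left hT.subset_left) (hfin hT.left.subset)
  have s2 := Set.ncard_sdiff_add_ncard_of_subset (s := (T₂ ∩ R) ∪ G.cls lock 2) (t := T₂)
    (Set.union_subset Set.inter_subset_left hT.subset_right) (hfin hT.right.subset)
  have s3 := Set.ncard_sdiff_add_ncard_of_subset (s := (G.cls own 1 ∩ R) ∪ G.cls lock 1)
    (t := G.cls own 1) (Set.union_subset Set.inter_subset_left (hlock 1 (Or.inl rfl))) (hfin hclsE)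
  have s4 := Set.ncard_sdiff_add_ncard_of_subset (s := (G.cls own 2 ∩ R) ∪ G.cls lock 2)
    (t := G.cls own 2) (Set.union_subset Set.inter_subset_left (hlock 2 (Or.inr rfl))) (hfin hclsE)
  have c1 := hcount 1 (Or.inl rfl) T₁ hT.left hT.subset_left
  have c2 := hcount 2 (Or.inr rfl) T₂ hT.right hT.subset_right
  have hle : ∀ c, c = 1 ∨ c = 2 → ∀ T, G.SpanTree T → (G.cls own c).ncard ≤ T.ncard :=
    fun c hc T hT => (h.forest c hc).ncard_le hclsE (hfin hclsE) (hfin hT.subset) hT.subset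
      fun e _ x y hxy => hT.conn x hxy.left_mem y hxy.right_mem
  have l1 := hle 1 (Or.inl rfl) T₁ hT.left
  have l2 := hle 2 (Or.inr rfl) T₂ hT.right
  refine ⟨(h.forest 1 (Or.inl rfl)).spans_of_ncard_le hclsE hE hT.left (by omega),
    (h.forest 2 (Or.inr rfl)).spans_of_ncard_le hclsE hE hT.right (by omega), ?_,
    hlock 1 (Or.inl rfl), hlock 2 (Or.inr rfl)⟩
  rw [Set.disjoint_left]
  rintro e he he'
  have := he.2.symm.trans he'.2
  omega

/-- The measure that decreases with every augmentation. -/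
noncomputable def deficiency (G : Graph α β) (lock own : β → ℕ) : ℕ :=
  (G.cls own 0).ncard * (E(G).ncard + 1) + sInf {d | ∃ e c, G.Augments lock own d e c}

lemma Augments.of_finite {m : ℕ} (ha : G.Augments lock own d e c) (hE : E(G).Finite)
    (hm : E(G).ncard ≤ m) : G.Augments lock own m e c :=
  ⟨level_subset_level hE hm d ha.mem, ha.colour, ha.ne, ha.free⟩

/-- Without augmentations the infimum is that of the empty set, namely `0`, so the bound still
holds. -/
lemma sInf_augments_le (hE : E(G).Finite) :
    sInf {d | ∃ e c, G.Augments lock own d e c} ≤ E(G).ncard := by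
  by_cases h : ∃ d e c, G.Augments lock own d e c
  · obtain ⟨d, e, c, h⟩ := h
    exact Nat.sInf_le ⟨e, c, h.of_finite hE le_rfl⟩
  · push Not at h
    simp [h]

lemma deficiency_lt (hE : E(G).Finite) :
    G.deficiency lock own < (E(G).ncard + 1) * (E(G).ncard + 1) := by
  have h1 : (G.cls own 0).ncard ≤ E(G).ncard := Set.ncard_le_ncard (fun e he => he.1) hE
  have h2 := sInf_augments_le (lock := lock) (own := own) hE
  have h3 := Nat.mul_le_mul_right (E(G).ncard + 1) h1
  unfold deficiency
  linarith

open Classical in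
-- Either one more edge is coloured, which outweighs any growth of the second summand because this
-- is at most `E(G).ncard`, or the uncoloured edges do not increase and the least level drops.
lemma IsTwoForest.deficiency_update_lt (h : G.IsTwoForest lock own) (hE : E(G).Finite)
    (ha : G.Augments lock own d e c) (hmin : ∀ d' < d, ∀ e' c', ¬ G.Augments lock own d' e' c') :
    G.deficiency lock (Function.update own e c) < G.deficiency lock own := by
  have hd : sInf {d | ∃ e c, G.Augments lock own d e c} = d := by
    refine le_antisymm (Nat.sInf_le ⟨e, c, ha⟩) (le_of_not_gt fun hlt => ?_)
    obtain ⟨e', c', h'⟩ := Nat.sInf_mem (s := {d | ∃ e c, G.Augments lock own d e c}) ⟨d, e, c, ha⟩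
    exact hmin _ hlt e' c' h'
  have hfin : (G.cls own 0).Finite := hE.subset fun e he => he.1
  unfold deficiency
  rw [hd]
  rcases h.augment ha hmin with ⟨rfl, h1, h2⟩ | ⟨d', rfl, h1, e', c', h2⟩
  · have h3 := Set.ncard_sdiff_singleton_add_one h2 hfin
    have h4 := sInf_augments_le (lock := lock) (own := Function.update own e c) hE
    rw [← h1] at h3
    rw [← h3, add_mul]
    omega
  · have h3 := Nat.mul_le_mul_right (E(G).ncard + 1) (Set.ncard_le_ncard h1 hfin)
    have h4 : sInf {d | ∃ e' c', G.Augments lock (Function.update own e c) d e' c'} ≤ d' :=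
      Nat.sInf_le ⟨e', c', h2⟩
    omega

end Graph

namespace RAM

/-! ### Programs with bounded loops -/

namespace State

/-- The memory after an assignment to a register. -/
def setReg (s : State) (x v : ℕ) : State := { s with reg := Function.update s.reg x v }

/-- The memory after an assignment to an array cell. -/
def setArr (s : State) (a i v : ℕ) : State :=
  { s with arr := Function.update s.arr a (Function.update (s.arr a) i v) }

variable (s : State) (a b i j x y v : ℕ)

lemma setReg_reg : (s.setReg x v).reg y = if y = x then v else s.reg y :=
  Function.update_apply _ _ _ _

@[simp] lemma setReg_arr : (s.setReg x v).arr = s.arr := rfl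

@[simp] lemma setArr_reg : (s.setArr a i v).reg = s.reg := rfl

lemma setArr_arr : (s.setArr a i v).arr b = if b = a then Function.update (s.arr a) i v
    else s.arr b :=
  Function.update_apply _ _ _ _

@[simp] lemma setReg_reg_self : (s.setReg x v).reg x = v := Function.update_self _ _ _

@[simp] lemma setArr_arr_self : (s.setArr a i v).arr a = Function.update (s.arr a) i v :=
  Function.update_self _ _ _

lemma setReg_reg_of_ne (h : y ≠ x) : (s.setReg x v).reg y = s.reg y :=
  Function.update_of_ne h _ _

lemma setArr_arr_of_ne (h : b ≠ a) : (s.setArr a i v).arr b = s.arr b :=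
  Function.update_of_ne h _ _

end State

/-- The numbers of iterations of bounded loops on an input with `n` vertices and `m` edges. -/
inductive Bound where
  | verts
  | edges
  | total

namespace Bound

def expr : Bound → Expr
  | verts => .reg 0
  | edges => .reg 1
  | total => .add (.add (.reg 0) (.reg 1)) (.const 1)

def val (s : State) : Bound → ℕ
  | verts => s.reg 0
  | edges => s.reg 1
  | total => s.reg 0 + s.reg 1 + 1

lemma eval_expr (b : Bound) (s : State) : b.expr.eval s = b.val s := by
  cases b <;> rfl

lemma cost_expr_le (b : Bound) : b.expr.cost ≤ 5 := by
  cases b <;> simp [expr, Expr.cost]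

end Bound

/-- Programs whose only loops are `for x = 0, …, b - 1`. -/
inductive ForProg where
  | skip
  | assign (x : ℕ) (e : Expr)
  | store (a : ℕ) (i e : Expr)
  | seq (p q : ForProg)
  | ite (e : Expr) (p q : ForProg)
  | loop (x : ℕ) (b : Bound) (p : ForProg)

/-- The memory after `i` iterations of a loop with counter `x`. -/
def iterate (f : State → State) (x : ℕ) (s : State) : ℕ → State
  | 0 => s.setReg x 0
  | i + 1 => (f (iterate f x s i)).setReg x (i + 1)

namespace ForProg

/-- The loop test is the truncated difference of bound and counter, nonzero exactly while the
counter is smaller. -/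
def compile : ForProg → Prog
  | skip => .skip
  | assign x e => .assign x e
  | store a i e => .store a i e
  | seq p q => .seq p.compile q.compile
  | ite e p q => .ite e p.compile q.compile
  | loop x b p => .seq (.assign x (.const 0))
      (.loop (.sub b.expr (.reg x)) (.seq p.compile (.assign x (.add (.reg x) (.const 1)))))

/-- The memory after the execution of the program. -/
def run : ForProg → State → State
  | skip, s => s
  | assign x e, s => s.setReg x (e.eval s)
  | store a i e, s => s.setArr a (i.eval s) (e.eval s)
  | seq p q, s => q.run (p.run s)
  | ite e p q, s => if e.eval s ≠ 0 then p.run s else q.run s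
  | loop x b p, s => iterate p.run x s (b.val s)

/-- The program assigns to the register `y`. -/
def writesReg : ForProg → ℕ → Bool
  | skip, _ => false
  | assign x _, y => x == y
  | store _ _ _, _ => false
  | seq p q, y => p.writesReg y || q.writesReg y
  | ite _ p q, y => p.writesReg y || q.writesReg y
  | loop x _ p, y => x == y || p.writesReg y

/-- The program stores to the array `a`. -/
def writesArr : ForProg → ℕ → Bool
  | skip, _ => false
  | assign _ _, _ => false
  | store b _ _, a => b == a
  | seq p q, a => p.writesArr a || q.writesArr a
  | ite _ p q, a => p.writesArr a || q.writesArr a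
  | loop _ _ p, a => p.writesArr a

/-- The program does not assign to the registers `0`, `1`, and loop counters are not changed by
the body of the loop. -/
def valid : ForProg → Bool
  | skip => true
  | assign x _ => Nat.ble 2 x
  | store _ _ _ => true
  | seq p q => p.valid && q.valid
  | ite _ p q => p.valid && q.valid
  | loop x _ p => Nat.ble 2 x && !p.writesReg x && p.valid

/-- A bound on the number of steps in terms of the number of vertices and edges. -/
noncomputable def time : ForProg → Polynomial ℕ
  | skip => 1
  | assign _ e => .C (e.cost + 1)
  | store _ i e => .C (i.cost + e.cost + 1)
  | seq p q => p.time + q.time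
  | ite e p q => .C (e.cost + 1) + p.time + q.time
  | loop _ _ p => .C 10 + (.X + 1) * (.C 12 + p.time)

variable {p : ForProg} {s s' : State} {a x y : ℕ}

/-- Frame rule: `writesReg` is computable, so for concrete programs the hypothesis is closed by
`rfl`. -/
lemma run_reg_eq (h : p.writesReg y = false) : (p.run s).reg y = s.reg y := by
  induction p generalizing s with
  | skip => rfl
  | assign x e =>
    simp only [writesReg, beq_eq_false_iff_ne] at h
    exact State.setReg_reg_of_ne _ _ _ _ h.symm
  | store a i e => rfl
  | seq p q ihp ihq =>
    simp only [writesReg, Bool.or_eq_false_iff] at h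
    exact (ihq h.2).trans (ihp h.1)
  | ite e p q ihp ihq =>
    simp only [writesReg, Bool.or_eq_false_iff] at h
    simp only [run]
    split
    · exact ihp h.1
    · exact ihq h.2
  | loop x b p ih =>
    simp only [writesReg, Bool.or_eq_false_iff, beq_eq_false_iff_ne] at h
    simp only [run]
    induction b.val s with
    | zero => exact State.setReg_reg_of_ne _ _ _ _ h.1.symm
    | succ i ihi =>
      simp only [iterate]
      rw [State.setReg_reg_of_ne _ _ _ _ h.1.symm, ih h.2, ihi]

lemma run_arr_eq (h : p.writesArr a = false) : (p.run s).arr a = s.arr a := by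
  induction p generalizing s with
  | skip => rfl
  | assign x e => rfl
  | store b i e =>
    simp only [writesArr, beq_eq_false_iff_ne] at h
    exact State.setArr_arr_of_ne _ _ _ _ _ h.symm
  | seq p q ihp ihq =>
    simp only [writesArr, Bool.or_eq_false_iff] at h
    exact (ihq h.2).trans (ihp h.1)
  | ite e p q ihp ihq =>
    simp only [writesArr, Bool.or_eq_false_iff] at h
    simp only [run]
    split
    · exact ihp h.1
    · exact ihq h.2
  | loop x b p ih =>
    simp only [writesArr] at h
    simp only [run]
    induction b.val s with
    | zero => rfl
    | succ i ihi =>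
      simp only [iterate]
      rw [State.setReg_arr, ih h, ihi]

/-- The registers `0` and `1` hold the numbers that bound all loops, so loop bounds are constant
throughout the execution. -/
lemma valid.writesReg_eq (h : p.valid = true) (hy : y < 2) : p.writesReg y = false := by
  induction p with
  | skip => rfl
  | assign x e =>
    simp only [valid, Nat.ble_eq] at h
    simp only [writesReg, beq_eq_false_iff_ne]
    omega
  | store a i e => rfl
  | seq p q ihp ihq =>
    simp only [valid, Bool.and_eq_true] at h
    simp only [writesReg, ihp h.1, ihq h.2, Bool.or_self]
  | ite e p q ihp ihq =>
    simp only [valid, Bool.and_eq_true] at h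
    simp only [writesReg, ihp h.1, ihq h.2, Bool.or_self]
  | loop x b p ih =>
    simp only [valid, Bool.and_eq_true, Nat.ble_eq] at h
    simp only [writesReg, ih h.2, Bool.or_false, beq_eq_false_iff_ne]
    omega

/-- `s'` agrees with `s` on everything that a loop with counter `x` and body `p` leaves alone. -/
structure Agrees (p : ForProg) (x : ℕ) (s s' : State) : Prop where
  reg : ∀ y, y ≠ x → p.writesReg y = false → s'.reg y = s.reg y
  arr : ∀ a, p.writesArr a = false → s'.arr a = s.arr a

lemma iterate_agrees (i : ℕ) : p.Agrees x s (iterate p.run x s i) := by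
  induction i with
  | zero => exact ⟨fun y hy _ => State.setReg_reg_of_ne _ _ _ _ hy, fun _ _ => rfl⟩
  | succ i ih =>
    refine ⟨fun y hy hw => ?_, fun a ha => ?_⟩
    · simp only [iterate]
      rw [State.setReg_reg_of_ne _ _ _ _ hy, run_reg_eq hw, ih.reg y hy hw]
    · simp only [iterate]
      rw [State.setReg_arr, run_arr_eq ha, ih.arr a ha]

lemma iterate_reg (f : State → State) (i : ℕ) : (iterate f x s i).reg x = i := by
  cases i <;> simp [iterate]

/-- The invariant rule for loops. -/
lemma loop_induction {b : Bound} {N : ℕ} (hN : b.val s = N) (I : ℕ → State → Prop)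
    (h0 : I 0 (s.setReg x 0))
    (hs : ∀ i < N, ∀ s', s'.reg x = i → p.Agrees x s s' → I i s' →
      I (i + 1) ((p.run s').setReg x (i + 1))) : I N ((loop x b p).run s) := by
  subst hN
  have : ∀ i ≤ b.val s, I i (iterate p.run x s i) := by
    intro i
    induction i with
    | zero => intro _; exact h0
    | succ i ih =>
      intro hi
      exact hs i hi _ (iterate_reg _ _) (iterate_agrees i) (ih (by omega))
  exact this _ le_rfl

/-- A loop whose `i`-th iteration stores `f i` in the `i`-th cell of the array `a`. -/
lemma loop_fill {b : Bound} {N : ℕ} (hN : b.val s = N) (a : ℕ) (f : ℕ → ℕ)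
    (hs : ∀ i < N, ∀ s', s'.reg x = i → p.Agrees x s s' → (∀ j ≥ i, s'.arr a j = s.arr a j) →
      (p.run s').arr a = Function.update (s'.arr a) i (f i)) :
    ∀ i < N, ((loop x b p).run s).arr a i = f i := by
  have := loop_induction (p := p) (x := x) hN
    (fun i s' => (∀ j < i, s'.arr a j = f j) ∧ ∀ j ≥ i, s'.arr a j = s.arr a j)
    ⟨by intros; omega, fun j _ => rfl⟩ (by
      rintro i hi s' hx hA ⟨h1, h2⟩
      rw [State.setReg_arr, hs i hi s' hx hA h2]
      constructor
      · intro j hj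
        by_cases hji : j = i
        · subst hji; simp
        · rw [Function.update_of_ne hji]; exact h1 j (by omega)
      · intro j hj
        rw [Function.update_of_ne (by omega)]
        exact h2 j (by omega))
  exact this.1

/-- A program with bounded loops halts in polynomial time. -/
theorem runs_compile (hp : p.valid = true) {N : ℕ} (hN : s.reg 0 + s.reg 1 = N) :
    ∃ t ≤ p.time.eval N, Runs p.compile s t (p.run s) := by
  induction p generalizing s with
  | skip => exact ⟨1, by simp [time], .skip s⟩
  | assign x e => exact ⟨_, by simp [time], .assign x e s⟩
  | store a i e => exact ⟨_, by simp [time], .store a i e s⟩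
  | seq p q ihp ihq =>
    simp only [valid, Bool.and_eq_true] at hp
    obtain ⟨t, ht, h⟩ := ihp hp.1 hN
    obtain ⟨t', ht', h'⟩ := ihq hp.2 (s := p.run s) (by
      rw [run_reg_eq (valid.writesReg_eq hp.1 (by norm_num)),
        run_reg_eq (valid.writesReg_eq hp.1 (by norm_num)), hN])
    exact ⟨t + t', by simp only [time, Polynomial.eval_add]; omega, .seq h h'⟩
  | ite e p q ihp ihq =>
    simp only [valid, Bool.and_eq_true] at hp
    by_cases he : e.eval s ≠ 0
    · obtain ⟨t, ht, h⟩ := ihp hp.1 hN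
      have hrun : (ite e p q).run s = p.run s := if_pos he
      rw [hrun]
      exact ⟨_, by simp only [time, Polynomial.eval_add, Polynomial.eval_C]; omega,
        .ite_true he h⟩
    · obtain ⟨t, ht, h⟩ := ihq hp.2 hN
      have hrun : (ite e p q).run s = q.run s := if_neg he
      rw [hrun]
      exact ⟨_, by simp only [time, Polynomial.eval_add, Polynomial.eval_C]; omega,
        .ite_false (not_not.1 he) h⟩
  | loop x b p ih =>
    simp only [valid, Bool.and_eq_true, Nat.ble_eq, Bool.not_eq_true'] at hp
    obtain ⟨⟨hx, hpx⟩, hpv⟩ := hp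
    have hreg : ∀ i y, y < 2 → (iterate p.run x s i).reg y = s.reg y := fun i y hy =>
      (iterate_agrees i).reg y (by omega) (valid.writesReg_eq hpv hy)
    have hbound : ∀ i, b.expr.eval (iterate p.run x s i) = b.val s := by
      intro i
      rw [b.eval_expr]
      cases b <;> simp [Bound.val, hreg]
    have hcost : (Expr.sub b.expr (.reg x)).cost ≤ 7 := by
      have := b.cost_expr_le
      simp only [Expr.cost]
      omega
    -- Besides the body, an iteration costs at most `8` for the test and `4` for the increment; the
    -- last, failing test costs at most `8`.
    have key : ∀ j i, i + j = b.val s → ∃ t ≤ j * (12 + p.time.eval N) + 8,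
        Runs (.loop (.sub b.expr (.reg x)) (.seq p.compile (.assign x (.add (.reg x) (.const 1)))))
          (iterate p.run x s i) t (iterate p.run x s (b.val s)) := by
      intro j
      induction j with
      | zero =>
        intro i hi
        obtain rfl : i = b.val s := hi
        refine ⟨_, ?_, .loop_done ?_⟩
        · omega
        · simp only [Expr.eval, hbound, iterate_reg, Nat.sub_self]
      | succ j ihj =>
        intro i hi
        obtain ⟨t, ht, h⟩ := ih hpv (s := iterate p.run x s i) (by
          rw [hreg _ _ (by norm_num), hreg _ _ (by norm_num), hN])
        obtain ⟨t', ht', h'⟩ := ihj (i + 1) (by omega)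
        have hassign := Runs.assign x (.add (.reg x) (.const 1)) (p.run (iterate p.run x s i))
        have hval : (Expr.add (.reg x) (.const 1)).eval (p.run (iterate p.run x s i)) = i + 1 := by
          simp only [Expr.eval]
          rw [run_reg_eq hpx, iterate_reg]
        rw [hval] at hassign
        refine ⟨_, ?_, .loop_step ?_ (.seq h hassign) h'⟩
        · have h4 : (Expr.add (.reg x) (.const 1)).cost = 3 := rfl
          rw [h4, Nat.succ_mul]
          omega
        · simp only [Expr.eval, hbound, iterate_reg]
          omega
    obtain ⟨t, ht, h⟩ := key (b.val s) 0 (by omega)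
    refine ⟨_, ?_, .seq (.assign x (.const 0) s) h⟩
    have hb : b.val s ≤ N + 1 := by cases b <;> simp only [Bound.val] <;> omega
    have := Nat.mul_le_mul_right (12 + p.time.eval N) hb
    simp only [time, Polynomial.eval_add, Polynomial.eval_mul, Polynomial.eval_C,
      Polynomial.eval_X, Polynomial.eval_one, Expr.cost]
    omega

end ForProg

end RAM

/-! ### Balls in an edge set: a bound on the length of a search. -/

namespace Graph

variable {α β : Type*} {G : Graph α β} {F F' : Set β} {x y : α}

/-- The vertices at distance at most `d` from `x` in `F`. -/
def ball (G : Graph α β) (F : Set β) (x : α) : ℕ → Set α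
  | 0 => {x}
  | d + 1 => ball G F x d ∪ {b | ∃ a ∈ ball G F x d, ∃ e ∈ F, G.IsLink e a b}

lemma ball_mono : Monotone (G.ball F x) := monotone_nat_of_le_succ fun _ => Set.subset_union_left

lemma ball_subset (hx : x ∈ V(G)) (d : ℕ) : G.ball F x d ⊆ V(G) := by
  induction d with
  | zero => simpa [ball] using hx
  | succ d ih => exact Set.union_subset ih fun b ⟨a, _, e, _, hl⟩ => hl.right_mem

/-- The balls stabilise within as many steps as there are vertices, and the stable ball is closed
under the edges of `F`. -/
lemma Conn.mem_ball (h : G.Conn F x y) (hx : x ∈ V(G)) (hV : V(G).Finite) {n : ℕ}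
    (hn : V(G).ncard ≤ n) : y ∈ G.ball F x n := by
  have hst := Set.subset_of_stabilising (A := G.ball F x) hV ball_mono (ball_subset hx)
    (fun d h => by
      have hs : G.ball F x (d + 2) = G.ball F x (d + 1) ∪
        {b | ∃ a ∈ G.ball F x (d + 1), ∃ e ∈ F, G.IsLink e a b} := rfl
      rw [hs, ← h]
      exact h) hn
  refine h.mem_of_closed ?_ (hst 0 rfl)
  intro e he a b hl ha
  exact hst (n + 1) (Or.inr ⟨a, ha, e, he, hl⟩)

end Graph

/-! ### Graphs in memory, and searching them. -/

namespace RAM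

/-- The memory holds the graph `G`. -/
structure Encodes (G : Graph ℕ ℕ) (s : State) : Prop where
  verts : V(G) = {v | v < s.reg 0}
  edges : E(G) = {e | e < s.reg 1}
  link : ∀ e < s.reg 1, G.IsLink e (s.arr 0 e) (s.arr 1 e)

namespace Encodes

variable {G : Graph ℕ ℕ} {s s' : State} {p : ForProg} {e v x : ℕ}

lemma congr (h : Encodes G s) (h0 : s'.reg 0 = s.reg 0) (h1 : s'.reg 1 = s.reg 1)
    (h2 : s'.arr 0 = s.arr 0) (h3 : s'.arr 1 = s.arr 1) : Encodes G s' :=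
  ⟨by rw [h0]; exact h.verts, by rw [h1]; exact h.edges, by rw [h1, h2, h3]; exact h.link⟩

lemma run (h : Encodes G s) (hp : p.valid = true) (h0 : p.writesArr 0 = false)
    (h1 : p.writesArr 1 = false) : Encodes G (p.run s) :=
  h.congr (ForProg.run_reg_eq (ForProg.valid.writesReg_eq hp (by norm_num)))
    (ForProg.run_reg_eq (ForProg.valid.writesReg_eq hp (by norm_num)))
    (ForProg.run_arr_eq h0) (ForProg.run_arr_eq h1)

lemma of_agrees (h : Encodes G s) (hA : p.Agrees x s s') (hp : p.valid = true) (hx : 2 ≤ x)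
    (h0 : p.writesArr 0 = false) (h1 : p.writesArr 1 = false) : Encodes G s' :=
  h.congr (hA.reg _ (by omega) (ForProg.valid.writesReg_eq hp (by norm_num)))
    (hA.reg _ (by omega) (ForProg.valid.writesReg_eq hp (by norm_num))) (hA.arr _ h0) (hA.arr _ h1)

lemma setReg (h : Encodes G s) (hx : 2 ≤ x) : Encodes G (s.setReg x v) :=
  h.congr (State.setReg_reg_of_ne _ _ _ _ (by omega)) (State.setReg_reg_of_ne _ _ _ _ (by omega))
    rfl rfl

lemma mem_verts (h : Encodes G s) : v ∈ V(G) ↔ v < s.reg 0 := by rw [h.verts]; rfl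

lemma mem_edges (h : Encodes G s) : e ∈ E(G) ↔ e < s.reg 1 := by rw [h.edges]; rfl

lemma finite_verts (h : Encodes G s) : V(G).Finite := by
  rw [h.verts]; exact Set.finite_lt_nat _

lemma finite_edges (h : Encodes G s) : E(G).Finite := by
  rw [h.edges]; exact Set.finite_lt_nat _

lemma ncard_verts (h : Encodes G s) : V(G).ncard = s.reg 0 := by
  have : {v | v < s.reg 0} = ↑(Finset.range (s.reg 0)) := by ext; simp
  rw [h.verts, this, Set.ncard_coe_finset, Finset.card_range]

lemma ncard_edges (h : Encodes G s) : E(G).ncard = s.reg 1 := by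
  have : {v | v < s.reg 1} = ↑(Finset.range (s.reg 1)) := by ext; simp
  rw [h.edges, this, Set.ncard_coe_finset, Finset.card_range]

end Encodes

/-- A test for inequality. -/
def Expr.neq (a b : Expr) : Expr := .add (.sub a b) (.sub b a)

lemma Expr.eval_neq_ne_zero {a b : Expr} {s : State} :
    (Expr.neq a b).eval s ≠ 0 ↔ a.eval s ≠ b.eval s := by
  simp only [neq, eval]
  omega

namespace ForProg

variable {G : Graph ℕ ℕ} {s s' : State} {p q : ForProg} {e v x : ℕ}

lemma run_ite {c : Expr} : (ite c p q).run s = if c.eval s ≠ 0 then p.run s else q.run s := rfl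

lemma run_seq : (seq p q).run s = q.run (p.run s) := rfl

/-! ### Reachability

The search starts in the vertex held by the register `4`, uses the edges that are marked in the array
`9`, and marks the vertices that it reaches in the array `8`. -/

/-- Mark the ends of the edge held by the register `6` if one of them is marked. -/
def relax : ForProg :=
  .ite (.get 9 (.reg 6))
    (.seq
      (.ite (.get 8 (.get 0 (.reg 6))) (.store 8 (.get 1 (.reg 6)) (.const 1)) .skip)
      (.ite (.get 8 (.get 1 (.reg 6))) (.store 8 (.get 0 (.reg 6)) (.const 1)) .skip))
    .skip

def search : ForProg :=
  .seq (.loop 7 .verts (.store 8 (.reg 7) (.const 0)))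
    (.seq (.store 8 (.reg 4) (.const 1)) (.loop 5 .verts (.loop 6 .edges relax)))

lemma relax_spec (v : ℕ) :
    ((relax.run s).arr 8 v ≠ 0 ↔ s.arr 8 v ≠ 0 ∨ s.arr 9 (s.reg 6) ≠ 0 ∧
      (v = s.arr 1 (s.reg 6) ∧ s.arr 8 (s.arr 0 (s.reg 6)) ≠ 0 ∨
        v = s.arr 0 (s.reg 6) ∧ s.arr 8 (s.arr 1 (s.reg 6)) ≠ 0)) ∧
    (s.arr 8 v ≤ 1 → (relax.run s).arr 8 v ≤ 1) := by
  simp only [relax, run, Expr.eval]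
  by_cases h9 : s.arr 9 (s.reg 6) = 0
  · simp [h9]
  by_cases ht : s.arr 8 (s.arr 0 (s.reg 6)) = 0 <;>
    by_cases hh : s.arr 8 (s.arr 1 (s.reg 6)) = 0 <;>
    by_cases hv : v = s.arr 1 (s.reg 6) <;> by_cases hv' : v = s.arr 0 (s.reg 6) <;>
    simp_all [State.setArr_arr]

/-- The marked edges. -/
def marked (G : Graph ℕ ℕ) (s : State) : Set ℕ := {e | e ∈ E(G) ∧ s.arr 9 e ≠ 0}

/-- The invariant is that marks are sound and, after `j` rounds, cover the ball of radius `j`. The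
bound by `1` allows membership of two vertices to be compared by comparing their marks. -/
lemma search_spec (hG : Encodes G s) (h4 : s.reg 4 ∈ V(G)) :
    ∀ v ∈ V(G), ((search.run s).arr 8 v ≠ 0 ↔ G.Conn (marked G s) (s.reg 4) v) ∧
      (search.run s).arr 8 v ≤ 1 := by
  obtain ⟨s₁, hs₁⟩ : ∃ s₁, s₁ = (loop 7 .verts (.store 8 (.reg 7) (.const 0))).run s := ⟨_, rfl⟩
  have hclear : ∀ i < s.reg 0, s₁.arr 8 i = 0 := by
    rw [hs₁]
    refine loop_fill (b := .verts) (s := s) rfl 8 (fun _ => 0) fun i _ s' hx _ _ => ?_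
    simp [run, Expr.eval, hx]
  obtain ⟨s₂, hs₂⟩ : ∃ s₂, s₂ = s₁.setArr 8 (s₁.reg 4) 1 := ⟨_, rfl⟩
  have hrun : search.run s = (loop 5 .verts (.loop 6 .edges relax)).run s₂ := by
    rw [hs₂, hs₁]; rfl
  have hr : ∀ y, y ≠ 7 → s₂.reg y = s.reg y := by
    intro y hy
    rw [hs₂, State.setArr_reg, hs₁]
    exact run_reg_eq (by simpa [writesReg] using hy.symm)
  have ha : ∀ a, a ≠ 8 → s₂.arr a = s.arr a := by
    intro a ha
    rw [hs₂, State.setArr_arr_of_ne _ _ _ _ _ ha, hs₁]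
    exact run_arr_eq (by simpa [writesArr] using ha.symm)
  have h41 : s₁.reg 4 = s.reg 4 := by rw [hs₁]; exact run_reg_eq rfl
  have h8 : ∀ v < s.reg 0, s₂.arr 8 v = if v = s.reg 4 then 1 else 0 := by
    intro v hv
    rw [hs₂, State.setArr_arr_self, Function.update_apply, h41, hclear v hv]
  have hG₂ : Encodes G s₂ := hG.congr (hr 0 (by norm_num)) (hr 1 (by norm_num)) (ha 0 (by norm_num))
    (ha 1 (by norm_num))
  have hM : ∀ {s'}, s'.arr 9 = s.arr 9 → marked G s' = marked G s := by
    intro s' h; simp only [marked, h]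
  let F := marked G s
  let J : ℕ → State → Prop := fun j s' => ∀ v ∈ V(G),
    (s'.arr 8 v ≠ 0 → G.Conn F (s.reg 4) v) ∧ (v ∈ G.ball F (s.reg 4) j → s'.arr 8 v ≠ 0) ∧
      s'.arr 8 v ≤ 1
  have hJ : J (s.reg 0) ((loop 5 .verts (.loop 6 .edges relax)).run s₂) := by
    refine loop_induction (b := .verts) (s := s₂) (hr 0 (by norm_num)) J ?_ ?_
    · intro v hv
      rw [State.setReg_arr, h8 v (hG.mem_verts.1 hv)]
      by_cases hv4 : v = s.reg 4
      · subst hv4; simp [Graph.Conn.refl]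
      · simp [hv4, Graph.ball]
    · intro j hj s₃ _ hA hJ
      have hG₃ : Encodes G s₃ := hG₂.of_agrees hA rfl (by norm_num) rfl rfl
      have h93 : s₃.arr 9 = s.arr 9 := (hA.arr 9 rfl).trans (ha 9 (by norm_num))
      -- Within one round marks may spread further than one step, so the invariant only bounds the
      -- marked set from below by the ball.
      have hI := loop_induction (x := 6) (p := relax) (b := .edges) (s := s₃) rfl (fun i s' =>
        (∀ v ∈ V(G), (s'.arr 8 v ≠ 0 → G.Conn F (s.reg 4) v) ∧
          (v ∈ G.ball F (s.reg 4) j → s'.arr 8 v ≠ 0) ∧ s'.arr 8 v ≤ 1) ∧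
        ∀ e < i, e ∈ F → ∀ a b, G.IsLink e a b → a ∈ G.ball F (s.reg 4) j → s'.arr 8 b ≠ 0)
        ⟨hJ, by intros; omega⟩ (by
          rintro i hi s' h6 hA' ⟨h1, h2⟩
          have h9 : s'.arr 9 = s.arr 9 := (hA'.arr 9 rfl).trans h93
          have hl := hG₃.link i hi
          have e0 : s'.arr 0 = s₃.arr 0 := hA'.arr 0 rfl
          have e1 : s'.arr 1 = s₃.arr 1 := hA'.arr 1 rfl
          rw [← e0, ← e1] at hl
          have hiE : i ∈ E(G) := hG₃.mem_edges.2 hi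
          have hiF : i ∈ F ↔ s'.arr 9 i ≠ 0 := by
            simp only [F, marked, Set.mem_ofPred_eq, h9, hiE, true_and]
          have hrel := fun v => relax_spec (s := s') v
          simp only [h6] at hrel
          rw [State.setReg_arr]
          refine ⟨fun v hv => ⟨fun hm => ?_, fun hm => ?_, (hrel v).2 (h1 v hv).2.2⟩,
            fun e he heF a b hab ha => ?_⟩
          · rcases (hrel v).1.1 hm with hm | ⟨h9i, ⟨rfl, hm'⟩ | ⟨rfl, hm'⟩⟩
            · exact (h1 v hv).1 hm
            · exact ((h1 _ hl.left_mem).1 hm').trans (hl.conn (hiF.2 h9i))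
            · exact ((h1 _ hl.right_mem).1 hm').trans (hl.symm.conn (hiF.2 h9i))
          · exact (hrel v).1.2 (Or.inl ((h1 v hv).2.1 hm))
          · rcases Nat.lt_succ_iff_lt_or_eq.1 he with he | rfl
            · exact (hrel b).1.2 (Or.inl (h2 e he heF a b hab ha))
            · refine (hrel b).1.2 (Or.inr ⟨hiF.1 heF, ?_⟩)
              rcases hab.eq_and_eq_or_eq_and_eq hl with ⟨rfl, rfl⟩ | ⟨rfl, rfl⟩
              · exact Or.inl ⟨rfl, (h1 _ hl.left_mem).2.1 ha⟩
              · exact Or.inr ⟨rfl, (h1 _ hl.right_mem).2.1 ha⟩)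
      obtain ⟨h1, h2⟩ := hI
      intro v hv
      refine ⟨(h1 v hv).1, ?_, (h1 v hv).2.2⟩
      rintro (hb | ⟨a, hab, e, he, hl⟩)
      · exact (h1 v hv).2.1 hb
      · exact h2 e (hG₃.mem_edges.1 hl.edge_mem) he a v hl hab
  rw [hrun]
  intro v hv
  refine ⟨⟨(hJ v hv).1, fun hc => (hJ v hv).2.1 ?_⟩, (hJ v hv).2.2⟩
  exact hc.mem_ball h4 hG.finite_verts hG.ncard_verts.le

/-! ### Testing whether an edge is spanned -/

/-- Test whether the ends of the edge held by the register `9` are connected by edges whose entry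
in the array `10` is the colour held by the register `10`, without the edge held by the
register `11`. -/
def connTest : ForProg :=
  .seq (.loop 8 .edges
      (.ite (.neq (.get 10 (.reg 8)) (.reg 10)) (.store 9 (.reg 8) (.const 0))
        (.ite (.neq (.reg 8) (.reg 11)) (.store 9 (.reg 8) (.const 1))
          (.store 9 (.reg 8) (.const 0)))))
    (.seq (.assign 4 (.get 0 (.reg 9)))
      (.seq search (.assign 12 (.get 8 (.get 1 (.reg 9))))))

lemma connTest_spec (hG : Encodes G s) (h9 : s.reg 9 ∈ E(G)) :
    (connTest.run s).reg 12 ≠ 0 ↔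
      G.Spans (G.cls (s.arr 10) (s.reg 10) \ {s.reg 11}) (s.reg 9) := by
  obtain ⟨s₁, hs₁⟩ : ∃ s₁, s₁ = (loop 8 .edges
      (.ite (.neq (.get 10 (.reg 8)) (.reg 10)) (.store 9 (.reg 8) (.const 0))
        (.ite (.neq (.reg 8) (.reg 11)) (.store 9 (.reg 8) (.const 1))
          (.store 9 (.reg 8) (.const 0))))).run s := ⟨_, rfl⟩
  have hfill : ∀ i < s.reg 1, s₁.arr 9 i =
      if s.arr 10 i = s.reg 10 ∧ i ≠ s.reg 11 then 1 else 0 := by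
    rw [hs₁]
    refine loop_fill (b := .edges) (s := s) rfl 9
      (fun i => if s.arr 10 i = s.reg 10 ∧ i ≠ s.reg 11 then 1 else 0) ?_
    intro i _ s' hx hA _
    have a10 : s'.arr 10 = s.arr 10 := hA.arr 10 rfl
    have r10 : s'.reg 10 = s.reg 10 := hA.reg 10 (by norm_num) rfl
    have r11 : s'.reg 11 = s.reg 11 := hA.reg 11 (by norm_num) rfl
    simp only [run_ite, Expr.eval_neq_ne_zero]
    simp only [run, Expr.eval, hx, a10, r10, r11]
    by_cases h1 : s.arr 10 i = s.reg 10 <;> by_cases h2 : i = s.reg 11 <;> simp [h1, h2]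
  have hr : ∀ y, y ≠ 8 → s₁.reg y = s.reg y := by
    intro y hy
    rw [hs₁]
    exact run_reg_eq (by simpa [writesReg] using hy.symm)
  have ha : ∀ a, a ≠ 9 → s₁.arr a = s.arr a := by
    intro a ha
    rw [hs₁]
    exact run_arr_eq (by simpa [writesArr] using ha.symm)
  obtain ⟨s₂, hs₂⟩ : ∃ s₂, s₂ = s₁.setReg 4 (s₁.arr 0 (s₁.reg 9)) := ⟨_, rfl⟩
  have hG₁ : Encodes G s₁ := hG.congr (hr 0 (by norm_num)) (hr 1 (by norm_num)) (ha 0 (by norm_num))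
    (ha 1 (by norm_num))
  have hG₂ : Encodes G s₂ := by rw [hs₂]; exact hG₁.setReg (by norm_num)
  have hl := hG.link _ (hG.mem_edges.1 h9)
  have h4 : s₂.reg 4 = s.arr 0 (s.reg 9) := by
    rw [hs₂, State.setReg_reg_self, ha 0 (by norm_num), hr 9 (by norm_num)]
  have hrun : (connTest.run s).reg 12 = (search.run s₂).arr 8 (s.arr 1 (s.reg 9)) := by
    have e1 : (search.run s₂).arr 1 = s.arr 1 := by
      rw [run_arr_eq (p := search) rfl, hs₂, State.setReg_arr, ha 1 (by norm_num)]
    have e9 : (search.run s₂).reg 9 = s.reg 9 := by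
      rw [run_reg_eq (p := search) rfl, hs₂, State.setReg_reg_of_ne _ _ _ _ (by norm_num),
        hr 9 (by norm_num)]
    have : (connTest.run s) = (search.run s₂).setReg 12
        ((search.run s₂).arr 8 ((search.run s₂).arr 1 ((search.run s₂).reg 9))) := by
      rw [hs₂, hs₁]; rfl
    rw [this, State.setReg_reg_self, e1, e9]
  have hmark : marked G s₂ = G.cls (s.arr 10) (s.reg 10) \ {s.reg 11} := by
    ext i
    have : s₂.arr 9 = s₁.arr 9 := by rw [hs₂]; rfl
    simp only [marked, Graph.cls, Set.mem_ofPred_eq, Set.mem_sdiff, Set.mem_singleton_iff, this,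
      and_assoc]
    refine and_congr_right fun hi => ?_
    rw [hfill i (hG.mem_edges.1 hi)]
    by_cases hc : s.arr 10 i = s.reg 10 ∧ i ≠ s.reg 11 <;> simp [hc]
  rw [hrun, (search_spec hG₂ (by rw [h4]; exact hl.left_mem) _ hl.right_mem).1, hl.spans_iff, h4,
    hmark]

end ForProg

end RAM

namespace RAM

namespace ForProg

variable {G : Graph ℕ ℕ} {s s' : State} {p q : ForProg} {e v x : ℕ} {lock own : ℕ → ℕ} {c d : ℕ}

/-! ### Augmentation

The array `10` holds the colours of the edges, the array `11` the locked colours, and the array `12`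
marks the edges of the current level. The register `15` is set when an edge has been recoloured. -/

/-- Test whether the edge held by the register `13` is spanned by the colour `c` without `f`. -/
def spanTest (c f : Expr) : ForProg :=
  .seq (.assign 9 (.reg 13)) (.seq (.assign 10 c) (.seq (.assign 11 f) connTest))

/-- The arguments are passed in registers that are overwritten one after the other; `hc` and `hf`
say that `c` and `f` do not depend on those already written. -/
lemma spanTest_spec {c f : Expr} (hG : Encodes G s) (h13 : s.reg 13 ∈ E(G))
    (hc : ∀ v, c.eval (s.setReg 9 v) = c.eval s)
    (hf : ∀ v w, f.eval ((s.setReg 9 v).setReg 10 w) = f.eval s) :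
    ((spanTest c f).run s).reg 12 ≠ 0 ↔
      G.Spans (G.cls (s.arr 10) (c.eval s) \ {f.eval s}) (s.reg 13) := by
  have hrun : (spanTest c f).run s = connTest.run
      (((s.setReg 9 (s.reg 13)).setReg 10 (c.eval s)).setReg 11 (f.eval s)) := by
    simp only [spanTest, run_seq, run, Expr.eval, hc, hf]
  rw [hrun, connTest_spec (G := G)]
  · simp [State.setReg_reg]
  · exact ((hG.setReg (by norm_num)).setReg (by norm_num)).setReg (by norm_num)
  · simpa [State.setReg_reg] using h13

/-- Give the colour `c` to the edge held by the register `13` if it is free in this colour. -/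
def recolour (c : ℕ) : ForProg :=
  .ite (.reg 15) .skip
    (.ite (.neq (.get 10 (.reg 13)) (.const c))
      (.seq (spanTest (.const c) (.reg 1))
        (.ite (.reg 12) .skip (.seq (.store 10 (.reg 13) (.const c)) (.assign 15 (.const 1)))))
      .skip)

lemma recolour_spec (hG : Encodes G s) (h13 : s.reg 13 ∈ E(G)) (h15 : s.reg 15 = 0) :
    (((recolour c).run s).reg 15 = 0 ∧ ((recolour c).run s).arr 10 = s.arr 10 ∧
      ¬ (s.arr 10 (s.reg 13) ≠ c ∧ ¬ G.Spans (G.cls (s.arr 10) c) (s.reg 13))) ∨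
    (((recolour c).run s).reg 15 ≠ 0 ∧
      (s.arr 10 (s.reg 13) ≠ c ∧ ¬ G.Spans (G.cls (s.arr 10) c) (s.reg 13)) ∧
      ((recolour c).run s).arr 10 = Function.update (s.arr 10) (s.reg 13) c) := by
  have hspec := spanTest_spec (c := .const c) (f := .reg 1) hG h13 (fun _ => rfl) (fun _ _ => rfl)
  -- The number `m` in register `1` names no edge, so with this argument nothing is removed from the
  -- colour class.
  have hm : G.cls (s.arr 10) c \ {s.reg 1} = G.cls (s.arr 10) c :=
    Set.sdiff_singleton_eq_self fun h => lt_irrefl _ (hG.mem_edges.1 h.1)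
  simp only [Expr.eval, hm] at hspec
  have ha : ((spanTest (.const c) (.reg 1)).run s).arr 10 = s.arr 10 := run_arr_eq rfl
  have r13 : ((spanTest (.const c) (.reg 1)).run s).reg 13 = s.reg 13 := run_reg_eq rfl
  have r15 : ((spanTest (.const c) (.reg 1)).run s).reg 15 = s.reg 15 := run_reg_eq rfl
  by_cases hne : s.arr 10 (s.reg 13) = c
  · left
    have : (recolour c).run s = s := by
      have : ¬ (Expr.neq (.get 10 (.reg 13)) (.const c)).eval s ≠ 0 := by
        rw [Expr.eval_neq_ne_zero]; simpa [Expr.eval] using hne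
      rw [recolour, run_ite, if_neg (by simpa [Expr.eval] using h15), run_ite, if_neg this]
      rfl
    rw [this]
    exact ⟨h15, rfl, fun h => h.1 hne⟩
  have hne' : (Expr.neq (.get 10 (.reg 13)) (.const c)).eval s ≠ 0 := by
    rw [Expr.eval_neq_ne_zero]; simpa [Expr.eval] using hne
  have hrun : (recolour c).run s = (ite (.reg 12) .skip
      (.seq (.store 10 (.reg 13) (.const c)) (.assign 15 (.const 1)))).run
        ((spanTest (.const c) (.reg 1)).run s) := by
    rw [recolour, run_ite, if_neg (by simpa [Expr.eval] using h15), run_ite, if_pos hne']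
    rfl
  rw [hrun, run_ite]
  by_cases hsp : G.Spans (G.cls (s.arr 10) c) (s.reg 13)
  · left
    rw [if_pos (by simpa [Expr.eval] using hspec.2 hsp)]
    exact ⟨r15.trans h15, ha, fun h => h.2 hsp⟩
  · right
    rw [if_neg (by simpa [Expr.eval] using fun h => hsp (hspec.1 h))]
    refine ⟨by simp [run, Expr.eval], ⟨hne, hsp⟩, ?_⟩
    simp [run, Expr.eval, ha, r13]

lemma recolour_of_done (h15 : s.reg 15 ≠ 0) : (recolour c).run s = s := by
  rw [recolour, run_ite, if_pos (by simpa [Expr.eval] using h15)]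
  rfl

/-- Recolour one free edge of the current level. -/
def scan : ForProg :=
  .loop 13 .edges (.ite (.get 12 (.reg 13)) (.seq (recolour 1) (recolour 2)) .skip)

/-- Until the first success the colouring is unchanged, and afterwards register `15` makes the
remaining iterations idle, so every test refers to the initial colouring. -/
lemma scan_spec (hG : Encodes G s) (h15 : s.reg 15 = 0)
    (hlev : ∀ e ∈ E(G), s.arr 12 e ≠ 0 ↔ e ∈ G.level lock (s.arr 10) d) :
    ((scan.run s).reg 15 = 0 ∧ (scan.run s).arr 10 = s.arr 10 ∧
      ∀ e c, ¬ G.Augments lock (s.arr 10) d e c) ∨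
    ((scan.run s).reg 15 ≠ 0 ∧ ∃ e c, G.Augments lock (s.arr 10) d e c ∧
      (scan.run s).arr 10 = Function.update (s.arr 10) e c) := by
  have h := loop_induction (x := 13) (b := .edges) (s := s)
    (p := .ite (.get 12 (.reg 13)) (.seq (recolour 1) (recolour 2)) .skip) rfl (fun i s' =>
      (s'.reg 15 = 0 ∧ s'.arr 10 = s.arr 10 ∧
        ∀ e < i, ∀ c, ¬ G.Augments lock (s.arr 10) d e c) ∨
      (s'.reg 15 ≠ 0 ∧ ∃ e c, G.Augments lock (s.arr 10) d e c ∧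
        s'.arr 10 = Function.update (s.arr 10) e c))
    (Or.inl ⟨by rw [State.setReg_reg_of_ne _ _ _ _ (by norm_num)]; exact h15, rfl,
      by intros; omega⟩) (by
      rintro i hi s' h13 hA h
      rw [State.setReg_reg_of_ne _ _ _ _ (by norm_num), State.setReg_arr]
      have a12 : s'.arr 12 = s.arr 12 := hA.arr 12 rfl
      have hG' : Encodes G s' := hG.of_agrees hA rfl (by norm_num) rfl rfl
      have hiE : i ∈ E(G) := hG.mem_edges.2 hi
      rw [run_ite]
      have hcond : (Expr.get 12 (.reg 13)).eval s' = s.arr 12 i := by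
        simp only [Expr.eval, h13, a12]
      rw [hcond]
      rcases h with ⟨h15, h10, hno⟩ | ⟨h15, h10⟩
      · by_cases hi12 : s.arr 12 i ≠ 0
        · rw [if_pos hi12, run_seq]
          have hil := (hlev i hiE).1 hi12
          have haug : ∀ c, (c = 1 ∨ c = 2) → (s.arr 10 i ≠ c ∧ ¬ G.Spans (G.cls (s.arr 10) c) i) →
              G.Augments lock (s.arr 10) d i c := fun c hc h => ⟨hil, hc, h.1, h.2⟩
          rcases recolour_spec (c := 1) hG' (by rwa [h13]) h15 with ⟨b1, b2, b3⟩ | ⟨b1, b2, b3⟩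
          · have hG'' : Encodes G ((recolour 1).run s') := hG'.run rfl rfl rfl
            have r13 : ((recolour 1).run s').reg 13 = i := (run_reg_eq rfl).trans h13
            rcases recolour_spec (c := 2) hG'' (by rwa [r13]) b1 with ⟨d1, d2, d3⟩ | ⟨d1, d2, d3⟩
            · left
              refine ⟨d1, d2.trans (b2.trans h10), fun e he c ha => ?_⟩
              rcases Nat.lt_succ_iff_lt_or_eq.1 he with he | rfl
              · exact hno e he c ha
              · rw [h13, h10] at b3
                rw [r13, b2, h10] at d3
                rcases ha.colour with rfl | rfl
                · exact b3 ⟨ha.ne, ha.free⟩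
                · exact d3 ⟨ha.ne, ha.free⟩
            · right
              rw [r13, b2, h10] at d2 d3
              exact ⟨d1, i, 2, haug 2 (Or.inr rfl) d2, d3⟩
          · right
            rw [recolour_of_done b1]
            rw [h13, h10] at b2 b3
            exact ⟨b1, i, 1, haug 1 (Or.inl rfl) b2, b3⟩
        · rw [if_neg hi12]
          left
          refine ⟨h15, h10, fun e he c ha => ?_⟩
          rcases Nat.lt_succ_iff_lt_or_eq.1 he with he | rfl
          · exact hno e he c ha
          · exact hi12 ((hlev e hiE).2 ha.mem)
      · right
        have : (if s.arr 12 i ≠ 0 then ((recolour 1).seq (recolour 2)).run s' else skip.run s') =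
            s' := by
          split
          · rw [run_seq, recolour_of_done h15, recolour_of_done h15]
          · rfl
        rw [this]
        exact ⟨h15, h10⟩)
  refine h.imp (fun h => ⟨h.1, h.2.1, fun e c ha => ?_⟩) id
  exact h.2.2 e (hG.mem_edges.1 (Graph.level_subset _ ha.mem)) c ha

/-- Mark the edge held by the register `14` if the one held by the register `13` leads to it. -/
def spreadEdge : ForProg :=
  .ite (.get 12 (.reg 13))
    (.ite (.neq (.get 10 (.reg 13)) (.get 10 (.reg 14)))
      (.seq (spanTest (.get 10 (.reg 14)) (.reg 14))
        (.ite (.reg 12) .skip (.store 13 (.reg 14) (.const 1)))) .skip) .skip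

lemma spreadEdge_spec (hG : Encodes G s) (h13 : s.reg 13 ∈ E(G)) :
    ((spreadEdge.run s).arr 13 (s.reg 14) ≠ 0 ↔ s.arr 13 (s.reg 14) ≠ 0 ∨
      (s.arr 12 (s.reg 13) ≠ 0 ∧ s.arr 10 (s.reg 13) ≠ s.arr 10 (s.reg 14) ∧
        ¬ G.Spans (G.cls (s.arr 10) (s.arr 10 (s.reg 14)) \ {s.reg 14}) (s.reg 13))) ∧
      ∀ f ≠ s.reg 14, (spreadEdge.run s).arr 13 f = s.arr 13 f := by
  have hspec := spanTest_spec (c := .get 10 (.reg 14)) (f := .reg 14) hG h13 (fun _ => rfl)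
    (fun _ _ => rfl)
  simp only [Expr.eval] at hspec
  have ha : ((spanTest (.get 10 (.reg 14)) (.reg 14)).run s).arr 13 = s.arr 13 := run_arr_eq rfl
  have r14 : ((spanTest (.get 10 (.reg 14)) (.reg 14)).run s).reg 14 = s.reg 14 := run_reg_eq rfl
  rw [spreadEdge, run_ite]
  by_cases h1 : s.arr 12 (s.reg 13) = 0
  · rw [if_neg (by simpa [Expr.eval] using h1)]
    simp [run, h1]
  rw [if_pos (by simpa [Expr.eval] using h1), run_ite]
  by_cases h2 : s.arr 10 (s.reg 13) = s.arr 10 (s.reg 14)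
  · rw [if_neg (by rw [Expr.eval_neq_ne_zero]; simpa [Expr.eval] using h2)]
    simp [run, h2]
  rw [if_pos (by rw [Expr.eval_neq_ne_zero]; simpa [Expr.eval] using h2), run_seq, run_ite]
  by_cases h3 : G.Spans (G.cls (s.arr 10) (s.arr 10 (s.reg 14)) \ {s.reg 14}) (s.reg 13)
  · rw [if_pos (by simpa [Expr.eval] using hspec.2 h3)]
    simp [run, ha, h3]
  · rw [if_neg (by simpa [Expr.eval] using fun h => h3 (hspec.1 h))]
    simp only [run, Expr.eval, r14, State.setArr_arr_self, ha]
    refine ⟨by simp [h1, h2, h3], fun f hf => by rw [Function.update_of_ne hf]⟩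

/-- Pass from the current level to the next one. -/
def spread : ForProg :=
  .seq
    (.loop 14 .edges (.seq (.store 13 (.reg 14) (.get 12 (.reg 14)))
      (.ite (.get 10 (.reg 14)) (.ite (.get 11 (.reg 14)) .skip (.loop 13 .edges spreadEdge))
        .skip)))
    (.loop 14 .edges (.store 12 (.reg 14) (.get 13 (.reg 14))))

/-- The new level is built in array `13` while array `12` keeps the old one, so an edge marked in
this round does not already serve as a source. -/
lemma spread_spec (hG : Encodes G s)
    (hlev : ∀ e ∈ E(G), s.arr 12 e ≠ 0 ↔ e ∈ G.level (s.arr 11) (s.arr 10) d) :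
    ∀ e ∈ E(G), (spread.run s).arr 12 e ≠ 0 ↔ e ∈ G.level (s.arr 11) (s.arr 10) (d + 1) := by
  obtain ⟨s₁, hs₁⟩ : ∃ s₁, s₁ = (loop 14 .edges (.seq (.store 13 (.reg 14) (.get 12 (.reg 14)))
      (.ite (.get 10 (.reg 14)) (.ite (.get 11 (.reg 14)) .skip (.loop 13 .edges spreadEdge))
        .skip))).run s := ⟨_, rfl⟩
  have h1 : ∀ e < s.reg 1, s₁.arr 13 e ≠ 0 ↔ e ∈ G.level (s.arr 11) (s.arr 10) (d + 1) := by
    rw [hs₁]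
    refine loop_induction (b := .edges) (s := s) rfl (fun i s' => ∀ e < i, s'.arr 13 e ≠ 0 ↔
      e ∈ G.level (s.arr 11) (s.arr 10) (d + 1)) (by intros; omega) ?_
    intro i hi s' h14 hA hI
    have a10 : s'.arr 10 = s.arr 10 := hA.arr 10 rfl
    have a11 : s'.arr 11 = s.arr 11 := hA.arr 11 rfl
    have a12 : s'.arr 12 = s.arr 12 := hA.arr 12 rfl
    have hG' : Encodes G s' := hG.of_agrees hA rfl (by norm_num) rfl rfl
    have hiE : i ∈ E(G) := hG.mem_edges.2 hi
    obtain ⟨s₂, hs₂⟩ : ∃ s₂, s₂ = s'.setArr 13 i (s.arr 12 i) := ⟨_, rfl⟩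
    have hrun : (seq (.store 13 (.reg 14) (.get 12 (.reg 14)))
        (.ite (.get 10 (.reg 14)) (.ite (.get 11 (.reg 14)) .skip (.loop 13 .edges spreadEdge))
        .skip)).run s' = (if s.arr 10 i ≠ 0 then (if s.arr 11 i ≠ 0 then s₂ else
          (loop 13 .edges spreadEdge).run s₂) else s₂) := by
      have hst : (store 13 (.reg 14) (.get 12 (.reg 14))).run s' = s₂ := by
        rw [hs₂]; simp only [run, Expr.eval, h14, a12]
      have e1 : (Expr.get 10 (.reg 14)).eval s₂ = s.arr 10 i := by
        rw [hs₂]; simp only [Expr.eval, State.setArr_reg, h14]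
        rw [State.setArr_arr_of_ne _ _ _ _ _ (by norm_num), a10]
      have e2 : (Expr.get 11 (.reg 14)).eval s₂ = s.arr 11 i := by
        rw [hs₂]; simp only [Expr.eval, State.setArr_reg, h14]
        rw [State.setArr_arr_of_ne _ _ _ _ _ (by norm_num), a11]
      rw [run_seq, hst, run_ite, e1, run_ite, e2]
      rfl
    rw [hrun, State.setReg_arr]
    have h13 : s₂.arr 13 = Function.update (s'.arr 13) i (s.arr 12 i) := by
      rw [hs₂, State.setArr_arr_self]
    have hold : ∀ s₃ : State, (∀ f ≠ i, s₃.arr 13 f = s₂.arr 13 f) →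
        (s₃.arr 13 i ≠ 0 ↔ i ∈ G.level (s.arr 11) (s.arr 10) (d + 1)) →
        ∀ e < i + 1, s₃.arr 13 e ≠ 0 ↔ e ∈ G.level (s.arr 11) (s.arr 10) (d + 1) := by
      intro s₃ hf hi' e he
      rcases Nat.lt_succ_iff_lt_or_eq.1 he with he | rfl
      · rw [hf e (by omega), h13, Function.update_of_ne (by omega)]
        exact hI e he
      · exact hi'
    have hlevel : i ∈ G.level (s.arr 11) (s.arr 10) (d + 1) ↔ s.arr 12 i ≠ 0 ∨
        (s.arr 10 i ≠ 0 ∧ s.arr 11 i = 0 ∧ ∃ e ∈ E(G), s.arr 12 e ≠ 0 ∧ s.arr 10 e ≠ s.arr 10 i ∧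
          ¬ G.Spans (G.cls (s.arr 10) (s.arr 10 i) \ {i}) e) := by
      rw [hlev i hiE]
      constructor
      · rintro (h | ⟨-, h0, hl, e, he, h⟩)
        · exact Or.inl h
        · have heE := Graph.level_subset _ he
          exact Or.inr ⟨h0, hl, e, heE, (hlev e heE).2 he, h⟩
      · rintro (h | ⟨h0, hl, e, heE, he, h⟩)
        · exact Or.inl h
        · exact Or.inr ⟨hiE, h0, hl, e, (hlev e heE).1 he, h⟩
    by_cases h10 : s.arr 10 i = 0
    · rw [if_neg (by simpa using h10)]
      refine hold s₂ (fun _ _ => rfl) ?_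
      rw [hlevel, h13, Function.update_self]
      simp [h10]
    rw [if_pos h10]
    by_cases h11 : s.arr 11 i = 0
    swap
    · rw [if_pos h11]
      refine hold s₂ (fun _ _ => rfl) ?_
      rw [hlevel, h13, Function.update_self]
      simp [h11]
    rw [if_neg (by simpa using h11)]
    have b10 : s₂.arr 10 = s.arr 10 := by
      rw [hs₂, State.setArr_arr_of_ne _ _ _ _ _ (by norm_num), a10]
    have b12 : s₂.arr 12 = s.arr 12 := by
      rw [hs₂, State.setArr_arr_of_ne _ _ _ _ _ (by norm_num), a12]
    have hG₂ : Encodes G s₂ := by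
      rw [hs₂]
      exact hG'.congr rfl rfl (State.setArr_arr_of_ne _ _ _ _ _ (by norm_num))
        (State.setArr_arr_of_ne _ _ _ _ _ (by norm_num))
    have r14 : s₂.reg 14 = i := by rw [hs₂]; exact h14
    have r1 : s₂.reg 1 = s.reg 1 := by
      rw [hs₂, State.setArr_reg]; exact hA.reg 1 (by norm_num) rfl
    have hin := loop_induction (x := 13) (b := .edges) (s := s₂) (p := spreadEdge) r1 (fun j t =>
      (t.arr 13 i ≠ 0 ↔ s.arr 12 i ≠ 0 ∨ ∃ e < j, s.arr 12 e ≠ 0 ∧ s.arr 10 e ≠ s.arr 10 i ∧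
          ¬ G.Spans (G.cls (s.arr 10) (s.arr 10 i) \ {i}) e) ∧
        ∀ f ≠ i, t.arr 13 f = s₂.arr 13 f)
      ⟨by rw [State.setReg_arr, h13, Function.update_self]; simp, fun _ _ => rfl⟩ (by
        rintro j hj t t13 hA' ⟨i1, i2⟩
        have hGt : Encodes G t := hG₂.of_agrees hA' rfl (by norm_num) rfl rfl
        have t14 : t.reg 14 = i := (hA'.reg 14 (by norm_num) rfl).trans r14
        have t10 : t.arr 10 = s.arr 10 := (hA'.arr 10 rfl).trans b10
        have t12 : t.arr 12 = s.arr 12 := (hA'.arr 12 rfl).trans b12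
        have hsp := spreadEdge_spec hGt (by rw [t13]; exact hG.mem_edges.2 hj)
        rw [t13, t14, t10, t12] at hsp
        rw [State.setReg_arr]
        refine ⟨?_, fun f hf => (hsp.2 f hf).trans (i2 f hf)⟩
        rw [hsp.1, i1, or_assoc]
        refine or_congr_right ⟨?_, ?_⟩
        · rintro (⟨e, he, h⟩ | h)
          · exact ⟨e, by omega, h⟩
          · exact ⟨j, by omega, h⟩
        · rintro ⟨e, he, h⟩
          rcases Nat.lt_succ_iff_lt_or_eq.1 he with he | rfl
          · exact Or.inl ⟨e, he, h⟩
          · exact Or.inr h)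
    refine hold _ hin.2 (hin.1.trans ?_)
    rw [hlevel]
    refine or_congr_right ⟨?_, ?_⟩
    · rintro ⟨e, he, h⟩
      exact ⟨h10, h11, e, hG.mem_edges.2 he, h⟩
    · rintro ⟨-, -, e, he, h⟩
      exact ⟨e, hG.mem_edges.1 he, h⟩
  have r1 : s₁.reg 1 = s.reg 1 := by rw [hs₁]; exact run_reg_eq rfl
  have h2 : ∀ e < s.reg 1, (spread.run s).arr 12 e = s₁.arr 13 e := by
    have hrun : spread.run s = (loop 14 .edges (.store 12 (.reg 14) (.get 13 (.reg 14)))).run s₁ := by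
      rw [hs₁]; rfl
    rw [hrun]
    refine loop_fill (b := .edges) (s := s₁) r1 12 (fun e => s₁.arr 13 e) fun i _ s' hx hA _ => ?_
    have a13 : s'.arr 13 = s₁.arr 13 := hA.arr 13 rfl
    simp [run, Expr.eval, hx, a13]
  intro e he
  rw [h2 e (hG.mem_edges.1 he)]
  exact h1 e (hG.mem_edges.1 he)

/-- One augmentation step. -/
def augment : ForProg :=
  .seq (.assign 15 (.const 0))
    (.seq (.loop 13 .edges (.store 12 (.reg 13) (.sub (.const 1) (.get 10 (.reg 13)))))
      (.loop 16 .total (.ite (.reg 15) .skip (.seq scan (.ite (.reg 15) .skip spread)))))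

/-- Levels are scanned in increasing order, so the recoloured edge has least possible level, as the
decrease of the measure requires. -/
lemma augment_spec (hG : Encodes G s) :
    ((augment.run s).arr 10 = s.arr 10 ∧ ∀ d e c, ¬ G.Augments (s.arr 11) (s.arr 10) d e c) ∨
    ∃ d e c, G.Augments (s.arr 11) (s.arr 10) d e c ∧
      (∀ d' < d, ∀ e' c', ¬ G.Augments (s.arr 11) (s.arr 10) d' e' c') ∧
      (augment.run s).arr 10 = Function.update (s.arr 10) e c := by
  obtain ⟨s₁, hs₁⟩ : ∃ s₁, s₁ = (loop 13 .edges
    (.store 12 (.reg 13) (.sub (.const 1) (.get 10 (.reg 13))))).run (s.setReg 15 0) := ⟨_, rfl⟩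
  have hrun : augment.run s = (loop 16 .total
      (.ite (.reg 15) .skip (.seq scan (.ite (.reg 15) .skip spread)))).run s₁ := by
    rw [hs₁]; rfl
  have hr : ∀ y, y ≠ 13 → s₁.reg y = (s.setReg 15 0).reg y := by
    intro y hy
    rw [hs₁]
    exact run_reg_eq (by simpa [writesReg] using hy.symm)
  have ha : ∀ a, a ≠ 12 → s₁.arr a = s.arr a := by
    intro a ha
    rw [hs₁]
    exact run_arr_eq (by simpa [writesArr] using ha.symm)
  have h12 : ∀ e < s.reg 1, s₁.arr 12 e = 1 - s.arr 10 e := by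
    rw [hs₁]
    refine loop_fill (b := .edges) (s := s.setReg 15 0) rfl 12 (fun e => 1 - s.arr 10 e)
      fun i _ s' hx hA _ => ?_
    have a10 : s'.arr 10 = s.arr 10 := hA.arr 10 rfl
    simp [run, Expr.eval, hx, a10]
  have hG₁ : Encodes G s₁ := hG.congr (hr 0 (by norm_num)) (hr 1 (by norm_num)) (ha 0 (by norm_num))
    (ha 1 (by norm_num))
  have h15 : s₁.reg 15 = 0 := by rw [hr 15 (by norm_num), State.setReg_reg_self]
  have a10 : s₁.arr 10 = s.arr 10 := ha 10 (by norm_num)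
  have a11 : s₁.arr 11 = s.arr 11 := ha 11 (by norm_num)
  rw [← a10, ← a11, hrun]
  have hI := loop_induction (x := 16) (b := .total) (s := s₁)
    (p := .ite (.reg 15) .skip (.seq scan (.ite (.reg 15) .skip spread))) rfl (fun j t =>
      (t.reg 15 = 0 ∧ t.arr 10 = s₁.arr 10 ∧
        (∀ e ∈ E(G), t.arr 12 e ≠ 0 ↔ e ∈ G.level (s₁.arr 11) (s₁.arr 10) j) ∧
        ∀ d < j, ∀ e c, ¬ G.Augments (s₁.arr 11) (s₁.arr 10) d e c) ∨
      (t.reg 15 ≠ 0 ∧ ∃ d e c, G.Augments (s₁.arr 11) (s₁.arr 10) d e c ∧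
        (∀ d' < d, ∀ e' c', ¬ G.Augments (s₁.arr 11) (s₁.arr 10) d' e' c') ∧
        t.arr 10 = Function.update (s₁.arr 10) e c))
    (Or.inl ⟨by rw [State.setReg_reg_of_ne _ _ _ _ (by norm_num)]; exact h15, rfl, fun e he => by
      rw [State.setReg_arr, h12 e (hG.mem_edges.1 he), a10]
      simp only [Graph.level, Graph.cls, Set.mem_ofPred_eq, he, true_and]
      omega, by intros; omega⟩) (by
      rintro j hj t - hA hI
      have hGt : Encodes G t := hG₁.of_agrees hA rfl (by norm_num) rfl rfl
      have t11 : t.arr 11 = s₁.arr 11 := hA.arr 11 rfl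
      rw [State.setReg_reg_of_ne _ _ _ _ (by norm_num), State.setReg_arr, run_ite]
      rcases hI with ⟨h15, h10, hlev, hno⟩ | ⟨h15, h⟩
      · rw [if_neg (by simpa [Expr.eval] using h15), run_seq, run_ite]
        rw [← t11, ← h10] at hlev hno ⊢
        have hGs : Encodes G (scan.run t) := hGt.run rfl rfl rfl
        rcases scan_spec hGt h15 hlev with ⟨b1, b2, b3⟩ | ⟨b1, e, c, b2, b3⟩
        · left
          rw [if_neg (by simpa [Expr.eval] using b1)]
          have s11 : (scan.run t).arr 11 = t.arr 11 := run_arr_eq rfl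
          have s12 : (scan.run t).arr 12 = t.arr 12 := run_arr_eq rfl
          have hsp := spread_spec (d := j) hGs (by rw [s11, s12, b2]; exact hlev)
          rw [s11, b2] at hsp
          refine ⟨(run_reg_eq rfl).trans b1, (run_arr_eq rfl).trans b2, hsp, fun d hd e c hau => ?_⟩
          rcases Nat.lt_succ_iff_lt_or_eq.1 hd with hd | rfl
          · exact hno d hd e c hau
          · exact b3 e c hau
        · right
          rw [if_pos (by simpa [Expr.eval] using b1)]
          exact ⟨b1, j, e, c, b2, hno, b3⟩
      · right
        rw [if_pos (by simpa [Expr.eval] using h15)]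
        exact ⟨h15, h⟩)
  rcases hI with ⟨-, h10, -, hno⟩ | ⟨-, h⟩
  · refine Or.inl ⟨h10, fun d e c hau => ?_⟩
    -- Level `m` contains all levels, and it has been scanned because `total` exceeds `m`.
    have := hau.of_finite hG₁.finite_edges (m := s₁.reg 1) hG₁.ncard_edges.le
    refine hno (s₁.reg 1) ?_ e c this
    simp only [Bound.val]
    omega
  · exact Or.inr h

end ForProg

end RAM

namespace Graph

variable {α β : Type*} {G : Graph α β} {lock : β → ℕ} {r : α} {k c : ℕ} {e : β}

/-! ### Growing the certificates -/

/-- The edges of the colours `1` and `2` form a completable pair of partial certificates. -/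
structure IsGood (G : Graph α β) (r : α) (k : ℕ) (lock : β → ℕ) : Prop where
  le_two : ∀ e ∈ E(G), lock e ≤ 2
  cert : ∀ c, c = 1 ∨ c = 2 → G.IsPartialCertificate r k (G.largeVerts r k) (G.cls lock c)
  completable : G.Completable (G.cls lock 1) (G.cls lock 2)

/-- The number of vertices besides the root in the certificate of colour `c`. -/
noncomputable def size (G : Graph α β) (r : α) (lock : β → ℕ) (c : ℕ) : ℕ :=
  (G.reach (G.cls lock c) r \ {r}).ncard

open Classical in
/-- The edge `e` may be added to the certificate of colour `c`. -/
structure Extends (G : Graph α β) (r : α) (k : ℕ) (lock : β → ℕ) (c : ℕ) (e : β) : Prop where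
  unlocked : lock e = 0
  size_lt : G.size r lock c < 2 * k - 2
  link : ∃ v w, G.IsLink e v w ∧ v ∈ G.reach (G.cls lock c) r ∧ w ∉ G.reach (G.cls lock c) r ∧
    (G.branch (G.cls (Function.update lock e c) c) r w).ncard ≤ k - 1
  completable : G.Completable (G.cls (Function.update lock e c) 1)
    (G.cls (Function.update lock e c) 2)

open Classical in
lemma cls_update_eq {c' : ℕ} (hc : c' ≠ c) (hc' : c' ≠ 0) (h0 : lock e = 0) :
    G.cls (Function.update lock e c) c' = G.cls lock c' := by
  rw [cls_update_of_ne hc, Set.sdiff_singleton_eq_self]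
  intro h
  exact hc' (h.2.symm.trans h0)

open Classical in
lemma IsGood.update (h : G.IsGood r k lock) (hV : V(G).Finite) (hr : r ∈ V(G))
    (hc : c = 1 ∨ c = 2) (he : G.Extends r k lock c e) :
    G.IsGood r k (Function.update lock e c) ∧
      G.size r (Function.update lock e c) c = G.size r lock c + 1 ∧
      ∀ c', c' = 1 ∨ c' = 2 → c' ≠ c →
        G.size r (Function.update lock e c) c' = G.size r lock c' := by
  obtain ⟨v, w, hl, hv, hw, hb⟩ := he.link
  rw [cls_update_self hl.edge_mem] at hb
  obtain ⟨h1, h2⟩ := (h.cert c hc).insert_edge hV hr hl hv hw he.size_lt hb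
  rw [← cls_update_self hl.edge_mem] at h1 h2
  refine ⟨⟨fun f hf => ?_, fun c' hc' => ?_, he.completable⟩, h2, fun c' hc' hne => ?_⟩
  · by_cases hfe : f = e
    · subst hfe
      rw [Function.update_self]
      omega
    · rw [Function.update_of_ne hfe]
      exact h.le_two f hf
  · by_cases hcc : c' = c
    · subst hcc
      exact h1
    · rw [cls_update_eq hcc (by omega) he.unlocked]
      exact h.cert c' hc'
  · unfold size
    rw [cls_update_eq hne (by omega) he.unlocked]

lemma IsGood.exists_extends (h : G.IsGood r k lock) (hV : V(G).Finite) (hE : E(G).Finite)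
    (hr : r ∈ V(G)) (hc : c = 1 ∨ c = 2) (hlt : G.size r lock c < 2 * k - 2) :
    ∃ e ∈ E(G), G.Extends r k lock c e := by
  classical
  have key : ∀ c c', (c = 1 ∨ c = 2) → (c' = 1 ∨ c' = 2) → c' ≠ c → G.size r lock c < 2 * k - 2 →
      G.Completable (G.cls lock c) (G.cls lock c') → ∃ e v w, G.IsLink e v w ∧ lock e = 0 ∧
        v ∈ G.reach (G.cls lock c) r ∧ w ∉ G.reach (G.cls lock c) r ∧
        (G.branch (G.cls (Function.update lock e c) c) r w).ncard ≤ k - 1 ∧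
        G.Completable (G.cls (Function.update lock e c) c)
          (G.cls (Function.update lock e c) c') := by
    intro c c' hc hc' hne hlt hcompl
    obtain ⟨e, v, w, hl, he, hv, hw, hb, hco⟩ :=
      (h.cert c hc).exists_insert (h.cert c' hc') hV hE hr hcompl hlt
    -- The edge lies in neither certificate: one of its ends is outside the tree of colour `c`, and
    -- `exists_insert` keeps it out of the other colour.
    have h0 : lock e = 0 := by
      have h1 := (h.cert c hc).tree.notMem_of_isLink hw hl
      have h2 := h.le_two e hl.edge_mem
      by_contra h0
      have : lock e = c ∨ lock e = c' := by omega
      rcases this with h' | h'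
      · exact h1 ⟨hl.edge_mem, h'⟩
      · exact he ⟨hl.edge_mem, h'⟩
    refine ⟨e, v, w, hl, h0, hv, hw, ?_, ?_⟩
    · rwa [cls_update_self hl.edge_mem]
    · rwa [cls_update_self hl.edge_mem, cls_update_eq hne (by omega) h0]
  rcases hc with rfl | rfl
  · obtain ⟨e, v, w, hl, h0, hv, hw, hb, hco⟩ :=
      key 1 2 (Or.inl rfl) (Or.inr rfl) (by norm_num) hlt h.completable
    exact ⟨e, hl.edge_mem, h0, hlt, ⟨v, w, hl, hv, hw, hb⟩, hco⟩
  · obtain ⟨e, v, w, hl, h0, hv, hw, hb, hco⟩ :=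
      key 2 1 (Or.inr rfl) (Or.inl rfl) (by norm_num) hlt h.completable.symm
    exact ⟨e, hl.edge_mem, h0, hlt, ⟨v, w, hl, hv, hw, hb⟩, hco.symm⟩

lemma isTwoForest_of_eqOn {own : β → ℕ} (h2 : ∀ e ∈ E(G), lock e ≤ 2)
    (hf : ∀ c, c = 1 ∨ c = 2 → G.Forest (G.cls lock c)) (h : ∀ e ∈ E(G), own e = lock e) :
    G.IsTwoForest lock own := by
  refine ⟨fun e he => (h e he).le.trans (h2 e he), fun c hc => ?_, fun e he _ => h e he⟩
  have : G.cls own c = G.cls lock c := by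
    ext e
    exact and_congr_right fun he => by rw [h e he]
  rw [this]
  exact hf c hc

lemma IsTwoForest.completes_of_reach {own : β → ℕ} (h : G.IsTwoForest lock own)
    (hreach : ∀ c, c = 1 ∨ c = 2 → ∀ v ∈ V(G), v ∈ G.reach (G.cls own c) r) :
    G.Completes (G.cls lock 1) (G.cls lock 2) (G.cls own 1) (G.cls own 2) := by
  have hst : ∀ c, c = 1 ∨ c = 2 → G.SpanTree (G.cls own c) := fun c hc =>
    ⟨fun e he => he.1, h.forest c hc, fun x hx y hy =>
      (Conn.symm (hreach c hc x hx)).trans (hreach c hc y hy)⟩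
  have hlock : ∀ c, c = 1 ∨ c = 2 → G.cls lock c ⊆ G.cls own c := by
    rintro c hc e ⟨he, rfl⟩
    exact ⟨he, h.locked e he (by omega)⟩
  refine ⟨hst 1 (Or.inl rfl), hst 2 (Or.inr rfl), ?_, hlock 1 (Or.inl rfl), hlock 2 (Or.inr rfl)⟩
  rw [Set.disjoint_left]
  rintro e he he'
  have := he.2.symm.trans he'.2
  omega

end Graph

namespace RAM

namespace ForProg

variable {G : Graph ℕ ℕ} {s s' : State} {p q : ForProg} {e v x : ℕ} {lock own : ℕ → ℕ} {c d : ℕ}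

/-! ### Completing a pair of trees -/

/-- Search from the root along the edges of colour `c` in the array `a`. -/
def colourSearch (a c : ℕ) : ForProg :=
  .seq (.loop 8 .edges (.ite (.neq (.get a (.reg 8)) (.const c))
      (.store 9 (.reg 8) (.const 0)) (.store 9 (.reg 8) (.const 1))))
    (.seq (.assign 4 (.reg 2)) search)

lemma colourSearch_spec {a : ℕ} (ha9 : a ≠ 9) (hG : Encodes G s) (hr : s.reg 2 ∈ V(G)) :
    ∀ v ∈ V(G), (((colourSearch a c).run s).arr 8 v ≠ 0 ↔
      v ∈ G.reach (G.cls (s.arr a) c) (s.reg 2)) ∧ ((colourSearch a c).run s).arr 8 v ≤ 1 := by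
  obtain ⟨s₁, hs₁⟩ : ∃ s₁, s₁ = (loop 8 .edges (.ite (.neq (.get a (.reg 8)) (.const c))
      (.store 9 (.reg 8) (.const 0)) (.store 9 (.reg 8) (.const 1)))).run s := ⟨_, rfl⟩
  have hfill : ∀ i < s.reg 1, s₁.arr 9 i = if s.arr a i = c then 1 else 0 := by
    rw [hs₁]
    refine loop_fill (b := .edges) (s := s) rfl 9 (fun i => if s.arr a i = c then 1 else 0) ?_
    intro i _ s' hx hA _
    have aa : s'.arr a = s.arr a := hA.arr a (by simpa [writesArr] using ha9.symm)
    simp only [run_ite, Expr.eval_neq_ne_zero]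
    simp only [run, Expr.eval, hx, aa]
    by_cases h1 : s.arr a i = c <;> simp [h1]
  have hr₁ : ∀ y, y ≠ 8 → s₁.reg y = s.reg y := by
    intro y hy
    rw [hs₁]
    exact run_reg_eq (by simpa [writesReg] using hy.symm)
  have ha : ∀ a, a ≠ 9 → s₁.arr a = s.arr a := by
    intro a ha
    rw [hs₁]
    exact run_arr_eq (by simpa [writesArr] using ha.symm)
  have hG₁ : Encodes G s₁ := hG.congr (hr₁ 0 (by norm_num)) (hr₁ 1 (by norm_num))
    (ha 0 (by norm_num)) (ha 1 (by norm_num))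
  have hrun : (colourSearch a c).run s = search.run (s₁.setReg 4 (s₁.reg 2)) := by
    rw [hs₁]; rfl
  have h2 : (s₁.setReg 4 (s₁.reg 2)).reg 4 = s.reg 2 := by
    rw [State.setReg_reg_self, hr₁ 2 (by norm_num)]
  have hmark : marked G (s₁.setReg 4 (s₁.reg 2)) = G.cls (s.arr a) c := by
    ext i
    simp only [marked, Graph.cls, Set.mem_ofPred_eq, State.setReg_arr]
    refine and_congr_right fun hi => ?_
    rw [hfill i (hG.mem_edges.1 hi)]
    by_cases hc : s.arr a i = c <;> simp [hc]
  have hspec := search_spec (hG₁.setReg (x := 4) (v := s₁.reg 2) (by norm_num)) (by rwa [h2])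
  rw [h2, hmark, ← hrun] at hspec
  exact hspec

/-- Clear the register `19` if the colour `c` does not connect all vertices. -/
def checkColour (c : ℕ) : ForProg :=
  .seq (colourSearch 10 c) (.loop 13 .verts (.ite (.get 8 (.reg 13)) .skip (.assign 19 (.const 0))))

lemma checkColour_spec (hG : Encodes G s) (hr : s.reg 2 ∈ V(G)) :
    ((checkColour c).run s).reg 19 ≠ 0 ↔
      s.reg 19 ≠ 0 ∧ ∀ v ∈ V(G), v ∈ G.reach (G.cls (s.arr 10) c) (s.reg 2) := by
  have hspec := colourSearch_spec (c := c) (a := 10) (by norm_num) hG hr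
  have r19 : ((colourSearch 10 c).run s).reg 19 = s.reg 19 := run_reg_eq rfl
  have r0 : ((colourSearch 10 c).run s).reg 0 = s.reg 0 := run_reg_eq rfl
  have h := loop_induction (x := 13) (b := .verts) (s := (colourSearch 10 c).run s)
    (p := .ite (.get 8 (.reg 13)) .skip (.assign 19 (.const 0))) r0 (fun i t =>
      t.reg 19 ≠ 0 ↔ s.reg 19 ≠ 0 ∧ ∀ v < i, ((colourSearch 10 c).run s).arr 8 v ≠ 0)
    (by rw [State.setReg_reg_of_ne _ _ _ _ (by norm_num), r19]; simp) (by
      intro i hi t t13 hA hI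
      have a8 : t.arr 8 = ((colourSearch 10 c).run s).arr 8 := hA.arr 8 rfl
      rw [State.setReg_reg_of_ne _ _ _ _ (by norm_num), run_ite]
      have hcond : (Expr.get 8 (.reg 13)).eval t = ((colourSearch 10 c).run s).arr 8 i := by
        simp only [Expr.eval, t13, a8]
      rw [hcond]
      by_cases h8 : ((colourSearch 10 c).run s).arr 8 i = 0
      · rw [if_neg (by simpa using h8)]
        have : ((assign 19 (.const 0)).run t).reg 19 = 0 := by simp [run, Expr.eval]
        rw [this]
        simp only [ne_eq, not_true_eq_false, false_iff, not_and, not_forall]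
        exact fun _ => ⟨i, by omega, by simpa using h8⟩
      · rw [if_pos h8]
        refine hI.trans (and_congr_right fun _ => ⟨fun h v hv => ?_, fun h v hv => h v (by omega)⟩)
        rcases Nat.lt_succ_iff_lt_or_eq.1 hv with hv | rfl
        · exact h v hv
        · exact h8)
  refine h.trans (and_congr_right fun _ => ?_)
  constructor
  · exact fun h v hv => (hspec v hv).1.1 (h v (hG.mem_verts.1 hv))
  · exact fun h v hv => (hspec v (hG.mem_verts.2 hv)).1.2 (h v (hG.mem_verts.2 hv))

/-- Extend the colouring in the array `11` to two spanning trees in the array `10`, and set the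
register `19` if this is possible. -/
def complete : ForProg :=
  .seq (.loop 13 .edges (.store 10 (.reg 13) (.get 11 (.reg 13))))
    (.seq (.loop 17 .total (.loop 18 .total augment))
      (.seq (.assign 19 (.const 1)) (.seq (checkColour 1) (checkColour 2))))

/-- The measure starts below `(m + 1)²` and drops with each augmentation, so the `(n + m + 1)²`
rounds exhaust it. -/
lemma augment_loop_spec (hG : Encodes G s) (h : G.IsTwoForest (s.arr 11) (s.arr 10)) :
    G.IsTwoForest (s.arr 11) (((loop 17 .total (loop 18 .total augment)).run s).arr 10) ∧
      ∀ d e c, ¬ G.Augments (s.arr 11)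
        (((loop 17 .total (loop 18 .total augment)).run s).arr 10) d e c := by
  classical
  let M := (E(G).ncard + 1) * (E(G).ncard + 1)
  let N := s.reg 0 + s.reg 1 + 1
  let P : ℕ → State → Prop := fun j t => G.IsTwoForest (s.arr 11) (t.arr 10) ∧
    ((∀ d e c, ¬ G.Augments (s.arr 11) (t.arr 10) d e c) ∨
      G.deficiency (s.arr 11) (t.arr 10) + j < M)
  have hstep : ∀ j t, Encodes G t → t.arr 11 = s.arr 11 → P j t → P (j + 1) (augment.run t) := by
    rintro j t hGt h11 ⟨hF, hP⟩
    have hspec := augment_spec hGt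
    rw [h11] at hspec
    rcases hspec with ⟨h10, hno⟩ | ⟨d, e, c, hau, hmin, h10⟩
    · refine ⟨by rwa [h10], Or.inl (by rwa [h10])⟩
    · refine ⟨?_, Or.inr ?_⟩
      · rw [h10]
        convert hF.update hau
      · have h1 := hF.deficiency_update_lt hGt.finite_edges hau hmin
        have h2 := hP.resolve_left fun hno => hno d e c hau
        have h3 : G.deficiency (s.arr 11) ((augment.run t).arr 10) <
            G.deficiency (s.arr 11) (t.arr 10) := by
          rw [h10]
          convert h1
        omega
  have hout : P (N * N) ((loop 17 .total (loop 18 .total augment)).run s) := by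
    refine loop_induction (x := 17) (b := .total) (s := s) (N := N) rfl (fun i t => P (i * N) t)
      ⟨h, Or.inr ?_⟩ ?_
    · rw [Nat.zero_mul]
      exact Graph.deficiency_lt hG.finite_edges
    · intro i _ t _ hA hP
      have hGt : Encodes G t := hG.of_agrees hA rfl (by norm_num) rfl rfl
      have t11 : t.arr 11 = s.arr 11 := hA.arr 11 rfl
      have hb : Bound.total.val t = N := by
        have h0 : t.reg 0 = s.reg 0 := hA.reg 0 (by norm_num) rfl
        have h1 : t.reg 1 = s.reg 1 := hA.reg 1 (by norm_num) rfl
        simp only [Bound.val, h0, h1, N]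
      have hin := loop_induction (x := 18) (b := .total) (s := t) (p := augment) hb
        (fun j t' => P (i * N + j) t') hP (by
          intro j _ t' _ hA' hP'
          exact hstep _ t' (hGt.of_agrees hA' rfl (by norm_num) rfl rfl)
            ((hA'.arr 11 rfl).trans t11) hP')
      rw [Nat.succ_mul]
      exact hin
  refine ⟨hout.1, hout.2.resolve_right fun hlt => ?_⟩
  have : M ≤ N * N := by
    have : E(G).ncard + 1 ≤ N := by rw [hG.ncard_edges]; simp only [N]; omega
    exact Nat.mul_le_mul this this
  omega

/-- Completion doubles as a decision procedure: when no augmentation is left, both forests span if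
the locked pair is completable, and if they span they witness this themselves. -/
lemma complete_spec (hG : Encodes G s) (hr : s.reg 2 ∈ V(G)) (h2 : ∀ e ∈ E(G), s.arr 11 e ≤ 2)
    (hf : ∀ c, c = 1 ∨ c = 2 → G.Forest (G.cls (s.arr 11) c)) :
    ((complete.run s).reg 19 ≠ 0 ↔ G.Completable (G.cls (s.arr 11) 1) (G.cls (s.arr 11) 2)) ∧
    ((complete.run s).reg 19 ≠ 0 → G.Completes (G.cls (s.arr 11) 1) (G.cls (s.arr 11) 2)
      (G.cls ((complete.run s).arr 10) 1) (G.cls ((complete.run s).arr 10) 2)) := by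
  obtain ⟨s₁, hs₁⟩ : ∃ s₁, s₁ = (loop 13 .edges
    (.store 10 (.reg 13) (.get 11 (.reg 13)))).run s := ⟨_, rfl⟩
  have hcopy : ∀ i < s.reg 1, s₁.arr 10 i = s.arr 11 i := by
    rw [hs₁]
    refine loop_fill (b := .edges) (s := s) rfl 10 (s.arr 11) fun i _ s' hx hA _ => ?_
    have a11 : s'.arr 11 = s.arr 11 := hA.arr 11 rfl
    simp [run, Expr.eval, hx, a11]
  have a11 : s₁.arr 11 = s.arr 11 := by rw [hs₁]; exact run_arr_eq rfl
  have hG₁ : Encodes G s₁ := by rw [hs₁]; exact hG.run rfl rfl rfl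
  have hF := Graph.isTwoForest_of_eqOn h2 hf fun e he => hcopy e (hG.mem_edges.1 he)
  rw [← a11] at hF
  obtain ⟨s₂, hs₂⟩ : ∃ s₂, s₂ = (loop 17 .total (loop 18 .total augment)).run s₁ := ⟨_, rfl⟩
  have hG₂ : Encodes G s₂ := by rw [hs₂]; exact hG₁.run rfl rfl rfl
  have hloop := augment_loop_spec hG₁ hF
  rw [← hs₂, a11] at hloop
  obtain ⟨hF₂, hno⟩ := hloop
  have hr₂ : s₂.reg 2 = s.reg 2 := by
    have h1 : s₂.reg 2 = s₁.reg 2 := by rw [hs₂]; exact run_reg_eq rfl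
    have h2 : s₁.reg 2 = s.reg 2 := by rw [hs₁]; exact run_reg_eq rfl
    exact h1.trans h2
  have hrun : complete.run s = (checkColour 2).run ((checkColour 1).run (s₂.setReg 19 1)) := by
    rw [hs₂, hs₁]; rfl
  have h10 : (complete.run s).arr 10 = s₂.arr 10 := by
    rw [hrun]
    exact (run_arr_eq rfl).trans (run_arr_eq rfl)
  have hG₃ : Encodes G (s₂.setReg 19 1) := hG₂.setReg (by norm_num)
  have hG₄ : Encodes G ((checkColour 1).run (s₂.setReg 19 1)) := hG₃.run rfl rfl rfl
  have r3 : (s₂.setReg 19 1).reg 2 = s.reg 2 :=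
    (State.setReg_reg_of_ne _ _ _ _ (by norm_num)).trans hr₂
  have r4 : ((checkColour 1).run (s₂.setReg 19 1)).reg 2 = s.reg 2 := (run_reg_eq rfl).trans r3
  have a4 : ((checkColour 1).run (s₂.setReg 19 1)).arr 10 = s₂.arr 10 := run_arr_eq rfl
  have hcheck : (complete.run s).reg 19 ≠ 0 ↔
      ∀ c, c = 1 ∨ c = 2 → ∀ v ∈ V(G), v ∈ G.reach (G.cls (s₂.arr 10) c) (s.reg 2) := by
    rw [hrun, checkColour_spec hG₄ (by rwa [r4]), checkColour_spec hG₃ (by rwa [r3]), r3, r4, a4,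
      State.setReg_reg_self, State.setReg_arr]
    constructor
    · rintro ⟨⟨-, h1⟩, h2⟩ c (rfl | rfl)
      · exact h1
      · exact h2
    · exact fun h => ⟨⟨one_ne_zero, h 1 (Or.inl rfl)⟩, h 2 (Or.inr rfl)⟩
  have hcomp : (complete.run s).reg 19 ≠ 0 → G.Completes (G.cls (s.arr 11) 1)
      (G.cls (s.arr 11) 2) (G.cls ((complete.run s).arr 10) 1)
      (G.cls ((complete.run s).arr 10) 2) := by
    rw [hcheck, h10]
    exact fun h => hF₂.completes_of_reach h
  refine ⟨⟨fun h => ⟨_, _, hcomp h⟩, fun h => hcheck.2 ?_⟩, hcomp⟩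
  have hc := hF₂.completes hG.finite_edges hno h
  rintro c (rfl | rfl) v hv
  · exact hc.left.conn _ hr v hv
  · exact hc.right.conn _ hr v hv

/-! ### Adding an edge to a certificate -/

/-- Count the marked vertices. -/
def countMarked : ForProg :=
  .seq (.assign 21 (.const 0))
    (.loop 13 .verts (.ite (.get 8 (.reg 13)) (.assign 21 (.add (.reg 21) (.const 1))) .skip))

lemma countMarked_spec (hG : Encodes G s) {A : Set ℕ} (hA : A ⊆ V(G))
    (h : ∀ v ∈ V(G), s.arr 8 v ≠ 0 ↔ v ∈ A) : (countMarked.run s).reg 21 = A.ncard := by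
  have hl := loop_induction (x := 13) (b := .verts) (s := s.setReg 21 0) (N := s.reg 0)
    (p := .ite (.get 8 (.reg 13)) (.assign 21 (.add (.reg 21) (.const 1))) .skip)
    (State.setReg_reg_of_ne _ _ _ _ (by norm_num)) (fun i t =>
      t.reg 21 = ((Finset.range i).filter fun v => s.arr 8 v ≠ 0).card)
    (by rw [State.setReg_reg_of_ne _ _ _ _ (by norm_num), State.setReg_reg_self]; rfl) (by
      intro i _ t t13 hA hI
      have a8 : t.arr 8 = s.arr 8 := hA.arr 8 rfl
      rw [State.setReg_reg_of_ne _ _ _ _ (by norm_num), run_ite, Finset.range_add_one,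
        Finset.filter_insert]
      have hcond : (Expr.get 8 (.reg 13)).eval t = s.arr 8 i := by simp only [Expr.eval, t13, a8]
      rw [hcond]
      by_cases h8 : s.arr 8 i ≠ 0
      · rw [if_pos h8, if_pos h8, Finset.card_insert_of_notMem (by simp)]
        simp [run, Expr.eval, hI]
      · rw [if_neg h8, if_neg h8]
        exact hI)
  have hset : A = ↑((Finset.range (s.reg 0)).filter fun v => s.arr 8 v ≠ 0) := by
    ext v
    rw [Finset.coe_filter, Set.mem_ofPred_eq, Finset.mem_range]
    constructor
    · exact fun hv => ⟨hG.mem_verts.1 (hA hv), (h v (hA hv)).2 hv⟩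
    · exact fun hv => (h v (hG.mem_verts.2 hv.1)).1 hv.2
  rw [hset, Set.ncard_coe_finset]
  exact hl

/-- Search for the branch of the vertex held by the register `22` in the tree of colour `c`. -/
def branchSearch (c : ℕ) : ForProg :=
  .seq (.loop 8 .edges (.ite (.neq (.get 11 (.reg 8)) (.const c)) (.store 9 (.reg 8) (.const 0))
      (.ite (.neq (.get 0 (.reg 8)) (.reg 2))
        (.ite (.neq (.get 1 (.reg 8)) (.reg 2)) (.store 9 (.reg 8) (.const 1))
          (.store 9 (.reg 8) (.const 0)))
        (.store 9 (.reg 8) (.const 0)))))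
    (.seq (.assign 4 (.reg 22)) search)

lemma branchSearch_spec (hG : Encodes G s) (h22 : s.reg 22 ∈ V(G)) :
    ∀ v ∈ V(G), (((branchSearch c).run s).arr 8 v ≠ 0 ↔
      v ∈ G.branch (G.cls (s.arr 11) c) (s.reg 2) (s.reg 22)) := by
  obtain ⟨s₁, hs₁⟩ : ∃ s₁, s₁ = (loop 8 .edges (.ite (.neq (.get 11 (.reg 8)) (.const c))
      (.store 9 (.reg 8) (.const 0)) (.ite (.neq (.get 0 (.reg 8)) (.reg 2))
        (.ite (.neq (.get 1 (.reg 8)) (.reg 2)) (.store 9 (.reg 8) (.const 1))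
          (.store 9 (.reg 8) (.const 0)))
        (.store 9 (.reg 8) (.const 0))))).run s := ⟨_, rfl⟩
  have hfill : ∀ i < s.reg 1, s₁.arr 9 i =
      if s.arr 11 i = c ∧ s.arr 0 i ≠ s.reg 2 ∧ s.arr 1 i ≠ s.reg 2 then 1 else 0 := by
    rw [hs₁]
    refine loop_fill (b := .edges) (s := s) rfl 9
      (fun i => if s.arr 11 i = c ∧ s.arr 0 i ≠ s.reg 2 ∧ s.arr 1 i ≠ s.reg 2 then 1 else 0) ?_
    intro i _ s' hx hA _
    have a11 : s'.arr 11 = s.arr 11 := hA.arr 11 rfl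
    have a0 : s'.arr 0 = s.arr 0 := hA.arr 0 rfl
    have a1 : s'.arr 1 = s.arr 1 := hA.arr 1 rfl
    have r2 : s'.reg 2 = s.reg 2 := hA.reg 2 (by norm_num) rfl
    simp only [run_ite, Expr.eval_neq_ne_zero]
    simp only [run, Expr.eval, hx, a11, a0, a1, r2]
    by_cases h1 : s.arr 11 i = c <;> by_cases h2 : s.arr 0 i = s.reg 2 <;>
      by_cases h3 : s.arr 1 i = s.reg 2 <;> simp [h1, h2, h3]
  have hr₁ : ∀ y, y ≠ 8 → s₁.reg y = s.reg y := by
    intro y hy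
    rw [hs₁]
    exact run_reg_eq (by simpa [writesReg] using hy.symm)
  have ha : ∀ a, a ≠ 9 → s₁.arr a = s.arr a := by
    intro a ha
    rw [hs₁]
    exact run_arr_eq (by simpa [writesArr] using ha.symm)
  have hG₁ : Encodes G s₁ := hG.congr (hr₁ 0 (by norm_num)) (hr₁ 1 (by norm_num))
    (ha 0 (by norm_num)) (ha 1 (by norm_num))
  have hrun : (branchSearch c).run s = search.run (s₁.setReg 4 (s₁.reg 22)) := by
    rw [hs₁]; rfl
  have h2 : (s₁.setReg 4 (s₁.reg 22)).reg 4 = s.reg 22 := by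
    rw [State.setReg_reg_self, hr₁ 22 (by norm_num)]
  have hmark : marked G (s₁.setReg 4 (s₁.reg 22)) =
      G.cls (s.arr 11) c \ G.incidenceSet (s.reg 2) := by
    ext i
    simp only [marked, Graph.cls, Set.mem_ofPred_eq, State.setReg_arr, Set.mem_sdiff, and_assoc,
      Graph.mem_incidenceSet]
    refine and_congr_right fun hi => ?_
    rw [hfill i (hG.mem_edges.1 hi)]
    have hl := hG.link i (hG.mem_edges.1 hi)
    have hinc : G.Inc i (s.reg 2) ↔ s.arr 0 i = s.reg 2 ∨ s.arr 1 i = s.reg 2 := by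
      constructor
      · intro h
        exact (h.eq_or_eq_of_isLink hl).imp Eq.symm Eq.symm
      · rintro (h | h)
        · exact h ▸ hl.inc_left
        · exact h ▸ hl.inc_right
    rw [hinc, not_or]
    by_cases hc : s.arr 11 i = c ∧ s.arr 0 i ≠ s.reg 2 ∧ s.arr 1 i ≠ s.reg 2 <;> simp [hc]
  have hspec := search_spec (hG₁.setReg (x := 4) (v := s₁.reg 22) (by norm_num)) (by rwa [h2])
  rw [h2, hmark, ← hrun] at hspec
  exact fun v hv => (hspec v hv).1

/-- Add the edge held by the register `20` to the certificate of colour `c` if the branch of its end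
held by the register `22` is small and the result can be completed. -/
def tryLink (c : ℕ) : ForProg :=
  .seq (.store 11 (.reg 20) (.const c))
    (.seq (branchSearch c) (.seq countMarked
      (.ite (.sub (.reg 3) (.reg 21))
        (.seq complete (.ite (.reg 19) .skip (.store 11 (.reg 20) (.const 0))))
        (.store 11 (.reg 20) (.const 0)))))

/-- Add the edge held by the register `20` to the certificate of colour `c` if possible. -/
def tryEdge (c : ℕ) : ForProg :=
  .ite (.get 11 (.reg 20)) .skip
    (.seq (colourSearch 11 c) (.seq countMarked
      (.ite (.sub (.add (.reg 3) (.reg 3)) (.add (.reg 21) (.const 1)))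
        (.ite (.neq (.get 8 (.get 0 (.reg 20))) (.get 8 (.get 1 (.reg 20))))
          (.seq (.ite (.get 8 (.get 0 (.reg 20))) (.assign 22 (.get 1 (.reg 20)))
              (.assign 22 (.get 0 (.reg 20))))
            (tryLink c))
          .skip)
        .skip)))

end ForProg

end RAM

namespace Graph

variable {α β : Type*} {G : Graph α β} {lock : β → ℕ} {r v w : α} {k c : ℕ} {e : β}

open Classical in
-- Only one end of `e` lies in the tree, so the orientation in `Extends.link` is forced.
lemma extends_iff (h0 : lock e = 0) (hlt : G.size r lock c < 2 * k - 2) (hl : G.IsLink e v w)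
    (hv : v ∈ G.reach (G.cls lock c) r) (hw : w ∉ G.reach (G.cls lock c) r) :
    G.Extends r k lock c e ↔
      (G.branch (G.cls (Function.update lock e c) c) r w).ncard ≤ k - 1 ∧
      G.Completable (G.cls (Function.update lock e c) 1) (G.cls (Function.update lock e c) 2) := by
  refine ⟨fun h => ⟨?_, h.completable⟩, fun h => ⟨h0, hlt, ⟨v, w, hl, hv, hw, h.1⟩, h.2⟩⟩
  obtain ⟨v', w', hl', hv', hw', hb⟩ := h.link
  rcases hl'.eq_and_eq_or_eq_and_eq hl with ⟨rfl, rfl⟩ | ⟨rfl, rfl⟩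
  · exact hb
  · exact absurd hv' hw

end Graph

namespace RAM

namespace ForProg

variable {G : Graph ℕ ℕ} {s : State} {c : ℕ}

lemma tryLink_spec (hc : c = 1 ∨ c = 2) (hG : Encodes G s) (hr : s.reg 2 ∈ V(G))
    (hk : 1 ≤ s.reg 3) (hgood : G.IsGood (s.reg 2) (s.reg 3) (s.arr 11)) {e v : ℕ}
    (he : s.reg 20 = e) (h0 : s.arr 11 e = 0)
    (hlt : G.size (s.reg 2) (s.arr 11) c < 2 * s.reg 3 - 2) (hl : G.IsLink e v (s.reg 22))
    (hv : v ∈ G.reach (G.cls (s.arr 11) c) (s.reg 2))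
    (hw : s.reg 22 ∉ G.reach (G.cls (s.arr 11) c) (s.reg 2)) :
    (G.Extends (s.reg 2) (s.reg 3) (s.arr 11) c e ∧
      ((tryLink c).run s).arr 11 = Function.update (s.arr 11) e c) ∨
    (¬ G.Extends (s.reg 2) (s.reg 3) (s.arr 11) c e ∧ ((tryLink c).run s).arr 11 = s.arr 11) := by
  classical
  have hiff : G.Extends (s.reg 2) (s.reg 3) (s.arr 11) c e ↔
      (G.branch (G.cls (Function.update (s.arr 11) e c) c) (s.reg 2) (s.reg 22)).ncard ≤
        s.reg 3 - 1 ∧ G.Completable (G.cls (Function.update (s.arr 11) e c) 1)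
          (G.cls (Function.update (s.arr 11) e c) 2) := by
    convert Graph.extends_iff h0 hlt hl hv hw
  obtain ⟨s₁, hs₁⟩ : ∃ s₁, s₁ = s.setArr 11 (s.reg 20) c := ⟨_, rfl⟩
  have a11 : s₁.arr 11 = Function.update (s.arr 11) e c := by
    rw [hs₁, State.setArr_arr_self, he]
  have hr₁ : s₁.reg = s.reg := by rw [hs₁]; rfl
  have hG₁ : Encodes G s₁ := by
    rw [hs₁]
    exact hG.congr rfl rfl (State.setArr_arr_of_ne _ _ _ _ _ (by norm_num))
      (State.setArr_arr_of_ne _ _ _ _ _ (by norm_num))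
  obtain ⟨s₂, hs₂⟩ : ∃ s₂, s₂ = (branchSearch c).run s₁ := ⟨_, rfl⟩
  have hG₂ : Encodes G s₂ := by rw [hs₂]; exact hG₁.run rfl rfl rfl
  have hmark := branchSearch_spec (c := c) hG₁ (by rw [hr₁]; exact hl.right_mem)
  rw [← hs₂, a11, hr₁] at hmark
  have hsub : G.branch (G.cls (Function.update (s.arr 11) e c) c) (s.reg 2) (s.reg 22) ⊆ V(G) :=
    Graph.reach_subset hl.right_mem
  have hcount := countMarked_spec hG₂ hsub hmark
  obtain ⟨s₃, hs₃⟩ : ∃ s₃, s₃ = countMarked.run s₂ := ⟨_, rfl⟩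
  rw [← hs₃] at hcount
  have hG₃ : Encodes G s₃ := by rw [hs₃]; exact hG₂.run rfl rfl rfl
  have r2 : s₃.reg 2 = s.reg 2 := by
    rw [hs₃, run_reg_eq rfl, hs₂, run_reg_eq rfl, hr₁]
  have r3 : s₃.reg 3 = s.reg 3 := by
    rw [hs₃, run_reg_eq rfl, hs₂, run_reg_eq rfl, hr₁]
  have r20 : s₃.reg 20 = e := by
    rw [hs₃, run_reg_eq rfl, hs₂, run_reg_eq rfl, hr₁, he]
  have b11 : s₃.arr 11 = Function.update (s.arr 11) e c := by
    rw [hs₃, run_arr_eq rfl, hs₂, run_arr_eq rfl, a11]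
  have hrun : (tryLink c).run s = (ite (.sub (.reg 3) (.reg 21))
      (.seq complete (.ite (.reg 19) .skip (.store 11 (.reg 20) (.const 0))))
      (.store 11 (.reg 20) (.const 0))).run s₃ := by
    rw [hs₃, hs₂, hs₁]; rfl
  -- The edge was unlocked before, so storing `0` restores the array.
  have hundo : ∀ t : State, t.reg 20 = e → t.arr 11 = Function.update (s.arr 11) e c →
      ((store 11 (.reg 20) (.const 0)).run t).arr 11 = s.arr 11 := by
    intro t ht ht'
    simp only [run, State.setArr_arr_self, Expr.eval, ht, ht', Function.update_idem]
    rw [← h0, Function.update_eq_self]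
  rw [hrun, run_ite]
  have hcond : (Expr.sub (.reg 3) (.reg 21)).eval s₃ ≠ 0 ↔
      (G.branch (G.cls (Function.update (s.arr 11) e c) c) (s.reg 2) (s.reg 22)).ncard ≤
        s.reg 3 - 1 := by
    simp only [Expr.eval, r3, hcount]
    omega
  by_cases hb : (G.branch (G.cls (Function.update (s.arr 11) e c) c) (s.reg 2)
      (s.reg 22)).ncard ≤ s.reg 3 - 1
  · rw [if_pos (hcond.2 hb), run_seq, run_ite]
    have hself : G.cls (Function.update (s.arr 11) e c) c = insert e (G.cls (s.arr 11) c) := by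
      convert Graph.cls_update_self hl.edge_mem
    have hcert := hb
    -- Once the branch is known to be small, the tentative class is a partial certificate; in
    -- particular it is a forest, as the completion routine requires.
    rw [hself] at hcert
    have hcert := ((hgood.cert c hc).insert_edge hG.finite_verts hr hl hv hw hlt hcert).1
    rw [← hself] at hcert
    have hspec := (complete_spec hG₃ (by rwa [r2]) (by
      rw [b11]
      intro f hf
      by_cases hfe : f = e
      · subst hfe
        rw [Function.update_self]
        omega
      · rw [Function.update_of_ne hfe]
        exact hgood.le_two f hf) (by
      intro c' hc'
      rw [b11]
      by_cases hcc : c' = c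
      · subst hcc
        exact hcert.tree.forest
      · have : G.cls (Function.update (s.arr 11) e c) c' = G.cls (s.arr 11) c' := by
          convert Graph.cls_update_eq hcc (by omega) h0
        rw [this]
        exact (hgood.cert c' hc').tree.forest)).1
    have h20 : (complete.run s₃).reg 20 = e := by rw [run_reg_eq rfl, r20]
    have h11 : (complete.run s₃).arr 11 = Function.update (s.arr 11) e c := by
      rw [run_arr_eq rfl, b11]
    rw [b11] at hspec
    generalize complete.run s₃ = s₄ at hspec h20 h11 ⊢
    have h19 : (Expr.reg 19).eval s₄ = s₄.reg 19 := rfl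
    rw [h19]
    by_cases hco : s₄.reg 19 ≠ 0
    · left
      rw [if_pos hco]
      exact ⟨hiff.2 ⟨hb, hspec.1 hco⟩, h11⟩
    · right
      rw [if_neg hco]
      exact ⟨fun h => hco (hspec.2 (hiff.1 h).2), hundo _ h20 h11⟩
  · right
    rw [if_neg fun h => hb (hcond.1 h)]
    exact ⟨fun h => hb (hiff.1 h).1, hundo _ r20 b11⟩

lemma tryEdge_spec (hc : c = 1 ∨ c = 2) (hG : Encodes G s) (hr : s.reg 2 ∈ V(G))
    (hk : 1 ≤ s.reg 3) (hgood : G.IsGood (s.reg 2) (s.reg 3) (s.arr 11)) {e : ℕ}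
    (he : s.reg 20 = e) (heE : e ∈ E(G)) :
    (G.Extends (s.reg 2) (s.reg 3) (s.arr 11) c e ∧
      ((tryEdge c).run s).arr 11 = Function.update (s.arr 11) e c) ∨
    (¬ G.Extends (s.reg 2) (s.reg 3) (s.arr 11) c e ∧ ((tryEdge c).run s).arr 11 = s.arr 11) := by
  rw [tryEdge, run_ite]
  by_cases h0 : s.arr 11 e = 0
  swap
  · right
    rw [if_pos (by simpa only [Expr.eval, he] using h0)]
    exact ⟨fun h => h0 h.unlocked, rfl⟩
  rw [if_neg (by simpa only [Expr.eval, he, not_not] using h0), run_seq, run_seq]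
  have hmark := colourSearch_spec (a := 11) (c := c) (by norm_num) hG hr
  obtain ⟨s₁, hs₁⟩ : ∃ s₁, s₁ = (colourSearch 11 c).run s := ⟨_, rfl⟩
  have hG₁ : Encodes G s₁ := by rw [hs₁]; exact hG.run rfl rfl rfl
  rw [← hs₁] at hmark ⊢
  have hcount := countMarked_spec hG₁ (Graph.reach_subset hr) fun v hv => (hmark v hv).1
  obtain ⟨s₂, hs₂⟩ : ∃ s₂, s₂ = countMarked.run s₁ := ⟨_, rfl⟩
  rw [← hs₂] at hcount ⊢
  have hG₂ : Encodes G s₂ := by rw [hs₂]; exact hG₁.run rfl rfl rfl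
  have r2 : s₂.reg 2 = s.reg 2 := by rw [hs₂, run_reg_eq rfl, hs₁, run_reg_eq rfl]
  have r3 : s₂.reg 3 = s.reg 3 := by rw [hs₂, run_reg_eq rfl, hs₁, run_reg_eq rfl]
  have r20 : s₂.reg 20 = e := by rw [hs₂, run_reg_eq rfl, hs₁, run_reg_eq rfl, he]
  have a0 : s₂.arr 0 = s.arr 0 := by rw [hs₂, run_arr_eq rfl, hs₁, run_arr_eq rfl]
  have a1 : s₂.arr 1 = s.arr 1 := by rw [hs₂, run_arr_eq rfl, hs₁, run_arr_eq rfl]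
  have a11 : s₂.arr 11 = s.arr 11 := by rw [hs₂, run_arr_eq rfl, hs₁, run_arr_eq rfl]
  have a8 : s₂.arr 8 = s₁.arr 8 := by rw [hs₂, run_arr_eq rfl]
  rw [← a8] at hmark
  have hl := hG.link e (hG.mem_edges.1 heE)
  have hsize : (G.reach (G.cls (s.arr 11) c) (s.reg 2)).ncard =
      G.size (s.reg 2) (s.arr 11) c + 1 :=
    (Set.ncard_sdiff_singleton_add_one (Graph.Conn.refl _)
      (hG.finite_verts.subset (Graph.reach_subset hr))).symm
  rw [run_ite]
  -- Register `21` counts the root as well, so the tested number is the truncated difference of `2k`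
  -- and the size plus `2`.
  have hcond : (Expr.sub (.add (.reg 3) (.reg 3)) (.add (.reg 21) (.const 1))).eval s₂ ≠ 0 ↔
      G.size (s.reg 2) (s.arr 11) c < 2 * s.reg 3 - 2 := by
    simp only [Expr.eval, r3, hcount, hsize]
    omega
  by_cases hlt : G.size (s.reg 2) (s.arr 11) c < 2 * s.reg 3 - 2
  swap
  · right
    rw [if_neg fun h => hlt (hcond.1 h)]
    exact ⟨fun h => hlt h.size_lt, a11⟩
  rw [if_pos (hcond.2 hlt), run_ite]
  have hcond' : (Expr.neq (.get 8 (.get 0 (.reg 20))) (.get 8 (.get 1 (.reg 20)))).eval s₂ ≠ 0 ↔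
      s₂.arr 8 (s.arr 0 e) ≠ s₂.arr 8 (s.arr 1 e) := by
    rw [Expr.eval_neq_ne_zero]
    simp only [Expr.eval, r20, a0, a1]
  have ht := hmark _ hl.left_mem
  have hh := hmark _ hl.right_mem
  -- Marks are `0` or `1`, so they differ exactly when one end of the edge is in the tree and the
  -- other is not.
  by_cases hne : s₂.arr 8 (s.arr 0 e) ≠ s₂.arr 8 (s.arr 1 e)
  swap
  · right
    rw [if_neg fun h => hne (hcond'.1 h)]
    refine ⟨fun h => ?_, a11⟩
    rw [not_not] at hne
    rw [hne] at ht
    have hiff := ht.1.symm.trans hh.1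
    obtain ⟨v, w, hl', hv, hw, -⟩ := h.link
    rcases hl'.eq_and_eq_or_eq_and_eq hl with ⟨rfl, rfl⟩ | ⟨rfl, rfl⟩
    · exact hw (hiff.1 hv)
    · exact hw (hiff.2 hv)
  rw [if_pos (hcond'.2 hne), run_seq]
  have hfin : ∀ v w, G.IsLink e v w → v ∈ G.reach (G.cls (s.arr 11) c) (s.reg 2) →
      w ∉ G.reach (G.cls (s.arr 11) c) (s.reg 2) →
      (G.Extends (s.reg 2) (s.reg 3) (s.arr 11) c e ∧
        ((tryLink c).run (s₂.setReg 22 w)).arr 11 = Function.update (s.arr 11) e c) ∨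
      (¬ G.Extends (s.reg 2) (s.reg 3) (s.arr 11) c e ∧
        ((tryLink c).run (s₂.setReg 22 w)).arr 11 = s.arr 11) := by
    intro v w hl hv hw
    have e2 : (s₂.setReg 22 w).reg 2 = s.reg 2 := by
      rw [State.setReg_reg_of_ne _ _ _ _ (by norm_num), r2]
    have e3 : (s₂.setReg 22 w).reg 3 = s.reg 3 := by
      rw [State.setReg_reg_of_ne _ _ _ _ (by norm_num), r3]
    have e20 : (s₂.setReg 22 w).reg 20 = e := by
      rw [State.setReg_reg_of_ne _ _ _ _ (by norm_num), r20]
    have e22 : (s₂.setReg 22 w).reg 22 = w := State.setReg_reg_self _ _ _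
    have e11 : (s₂.setReg 22 w).arr 11 = s.arr 11 := a11
    have := tryLink_spec (s := s₂.setReg 22 w) (v := v) hc (hG₂.setReg (by norm_num))
      (by rwa [e2]) (by rwa [e3]) (by rwa [e2, e3, e11]) e20 (by rwa [e11])
      (by rwa [e2, e3, e11]) (by rwa [e22]) (by rwa [e2, e11]) (by rwa [e2, e11, e22])
    rwa [e2, e3, e11] at this
  rw [run_ite]
  have hcond'' : (Expr.get 8 (.get 0 (.reg 20))).eval s₂ = s₂.arr 8 (s.arr 0 e) := by
    simp only [Expr.eval, r20, a0]
  rw [hcond'']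
  by_cases h8 : s₂.arr 8 (s.arr 0 e) ≠ 0
  · rw [if_pos h8]
    have : (assign 22 (.get 1 (.reg 20))).run s₂ = s₂.setReg 22 (s.arr 1 e) := by
      simp only [run, Expr.eval, r20, a1]
    rw [this]
    refine hfin _ _ hl (ht.1.1 h8) fun h => ?_
    have h1 := hh.1.2 h
    have := ht.2
    have := hh.2
    omega
  · rw [if_neg h8]
    have : (assign 22 (.get 0 (.reg 20))).run s₂ = s₂.setReg 22 (s.arr 0 e) := by
      simp only [run, Expr.eval, r20, a0]
    rw [this]
    refine hfin _ _ hl.symm (hh.1.1 ?_) fun h => h8 (ht.1.2 h)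
    rw [not_not] at h8
    rw [h8] at hne
    exact hne.symm

end ForProg

end RAM

namespace RAM

namespace ForProg

variable {G : Graph ℕ ℕ} {s : State} {c : ℕ}

/-! ### The algorithm -/

/-- Try all edges once. -/
def sweep (c : ℕ) : ForProg := .loop 20 .edges (tryEdge c)

/-- If a sweep changes nothing, every edge was rejected for the same colouring, which
`IsGood.exists_extends` excludes unless the certificate is full. -/
lemma sweep_spec (hc : c = 1 ∨ c = 2) (hG : Encodes G s) (hr : s.reg 2 ∈ V(G))
    (hk : 1 ≤ s.reg 3) (hgood : G.IsGood (s.reg 2) (s.reg 3) (s.arr 11)) :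
    G.IsGood (s.reg 2) (s.reg 3) (((sweep c).run s).arr 11) ∧
      (∀ c', c' = 1 ∨ c' = 2 → c' ≠ c → G.size (s.reg 2) (((sweep c).run s).arr 11) c' =
        G.size (s.reg 2) (s.arr 11) c') ∧
      min (G.size (s.reg 2) (s.arr 11) c + 1) (2 * s.reg 3 - 2) ≤
        G.size (s.reg 2) (((sweep c).run s).arr 11) c := by
  have h := loop_induction (x := 20) (b := .edges) (s := s) (p := tryEdge c) rfl (fun i t =>
    G.IsGood (s.reg 2) (s.reg 3) (t.arr 11) ∧
      (∀ c', c' = 1 ∨ c' = 2 → c' ≠ c → G.size (s.reg 2) (t.arr 11) c' =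
        G.size (s.reg 2) (s.arr 11) c') ∧
      ((t.arr 11 = s.arr 11 ∧ ∀ e < i, ¬ G.Extends (s.reg 2) (s.reg 3) (s.arr 11) c e) ∨
        G.size (s.reg 2) (s.arr 11) c + 1 ≤ G.size (s.reg 2) (t.arr 11) c))
    ⟨hgood, fun _ _ _ => rfl, Or.inl ⟨rfl, by intros; omega⟩⟩ (by
      rintro i hi t t20 hA ⟨h1, h2, h3⟩
      have hGt : Encodes G t := hG.of_agrees hA rfl (by norm_num) rfl rfl
      have t2 : t.reg 2 = s.reg 2 := hA.reg 2 (by norm_num) rfl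
      have t3 : t.reg 3 = s.reg 3 := hA.reg 3 (by norm_num) rfl
      have hspec := tryEdge_spec hc hGt (by rwa [t2]) (by rwa [t3]) (by rwa [t2, t3]) t20
        (hG.mem_edges.2 hi)
      rw [t2, t3] at hspec
      rw [State.setReg_arr]
      rcases hspec with ⟨hex, h11⟩ | ⟨hex, h11⟩
      · rw [h11]
        obtain ⟨g1, g2, g3⟩ : G.IsGood (s.reg 2) (s.reg 3) (Function.update (t.arr 11) i c) ∧
            G.size (s.reg 2) (Function.update (t.arr 11) i c) c =
              G.size (s.reg 2) (t.arr 11) c + 1 ∧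
            ∀ c', c' = 1 ∨ c' = 2 → c' ≠ c →
              G.size (s.reg 2) (Function.update (t.arr 11) i c) c' =
                G.size (s.reg 2) (t.arr 11) c' := by
          convert h1.update hG.finite_verts hr hc hex
        refine ⟨g1, fun c' hc' hne => (g3 c' hc' hne).trans (h2 c' hc' hne), Or.inr ?_⟩
        rcases h3 with ⟨h3, -⟩ | h3
        · rw [g2, h3]
        · omega
      · rw [h11]
        refine ⟨h1, h2, h3.imp_left fun ⟨h5, h4⟩ => ⟨h5, fun e he => ?_⟩⟩
        rcases Nat.lt_succ_iff_lt_or_eq.1 he with he | rfl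
        · exact h4 e he
        · rwa [h5] at hex)
  refine ⟨h.1, h.2.1, ?_⟩
  rcases h.2.2 with ⟨h3, h4⟩ | h3
  · rw [sweep, h3]
    by_contra hlt
    obtain ⟨e, he, hex⟩ := hgood.exists_extends hG.finite_verts hG.finite_edges hr hc
      (c := c) (by omega)
    exact h4 e (hG.mem_edges.1 he) hex
  · exact (min_le_left _ _).trans h3

/-- Extend the certificate of colour `c` as far as possible. -/
def grow (c : ℕ) : ForProg := .loop 23 .verts (sweep c)

/-- Each sweep gains at least one vertex until the certificate is full, and there are `n ≥ 2k - 2`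
sweeps. -/
lemma grow_spec (hc : c = 1 ∨ c = 2) (hG : Encodes G s) (hr : s.reg 2 ∈ V(G))
    (hk : 1 ≤ s.reg 3) (hcard : 2 * s.reg 3 - 2 ≤ V(G).ncard)
    (hgood : G.IsGood (s.reg 2) (s.reg 3) (s.arr 11)) :
    G.IsGood (s.reg 2) (s.reg 3) (((grow c).run s).arr 11) ∧
      (∀ c', c' = 1 ∨ c' = 2 → c' ≠ c → G.size (s.reg 2) (((grow c).run s).arr 11) c' =
        G.size (s.reg 2) (s.arr 11) c') ∧
      2 * s.reg 3 - 2 ≤ G.size (s.reg 2) (((grow c).run s).arr 11) c := by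
  have h := loop_induction (x := 23) (b := .verts) (s := s) (p := sweep c) rfl (fun i t =>
    G.IsGood (s.reg 2) (s.reg 3) (t.arr 11) ∧
      (∀ c', c' = 1 ∨ c' = 2 → c' ≠ c → G.size (s.reg 2) (t.arr 11) c' =
        G.size (s.reg 2) (s.arr 11) c') ∧
      min i (2 * s.reg 3 - 2) ≤ G.size (s.reg 2) (t.arr 11) c)
    ⟨hgood, fun _ _ _ => rfl, by omega⟩ (by
      rintro i hi t - hA ⟨h1, h2, h3⟩
      have hGt : Encodes G t := hG.of_agrees hA rfl (by norm_num) rfl rfl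
      have t2 : t.reg 2 = s.reg 2 := hA.reg 2 (by norm_num) rfl
      have t3 : t.reg 3 = s.reg 3 := hA.reg 3 (by norm_num) rfl
      have hspec := sweep_spec hc hGt (by rwa [t2]) (by rwa [t3]) (by rwa [t2, t3])
      rw [t2, t3] at hspec
      rw [State.setReg_arr]
      refine ⟨hspec.1, fun c' hc' hne => (hspec.2.1 c' hc' hne).trans (h2 c' hc' hne), ?_⟩
      have := hspec.2.2
      omega)
  refine ⟨h.1, h.2.1, ?_⟩
  have hle := h.2.2
  rw [hG.ncard_verts] at hcard
  rw [grow]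
  change min (s.reg 0) _ ≤ _ at hle
  omega

/-- Read the given certificates. -/
def readInput : ForProg :=
  .loop 13 .edges (.store 11 (.reg 13)
    (.add (.get 3 (.reg 13)) (.add (.get 5 (.reg 13)) (.get 5 (.reg 13)))))

lemma readInput_spec : ∀ e < s.reg 1, (readInput.run s).arr 11 e =
    s.arr 3 e + (s.arr 5 e + s.arr 5 e) := by
  refine loop_fill (b := .edges) (s := s) rfl 11 (fun e => s.arr 3 e + (s.arr 5 e + s.arr 5 e)) ?_
  intro i _ t hx hA _
  have a3 : t.arr 3 = s.arr 3 := hA.arr 3 rfl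
  have a5 : t.arr 5 = s.arr 5 := hA.arr 5 rfl
  simp [run, Expr.eval, hx, a3, a5]

/-- Write the edges of colour `c` to the array `a`. -/
def writeOutput (a c : ℕ) : ForProg :=
  .loop 13 .edges (.store a (.reg 13) (.sub (.const 1) (.neq (.get 10 (.reg 13)) (.const c))))

lemma writeOutput_spec {a : ℕ} (ha : a ≠ 10) :
    ∀ e < s.reg 1, ((writeOutput a c).run s).arr a e ≠ 0 ↔ s.arr 10 e = c := by
  have h := loop_fill (b := .edges) (s := s) (x := 13)
    (p := .store a (.reg 13) (.sub (.const 1) (.neq (.get 10 (.reg 13)) (.const c))))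
    rfl a (fun e => 1 - ((s.arr 10 e - c) + (c - s.arr 10 e))) (by
      intro i _ t hx hA _
      have a10 : t.arr 10 = s.arr 10 := hA.arr 10 (by simpa [writesArr] using ha)
      simp [run, Expr.eval, Expr.neq, hx, a10])
  intro e he
  rw [writeOutput, h e he]
  -- The sum of the two truncated differences is the distance of the colours, and `1` minus it is
  -- nonzero only if they agree.
  omega

def main : ForProg :=
  .seq readInput (.seq (grow 1) (.seq (grow 2) (.seq complete
    (.seq (writeOutput 6 1) (writeOutput 7 2)))))

lemma main_spec (hG : Encodes G s) (hr : s.reg 2 ∈ V(G)) (hk : 1 ≤ s.reg 3)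
    (hcard : 2 * s.reg 3 - 2 ≤ (V(G) \ {s.reg 2}).ncard)
    (hgood : G.IsGood (s.reg 2) (s.reg 3) (readInput.run s |>.arr 11)) :
    ∃ T₁ T₂, HoldsOutput (main.run s) (s.reg 1) T₁ T₂ ∧
      G.IsSafePair (s.reg 2) (s.reg 3) T₁ T₂ := by
  have hcard' : 2 * s.reg 3 - 2 ≤ V(G).ncard :=
    hcard.trans (Set.ncard_le_ncard Set.sdiff_subset hG.finite_verts)
  obtain ⟨s₁, hs₁⟩ : ∃ s₁, s₁ = readInput.run s := ⟨_, rfl⟩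
  obtain ⟨s₂, hs₂⟩ : ∃ s₂, s₂ = (grow 1).run s₁ := ⟨_, rfl⟩
  obtain ⟨s₃, hs₃⟩ : ∃ s₃, s₃ = (grow 2).run s₂ := ⟨_, rfl⟩
  obtain ⟨s₄, hs₄⟩ : ∃ s₄, s₄ = complete.run s₃ := ⟨_, rfl⟩
  obtain ⟨s₅, hs₅⟩ : ∃ s₅, s₅ = (writeOutput 6 1).run s₄ := ⟨_, rfl⟩
  have hmain : main.run s = (writeOutput 7 2).run s₅ := by
    rw [hs₅, hs₄, hs₃, hs₂, hs₁]; rfl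
  rw [← hs₁] at hgood
  have hG₁ : Encodes G s₁ := by rw [hs₁]; exact hG.run rfl rfl rfl
  have hG₂ : Encodes G s₂ := by rw [hs₂]; exact hG₁.run rfl rfl rfl
  have hG₃ : Encodes G s₃ := by rw [hs₃]; exact hG₂.run rfl rfl rfl
  have r₁2 : s₁.reg 2 = s.reg 2 := by rw [hs₁]; exact run_reg_eq rfl
  have r₁3 : s₁.reg 3 = s.reg 3 := by rw [hs₁]; exact run_reg_eq rfl
  have r₂2 : s₂.reg 2 = s.reg 2 := by rw [hs₂, run_reg_eq rfl, r₁2]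
  have r₂3 : s₂.reg 3 = s.reg 3 := by rw [hs₂, run_reg_eq rfl, r₁3]
  have r₃2 : s₃.reg 2 = s.reg 2 := by rw [hs₃, run_reg_eq rfl, r₂2]
  have h₁ := grow_spec (c := 1) (Or.inl rfl) hG₁ (by rwa [r₁2]) (by rwa [r₁3]) (by rwa [r₁3])
    (by rwa [r₁2, r₁3])
  rw [r₁2, r₁3, ← hs₂] at h₁
  have h₂ := grow_spec (c := 2) (Or.inr rfl) hG₂ (by rwa [r₂2]) (by rwa [r₂3]) (by rwa [r₂3])
    (by rw [r₂2, r₂3]; exact h₁.1)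
  rw [r₂2, r₂3, ← hs₃] at h₂
  -- Growing the second certificate leaves the first one full.
  have hsize₁ : 2 * s.reg 3 - 2 ≤ G.size (s.reg 2) (s₃.arr 11) 1 := by
    rw [h₂.2.1 1 (Or.inl rfl) (by norm_num)]
    exact h₁.2.2
  have hco := complete_spec hG₃ (by rwa [r₃2]) h₂.1.le_two fun c hc => (h₂.1.cert c hc).tree.forest
  rw [← hs₄] at hco
  have hcompl := hco.2 (hco.1.2 h₂.1.completable)
  have hsafe := hcompl.isSafePair hG.finite_verts hr hk (h₂.1.cert 1 (Or.inl rfl))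
    (h₂.1.cert 2 (Or.inr rfl)) hsize₁ h₂.2.2
  refine ⟨_, _, ?_, hsafe⟩
  have r₄1 : s₄.reg 1 = s.reg 1 := by
    rw [hs₄, run_reg_eq rfl, hs₃, run_reg_eq rfl, hs₂, run_reg_eq rfl, hs₁, run_reg_eq rfl]
  have r₅1 : s₅.reg 1 = s.reg 1 := by rw [hs₅, run_reg_eq rfl, r₄1]
  have a10 : s₅.arr 10 = s₄.arr 10 := by rw [hs₅, run_arr_eq rfl]
  have a6 : (main.run s).arr 6 = s₅.arr 6 := by rw [hmain, run_arr_eq rfl]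
  have ho₁ := writeOutput_spec (s := s₄) (a := 6) (c := 1) (by norm_num)
  have ho₂ := writeOutput_spec (s := s₅) (a := 7) (c := 2) (by norm_num)
  rw [← hs₅, r₄1, ← a6] at ho₁
  rw [← hmain, r₅1, a10] at ho₂
  constructor
  · rw [Graph.edgeSet_restrict]
    ext e
    simp only [Graph.cls, Set.mem_inter_iff, Set.mem_ofPred_eq, hG.mem_edges]
    constructor
    · rintro ⟨-, he, h⟩
      exact ⟨he, (ho₁ e he).2 h⟩
    · rintro ⟨he, h⟩
      exact ⟨he, he, (ho₁ e he).1 h⟩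
  · rw [Graph.edgeSet_restrict]
    ext e
    simp only [Graph.cls, Set.mem_inter_iff, Set.mem_ofPred_eq, hG.mem_edges]
    constructor
    · rintro ⟨-, he, h⟩
      exact ⟨he, (ho₂ e he).2 h⟩
    · rintro ⟨he, h⟩
      exact ⟨he, he, (ho₂ e he).1 h⟩

end ForProg

/-! ### The initial memory and the theorem. -/

lemma encodes_inputState {n m r k : ℕ} {G X₁ X₂ : Graph ℕ ℕ} {tail head : ℕ → ℕ}
    (hV : V(G) = {v | v < n}) (hE : E(G) = {e | e < m})
    (hl : ∀ e < m, G.IsLink e (tail e) (head e)) :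
    Encodes G (inputState n m r k tail head X₁ X₂) := by
  refine ⟨hV, hE, fun e he => ?_⟩
  change e < m at he
  change G.IsLink e (if e < m then tail e else 0) (if e < m then head e else 0)
  rw [if_pos he, if_pos he]
  exact hl e he

end RAM

lemma Graph.isGood_of_isCompactCertificate {α β : Type*} {G X₁ X₂ : Graph α β} {r : α} {k : ℕ}
    {lock : β → ℕ} (hV : V(G).Finite) (hr : r ∈ V(G)) (hk : 1 ≤ k)
    (h₁ : G.IsCompactCertificate r k X₁) (h₂ : G.IsCompactCertificate r k X₂)
    (hc : G.IsCompletablePair X₁ X₂) (hlock : ∀ e ∈ E(G), lock e ≤ 2)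
    (hl₁ : ∀ e ∈ E(G), lock e = 1 ↔ e ∈ E(X₁)) (hl₂ : ∀ e ∈ E(G), lock e = 2 ↔ e ∈ E(X₂)) :
    G.IsGood r k lock := by
  have e₁ : G.cls lock 1 = E(X₁) := by
    ext e
    exact ⟨fun h => (hl₁ e h.1).1 h.2, fun h =>
      ⟨h₁.1.edgeSet_mono h, (hl₁ e (h₁.1.edgeSet_mono h)).2 h⟩⟩
  have e₂ : G.cls lock 2 = E(X₂) := by
    ext e
    exact ⟨fun h => (hl₂ e h.1).1 h.2, fun h =>
      ⟨h₂.1.edgeSet_mono h, (hl₂ e (h₂.1.edgeSet_mono h)).2 h⟩⟩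
  refine ⟨hlock, ?_, ?_⟩
  · rintro c (rfl | rfl)
    · rw [e₁]
      exact h₁.isPartialCertificate hV hk
    · rw [e₂]
      exact h₂.isPartialCertificate hV hk
  · rw [e₁, e₂]
    exact (Graph.isCompletablePair_iff ⟨r, hr⟩).1 hc

theorem lemma5p1 :
    (∀ (α : Type*) (β : Type*) (G : Graph α β) (r : α) (k : ℕ),
      V(G).Finite → E(G).Finite → G.Loopless → r ∈ V(G) → 1 ≤ k →
      2 * k - 2 ≤ (V(G) \ {r}).ncard →
      ((∃ T₁ T₂ : Graph α β, G.IsSafePair r k T₁ T₂) ↔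
        ∃ X₁ X₂ : Graph α β, G.IsCompactCertificate r k X₁ ∧ G.IsCompactCertificate r k X₂ ∧
          G.IsCompletablePair X₁ X₂)) ∧
    (∃ (P : RAM.Prog) (p : Polynomial ℕ),
      ∀ (n m r k : ℕ) (G : Graph ℕ ℕ) (tail head : ℕ → ℕ) (X₁ X₂ : Graph ℕ ℕ),
        V(G) = {v | v < n} → E(G) = {e | e < m} →
        (∀ e < m, G.IsLink e (tail e) (head e)) →
        G.Loopless → r ∈ V(G) → 1 ≤ k → 2 * k - 2 ≤ (V(G) \ {r}).ncard →
        G.IsCompactCertificate r k X₁ → G.IsCompactCertificate r k X₂ →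
        G.IsCompletablePair X₁ X₂ →
        ∃ (t : ℕ) (s : RAM.State) (T₁ T₂ : Graph ℕ ℕ),
          RAM.Runs P (RAM.inputState n m r k tail head X₁ X₂) t s ∧ t ≤ p.eval (n + m) ∧
          RAM.HoldsOutput s m T₁ T₂ ∧ G.IsSafePair r k T₁ T₂) := by
  refine ⟨fun α β G r k hV hE _ hr hk hcard => Graph.exists_isSafePair_iff hV hE hr hk hcard,
    RAM.ForProg.main.compile, RAM.ForProg.main.time, ?_⟩
  intro n m r k G tail head X₁ X₂ hV hE hl _ hr hk hcard h₁ h₂ hc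
  have hG := RAM.encodes_inputState (r := r) (k := k) (X₁ := X₁) (X₂ := X₂) hV hE hl
  obtain ⟨t, ht, hrun⟩ := RAM.ForProg.runs_compile (p := RAM.ForProg.main)
    (s := RAM.inputState n m r k tail head X₁ X₂) (N := n + m) rfl rfl
  -- An edge in both certificates would be read as colour `3`; a completable pair has none.
  have hdisj : Disjoint E(X₁) E(X₂) := by
    obtain ⟨T₁, T₂, -, -, hd, hs₁, hs₂⟩ := hc
    exact hd.mono hs₁ hs₂
  classical
  have hread : ∀ e ∈ E(G), (RAM.ForProg.readInput.run
      (RAM.inputState n m r k tail head X₁ X₂)).arr 11 e = (if e ∈ E(X₁) then 1 else 0) +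
        ((if e ∈ E(X₂) then 1 else 0) + if e ∈ E(X₂) then 1 else 0) := by
    intro e he
    rw [RAM.ForProg.readInput_spec e (hG.mem_edges.1 he)]
    simp only [RAM.inputState]
  have hdisj' : ∀ e, e ∈ E(X₁) → e ∉ E(X₂) := fun e h => Set.disjoint_left.1 hdisj h
  have hgood := Graph.isGood_of_isCompactCertificate (lock := (RAM.ForProg.readInput.run
      (RAM.inputState n m r k tail head X₁ X₂)).arr 11) hG.finite_verts hr hk h₁ h₂ hc
    (fun e he => by rw [hread e he]; have := hdisj' e; split_ifs <;> first | omega | tauto)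
    (fun e he => by rw [hread e he]; have := hdisj' e; split_ifs <;> simp_all)
    (fun e he => by rw [hread e he]; have := hdisj' e; split_ifs <;> simp_all)
  obtain ⟨T₁, T₂, hout, hsafe⟩ := RAM.ForProg.main_spec hG hr hk hcard hgood
  exact ⟨t, _, T₁, T₂, hrun, ht, hout, hsafe⟩
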